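/- Let $G$ be an $n$-dimensional Lie group with Lie algebra $\mathfrak g$ and left Haar measure $dm$. Suppose that there is an open neighbourhood $\mathcal O$ of $0$ in $\mathfrak g$ such that $tX\in\mathcal O$ for all $X\in\mathcal O$, $-1\le t\le 1$; the exponential map restricts to a diffeomorphism of $\mathcal O$ onto the open set $\mathcal U=\exp(\mathcal O)$; $G\setminus\mathcal U$ has measure zero; and $\exp^{-1}\colon\mathcal U\to\mathcal O$ maps sets with compact closure in $G$ to sets with compact closure in $\mathfrak g$. Let $\hbar\in\mathbb R\setminus\{0\}$ and $M=G\times\mathfrak g^*$. Let $dX$ be the measure on $\mathfrak g$ induced by the value at the unit of the left invariant volume form of $dm$, let $dp$ be the measure on $\mathfrak g^*$ that is dual to $dX$ under Fourier inversion $u(X)=(2\pi)^{-n}\int_{\mathfrak g^*}\big(\int_{\mathfrak g}u(Y)e^{-i\langle p,Y\rangle}\,dY\big)e^{i\langle p,X\rangle}\,dp$, and put $dl=|2\pi\hbar|^{-n}\,dm\,dp$ on $M$. The inverse momentum Fourier transform of $\tilde f$ is $f(q,p)=\int_{\mathfrak g}\tilde f(q,X)e^{-\frac i\hbar\langle p,X\rangle}\,dX$;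 it extends to an isometry of $L^2(G\times\mathfrak g,dm\,dX)$ into $L^2(M,dl)$. Let $\mathcal L(M)\subset L^2(M,dl)$ be the image of the functions in $L^2(G\times\mathfrak g,dm\,dX)$ with support in $G\times\overline{\mathcal O}$. Put $\phi(x)=(1-e^{-x})/x$, $F(X)=\sqrt{|\det\phi(\mathrm{ad}_X)\det\mathrm{Ad}_{\exp(X/2)}|}$ and $V_a(b)=\exp^{-1}(a^{-1}b)$ for $a^{-1}b\in\mathcal U$. Let $\mathcal F(M)\subset\mathcal L(M)$ be the space of inverse momentum Fourier transforms of the functions $\tilde f$ on $G\times\mathfrak g$, vanishing outside $G\times\mathcal O$, for which $(a,b)\mapsto\tilde f\big(a\exp(\tfrac12V_a(b)),V_a(b)\big)F(V_a(b))^{-1}$, defined for $a^{-1}b\in\mathcal U$, extends to a smooth compactly supported function on $G\times G$. For $X,Y\in\mathcal O$ with $\exp(X)\exp(Y)\in\mathcal U$ put $X\diamond Y=\exp^{-1}(\exp(X)\exp(Y))$ and $L(X,Y)=F(X)F(Y)/F(X\diamond Y)$; put $L(X,Y)=0$ for all other $X,Y$. For $f,g\in\mathcal F(M)$ let $$(f\star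 g)(q,p)=\int_{\mathfrak g\times\mathfrak g}\tilde f\big(q\exp(-\tfrac12(X\diamond Y))\exp(\tfrac12X),X\big)\,\tilde g\big(q\exp(\tfrac12(X\diamond Y))\exp(-\tfrac12Y),Y\big)\,e^{-\frac i\hbar\langle p,X\diamond Y\rangle}L(X,Y)\,dX\,dY ,$$ and extend $\star$ to $\mathcal L(M)$ by continuity in the $L^2$-norm. Let $\mathcal A(M)$ be the $C^*$-algebra obtained by completing $\mathcal L(M)$ in the norm $\|f\|=\sup\{\|f\star h\|_2 : h\in\mathcal L(M),\ \|h\|_2=1\}$, with product and involution extending $\star$ and complex conjugation by continuity. A state is a continuous linear functional $\Lambda$ on $\mathcal A(M)$ with $\|\Lambda\|=1$ and $\Lambda(\bar f\star f)\ge0$ for all $f\in\mathcal A(M)$; it is pure if it is an extreme point of the convex set of states. Let $\rho\in\mathcal L(M)$ and let $\Lambda_\rho$ be a state with $\Lambda_\rho(f)=\int_M f\cdot\rho\,dl$ for all $f\in\mathcal L(M)$. Then $\Lambda_\rho$ is pure if and only if $\rho\star\rho=\rho$. -/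

import Mathlib

open Set Filter Topology MeasureTheory
open scoped Manifold ContDiff ENNReal ComplexOrder

noncomputable section

namespace LieQuant

/-- The model space `ℝⁿ` of an `n`-dimensional manifold. The Lie algebra of a Lie group `G` modelled
on it, `GroupLieAlgebra (𝓡 n) G = T_e G`, has `ℝⁿ` as its underlying vector space. -/
abbrev E (n : ℕ) : Type := EuclideanSpace ℝ (Fin n)

section LieGroupBasics

variable {n : ℕ} {G : Type*} [Group G] [TopologicalSpace G] [ChartedSpace (E n) G]

/-- The Lie group exponential: `lexp X = γ 1`, where `γ` is the (unique) integral curve, with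
`γ 0 = e`, of the left invariant vector field determined by `X ∈ T_e G`. -/
def lexp (X : E n) : G :=
  open scoped Classical in
  if h : ∃ γ : ℝ → G, γ 0 = 1 ∧
      IsMIntegralCurve (I := 𝓡 n) γ
        (mulInvariantVectorField (I := 𝓡 n) (G := G) (X : GroupLieAlgebra (𝓡 n) G))
  then h.choose 1 else 1

variable (G) in
/-- `ad_X : Y ↦ [X, Y]` on the Lie algebra of `G`. -/
def adL [LieGroup (𝓡 n) ∞ G] (X : E n) : E n →L[ℝ] E n :=
  haveI : LieGroup (𝓡 n) (minSmoothness ℝ 3) G := by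
    rw [minSmoothness_of_isRCLikeNormedField]; infer_instance
  LinearMap.toContinuousLinearMap (E := E n) (F' := E n)
    (LieAlgebra.ad ℝ (GroupLieAlgebra (𝓡 n) G) X : E n →ₗ[ℝ] E n)

/-- `Ad_g`, the derivative at the unit of `h ↦ g h g⁻¹`. -/
def AdL (g : G) : E n →L[ℝ] E n :=
  (mfderiv (𝓡 n) (𝓡 n) (fun h : G => g * h * g⁻¹) 1 : E n →L[ℝ] E n)

variable (G) in
/-- `φ(ad_X)`, where `φ(x) = (1 - e^{-x}) / x = ∑ (-1)^k x^k / (k+1)!`. -/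
def phiAd [LieGroup (𝓡 n) ∞ G] (X : E n) : E n →L[ℝ] E n :=
  ∑' k : ℕ, ((-1 : ℝ) ^ k / ((k + 1).factorial : ℝ)) • (adL G X) ^ k

variable (G) in
/-- `F(X) = √|det φ(ad_X) · det Ad_{exp(X/2)}|`. -/
def Fdens [LieGroup (𝓡 n) ∞ G] (X : E n) : ℝ :=
  Real.sqrt |(phiAd G X).det * (AdL (n := n) (lexp ((1 / 2 : ℝ) • X) : G)).det|

/-- `exp⁻¹ : 𝒰 → 𝒪`, the inverse of `exp` restricted to `𝒪` (a junk value outside `𝒰`). -/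
def llog (O : Set (E n)) (g : G) : E n := Function.invFunOn (lexp (G := G)) O g

variable (G) in
/-- The set `𝒱` of pairs in `𝒪 × 𝒪` with `exp(X) exp(Y) ∈ 𝒰`. -/
def bchDomain (O : Set (E n)) : Set (E n × E n) :=
  {z | z.1 ∈ O ∧ z.2 ∈ O ∧ (lexp z.1 * lexp z.2 : G) ∈ lexp (G := G) '' O}

variable (G) in
/-- `X ⋄ Y = exp⁻¹(exp(X) exp(Y))`. -/
def bch (O : Set (E n)) (X Y : E n) : E n := llog O (lexp X * lexp Y : G)

variable (G) in
/-- `L(X,Y) = F(X) F(Y) / F(X ⋄ Y)` on `𝒱`, and `0` elsewhere. -/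
def Lfac [LieGroup (𝓡 n) ∞ G] (O : Set (E n)) (X Y : E n) : ℝ :=
  open scoped Classical in
  if (X, Y) ∈ bchDomain G O then Fdens G X * Fdens G Y / Fdens G (bch G O X Y) else 0

/-- `G` is weakly exponential with respect to the neighbourhood `𝒪` of `0` in its Lie algebra:
`𝒪` is open, star-shaped and symmetric, `exp` is a diffeomorphism of `𝒪` onto the open set
`𝒰 = exp(𝒪)`, whose complement is of (Haar) measure zero, and `exp⁻¹ : 𝒰 → 𝒪` maps precompact sets
onto precompact sets. -/
structure IsWeaklyExponential [MeasurableSpace G] (m : Measure G) (O : Set (E n)) : Prop where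
  isOpen : IsOpen O
  zero_mem : (0 : E n) ∈ O
  star : ∀ X ∈ O, ∀ t : ℝ, -1 ≤ t → t ≤ 1 → t • X ∈ O
  injOn : InjOn (lexp (G := G)) O
  isOpen_image : IsOpen (lexp (G := G) '' O)
  smooth : ContMDiffOn 𝓘(ℝ, E n) (𝓡 n) ∞ (lexp (G := G)) O
  smooth_inv : ContMDiffOn (𝓡 n) 𝓘(ℝ, E n) ∞ (llog (G := G) O) (lexp (G := G) '' O)
  null_compl : m (lexp (G := G) '' O)ᶜ = 0
  precompact : ∀ S : Set G, S ⊆ lexp (G := G) '' O → IsCompact (closure S) →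
    IsCompact (closure (llog O '' S))

end LieGroupBasics

section Measures

variable {n : ℕ} {G : Type*} [Group G] [TopologicalSpace G] [ChartedSpace (E n) G]
  [MeasurableSpace G]

variable (n) in
/-- The density at the unit of the Haar measure `m`, read in exponential coordinates, with respect
to Lebesgue measure on `T_e G = ℝⁿ`. -/
def unitDensity (m : Measure G) : ℝ≥0∞ :=
  limUnder (𝓝[>] (0 : ℝ)) fun r =>
    m (lexp (n := n) (G := G) '' Metric.ball 0 r) / volume (Metric.ball (0 : E n) r)

variable (n) in
/-- The measure `dX` on the Lie algebra induced by the value at the unit of the left invariant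
volume form of `m`; it is the Lebesgue measure for which `dm(exp)/dX = 1` at `0`. -/
def measX (m : Measure G) : Measure (E n) := unitDensity n m • volume

variable (n) in
/-- The measure `dp` on the dual of the Lie algebra that corresponds to `dX` under Fourier inversion
`f(X) = (2π)⁻ⁿ ∫ (∫ f(Y) e^{-i⟨p,Y⟩} dY) e^{i⟨p,X⟩} dp`: if `dX` is `c` times the Lebesgue measure
in coordinates, then `dp` is `c⁻¹` times the Lebesgue measure in the dual coordinates. -/
def measP (m : Measure G) : Measure (StrongDual ℝ (E n)) :=
  (unitDensity n m)⁻¹ • (volume : Measure (E n)).map (InnerProductSpace.toDual ℝ (E n))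

variable (n) in
/-- The measure `dn = dm × dX` on `G × 𝔤`. -/
def measN (m : Measure G) : Measure (G × E n) := m.prod (measX n m)

variable (n) in
/-- The normalized Liouville measure `dl = (dm × dp) / |2πħ|ⁿ` on `M = G × 𝔤*`. -/
def measL (m : Measure G) (ħ : ℝ) : Measure (G × StrongDual ℝ (E n)) :=
  ENNReal.ofReal (|2 * Real.pi * ħ| ^ n)⁻¹ • m.prod (measP n m)

end Measures

section Spaces

variable {n : ℕ} {G : Type*} [Group G] [TopologicalSpace G] [ChartedSpace (E n) G]
  [MeasurableSpace G]

/-- The inverse momentum Fourier transform, `f(q,p) = ∫ u(q,X) e^{-(i/ħ)⟨p,X⟩} dX`, as an absolutely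
convergent integral. -/
def invFourier (m : Measure G) (ħ : ℝ) (u : G × E n → ℂ) (x : G × StrongDual ℝ (E n)) : ℂ :=
  ∫ X, u (x.1, X) * Complex.exp (-(Complex.I / (ħ : ℂ)) * ((x.2 X : ℝ) : ℂ)) ∂(measX n m)

variable (n) in
/-- The inverse momentum Fourier transform on `L²(G × 𝔤, dn)`: the (unique) continuous linear map
into `L²(M, dl)` that is given by the integral formula on `L¹ ∩ L²`. -/
def invFourierL2 (m : Measure G) (ħ : ℝ) :
    Lp ℂ 2 (measN n m) →L[ℂ] Lp ℂ 2 (measL n m ħ) :=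
  open scoped Classical in
  if h : ∃ T : Lp ℂ 2 (measN n m) →L[ℂ] Lp ℂ 2 (measL n m ħ),
      ∀ u : Lp ℂ 2 (measN n m), Integrable u (measN n m) →
        T u =ᵐ[measL n m ħ] invFourier m ħ u
  then h.choose else 0

/-- `L²(G × 𝒪, dn)`: the square integrable functions on `G × 𝔤` that vanish almost everywhere
outside `G × closure 𝒪`. -/
def L2O (m : Measure G) (O : Set (E n)) : Submodule ℂ (Lp ℂ 2 (measN n m)) where
  carrier := {u | ∀ᵐ z ∂(measN n m), z.2 ∉ closure O → u z = 0}
  zero_mem' := by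
    filter_upwards [Lp.coeFn_zero ℂ 2 (measN n m)] with z hz _
    exact hz
  add_mem' := by
    intro u v hu hv
    filter_upwards [hu, hv, Lp.coeFn_add u v] with z h1 h2 h3 hz
    exact h3.trans (by simp [h1 hz, h2 hz])
  smul_mem' := by
    intro c u hu
    filter_upwards [hu, Lp.coeFn_smul c u] with z h1 h2 hz
    exact h2.trans (by simp [h1 hz])

/-- The Hilbert space `𝓛(M) ⊆ L²(M, dl)`: the image of `L²(G × 𝒪, dn)` under the inverse momentum
Fourier transform. -/
def hilbL (m : Measure G) (O : Set (E n)) (ħ : ℝ) : Submodule ℂ (Lp ℂ 2 (measL n m ħ)) :=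
  (L2O m O).map (invFourierL2 n m ħ : Lp ℂ 2 (measN n m) →ₗ[ℂ] Lp ℂ 2 (measL n m ħ))

variable [LieGroup (𝓡 n) ∞ G]

/-- Membership in `𝓕~(M)`: `u` is supported on `G × 𝒪` and the function
`(a,b) ↦ u(a exp(V/2), V) F(V)⁻¹`, `V = exp⁻¹(a⁻¹ b)`, defined for `a⁻¹ b ∈ 𝒰`, extends to a smooth
compactly supported function on `G × G`. -/
def MemFTilde (O : Set (E n)) (u : G × E n → ℂ) : Prop :=
  (∀ (q : G) (X : E n), X ∉ O → u (q, X) = 0) ∧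
  ∃ k : G × G → ℂ, ContMDiff ((𝓡 n).prod (𝓡 n)) 𝓘(ℝ, ℂ) ∞ k ∧ HasCompactSupport k ∧
    ∀ a b : G, a⁻¹ * b ∈ lexp (n := n) (G := G) '' O →
      k (a, b) = u (a * lexp ((1 / 2 : ℝ) • llog O (a⁻¹ * b)), llog O (a⁻¹ * b)) *
        ((Fdens G (llog O (a⁻¹ * b)) : ℝ) : ℂ)⁻¹

/-- The star-product `f ⋆ g` on `𝓕(M)`, written in terms of the momentum Fourier transforms
`u = f~` and `v = g~` of `f` and `g`. -/
def starInt (m : Measure G) (O : Set (E n)) (ħ : ℝ) (u v : G × E n → ℂ)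
    (x : G × StrongDual ℝ (E n)) : ℂ :=
  ∫ z : E n × E n,
    u (x.1 * lexp (-(1 / 2 : ℝ) • bch G O z.1 z.2) * lexp ((1 / 2 : ℝ) • z.1), z.1) *
    v (x.1 * lexp ((1 / 2 : ℝ) • bch G O z.1 z.2) * lexp (-(1 / 2 : ℝ) • z.2), z.2) *
    Complex.exp (-(Complex.I / (ħ : ℂ)) * ((x.2 (bch G O z.1 z.2) : ℝ) : ℂ)) *
    ((Lfac G O z.1 z.2 : ℝ) : ℂ) ∂((measX n m).prod (measX n m))

/-- The star-product on the Hilbert space `𝓛(M)`: the (unique) continuous bilinear map that extends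
the star-product of `𝓕(M)`, the space of inverse momentum Fourier transforms of `𝓕~(M)`. -/
def starL (m : Measure G) (O : Set (E n)) (ħ : ℝ) :
    hilbL m O ħ →L[ℂ] hilbL m O ħ →L[ℂ] hilbL m O ħ :=
  open scoped Classical in
  if h : ∃ B : hilbL m O ħ →L[ℂ] hilbL m O ħ →L[ℂ] hilbL m O ħ,
      ∀ (u v : G × E n → ℂ), MemFTilde O u → MemFTilde O v → ∀ f g : hilbL m O ħ,
        (f : Lp ℂ 2 (measL n m ħ)) =ᵐ[measL n m ħ] invFourier m ħ u →
        (g : Lp ℂ 2 (measL n m ħ)) =ᵐ[measL n m ħ] invFourier m ħ v →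
        (B f g : Lp ℂ 2 (measL n m ħ)) =ᵐ[measL n m ħ] starInt m O ħ u v
  then h.choose else 0

/-- Complex conjugation on `𝓛(M)`. The space `𝓛(M)` is closed under complex conjugation, so the
first branch always applies. -/
def conjL (m : Measure G) (O : Set (E n)) (ħ : ℝ) (f : hilbL m O ħ) : hilbL m O ħ :=
  open scoped Classical in
  if h : star (f : Lp ℂ 2 (measL n m ħ)) ∈ hilbL m O ħ then ⟨star (f : Lp ℂ 2 (measL n m ħ)), h⟩
  else 0

/-- A copy of `𝓛(M)`, to carry the norm `‖f‖ = sup {‖f ⋆ h‖₂ : ‖h‖₂ = 1}` in place of the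
`L²`-norm. -/
def PreObs (m : Measure G) (O : Set (E n)) (ħ : ℝ) : Type _ := hilbL m O ħ

instance (m : Measure G) (O : Set (E n)) (ħ : ℝ) : AddCommGroup (PreObs m O ħ) :=
  inferInstanceAs (AddCommGroup (hilbL m O ħ))

instance (m : Measure G) (O : Set (E n)) (ħ : ℝ) : Module ℂ (PreObs m O ħ) :=
  inferInstanceAs (Module ℂ (hilbL m O ħ))

/-- `f ↦ (h ↦ f ⋆ h)`, from the copy of `𝓛(M)` to the bounded operators on the Hilbert space
`𝓛(M)`. -/
def leftMul (m : Measure G) (O : Set (E n)) (ħ : ℝ) :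
    PreObs m O ħ →ₗ[ℂ] (hilbL m O ħ →L[ℂ] hilbL m O ħ) :=
  (starL m O ħ : hilbL m O ħ →ₗ[ℂ] (hilbL m O ħ →L[ℂ] hilbL m O ħ))

/-- The norm of `f` is the operator norm of `h ↦ f ⋆ h` on `𝓛(M)`. -/
instance (m : Measure G) (O : Set (E n)) (ħ : ℝ) : SeminormedAddCommGroup (PreObs m O ħ) :=
  SeminormedAddCommGroup.induced (PreObs m O ħ) (hilbL m O ħ →L[ℂ] hilbL m O ħ) (leftMul m O ħ)

instance (m : Measure G) (O : Set (E n)) (ħ : ℝ) : NormedSpace ℂ (PreObs m O ħ) :=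
  NormedSpace.induced ℂ (PreObs m O ħ) (hilbL m O ħ →L[ℂ] hilbL m O ħ) (leftMul m O ħ)

/-- The `C*`-algebra of observables `𝓐(M)`: the completion of `𝓛(M)` in the norm above. -/
abbrev Obs (m : Measure G) (O : Set (E n)) (ħ : ℝ) : Type _ :=
  UniformSpace.Completion (PreObs m O ħ)

/-- The embedding of `𝓛(M)` in `𝓐(M)`. -/
def toObs (m : Measure G) (O : Set (E n)) (ħ : ℝ) (f : hilbL m O ħ) : Obs m O ħ :=
  @UniformSpace.Completion.coe' (PreObs m O ħ) _ f

/-- The star-product on `𝓐(M)`, the extension by continuity of the star-product on `𝓛(M)`. -/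
def mulObs (m : Measure G) (O : Set (E n)) (ħ : ℝ) (a b : Obs m O ħ) : Obs m O ħ :=
  (UniformSpace.Completion.isDenseInducing_coe.prodMap
    UniformSpace.Completion.isDenseInducing_coe).extend
    (fun z : PreObs m O ħ × PreObs m O ħ => toObs m O ħ (starL m O ħ z.1 z.2)) (a, b)

/-- The involution on `𝓐(M)`, the extension by continuity of complex conjugation on `𝓛(M)`. -/
def conjObs (m : Measure G) (O : Set (E n)) (ħ : ℝ) (a : Obs m O ħ) : Obs m O ħ :=
  UniformSpace.Completion.isDenseInducing_coe.extend
    (fun f : PreObs m O ħ => toObs m O ħ (conjL m O ħ f)) a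

/-- States: continuous linear functionals on `𝓐(M)` of norm `1` with `Λ(ā ⋆ a) ≥ 0` for every
`a ∈ 𝓐(M)`. -/
def states (m : Measure G) (O : Set (E n)) (ħ : ℝ) : Set (Obs m O ħ →L[ℂ] ℂ) :=
  {Λ | ‖Λ‖ = 1 ∧ ∀ a : Obs m O ħ, 0 ≤ Λ (mulObs m O ħ (conjObs m O ħ a) a)}

/-- `Λ` is the functional `Λ_ρ`, that is `Λ_ρ(f) = ∫_M f · ρ dl` on the dense subspace `𝓛(M)` of
`𝓐(M)`. -/
def IsFunctionalOf (m : Measure G) (O : Set (E n)) (ħ : ℝ) (ρ : hilbL m O ħ)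
    (Λ : Obs m O ħ →L[ℂ] ℂ) : Prop :=
  ∀ f : hilbL m O ħ, Λ (toObs m O ħ f) =
    ∫ x, (f : Lp ℂ 2 (measL n m ħ)) x * (ρ : Lp ℂ 2 (measL n m ħ)) x ∂(measL n m ħ)

end Spaces

end LieQuant

end

/-! The algebra 𝓛(M) is the algebra of Hilbert-Schmidt operators on L²(G) in disguise. In
exponential coordinates Haar measure has density |det φ(ad X)|, and right translation by exp(-X/2)
changes it by the factor |det Ad_{exp(X/2)}|. Hence the substitution (a, b) = (q exp(-X/2), q
exp(X/2)) carries F(X)² dm dX on G × 𝒪 to dm dm on G × G (`lintegral_symMap`). Multiplying a kernel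
k(a, b) by F and applying the isometric inverse Fourier transform (`inner_invFourier`) then gives a
unitary map of L²(G × G) onto 𝓛(M); surjectivity needs that the boundary of 𝒪 is a null set
(`volume_closure_diff`).

The kernel φ(a) conj ψ(b) becomes the rank one operator |φ⟩⟨ψ|. The factor L and the midpoints in
the star product are made so that ⋆ is composition of operators (`starInt_kerFun`), and complex
conjugation is the adjoint because F is even. So 𝓐(M) is the algebra of compact operators on L²(G),
and Λ_ρ(f) = ⟨conj f, ρ⟩ = tr(fρ). The structure `HSModel` records exactly what the purity argument
needs of this picture, and `hsModel` supplies it.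

Purity is then operator theory (`HSModel.mem_extremePoints_iff`). Positivity of the state makes the
operator of ρ positive; it is compact and nonzero, so it has a unit eigenvector φ with eigenvalue r
> 0. Compressing to the complement of φ writes Λ as r times the vector state of φ plus a positive
functional of norm at most 1 - r, and extremality forces Λ to be that vector state, so that ρ is a
rank one projection. Conversely, an idempotent positive ρ is a projection, of rank one because ‖Λ‖ =
1. If Λ is a convex combination of states, each of them vanishes wherever Λ does on positive
elements, so it depends on f only through ρfρ = Λ(f)ρ and equals Λ.

The analytic part rests on Ad_{exp X} = exp(ad X), on the formula φ(ad X) for the derivative of exp,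
and on uniqueness of Haar measure. -/

noncomputable section

namespace LieQuant

open InnerProductSpace

/-! ### Abstract algebras of Hilbert-Schmidt operators -/

section HilbertSchmidt

variable {K H : Type*} [NormedAddCommGroup K] [InnerProductSpace ℂ K] [CompleteSpace K]
  [NormedAddCommGroup H] [InnerProductSpace ℂ H]

/-- A Hilbert space `H` with a product `B` and an involution `C` that is a model of the algebra of
Hilbert-Schmidt operators on the Hilbert space `K`, the vector `e α β` being the operator
`ψ ↦ ⟪β, ψ⟫ α`. -/
structure HSModel (B : H →L[ℂ] H →L[ℂ] H) (C : H → H) (K : Type*) [NormedAddCommGroup K]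
    [InnerProductSpace ℂ K] [CompleteSpace K] where
  e : K → K → H
  Op : H →L[ℂ] K →L[ℂ] K
  Op_e : ∀ α β, Op (e α β) = rankOne ℂ α β
  inner_e : ∀ α β f, inner ℂ (e α β) f = inner ℂ α (Op f β)
  dense : Dense (Submodule.span ℂ (Set.range fun z : K × K => e z.1 z.2) : Set H)
  Op_mul : ∀ f g, Op (B f g) = Op f * Op g
  Op_conj : ∀ f, Op (C f) = ContinuousLinearMap.adjoint (Op f)

namespace HSModel

variable {B : H →L[ℂ] H →L[ℂ] H} {C : H → H} (M : HSModel B C K)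
include M

lemma ext_inner {f g : H} (h : ∀ α β, inner ℂ (M.e α β) f = inner ℂ (M.e α β) g) : f = g := by
  refine M.dense.eq_of_inner_right (𝕜 := ℂ) fun v hv => ?_
  induction hv using Submodule.span_induction with
  | mem x hx => obtain ⟨z, rfl⟩ := hx; exact h _ _
  | zero => simp
  | add x y _ _ hx hy => simp [inner_add_left, hx, hy]
  | smul c x _ hx => simp [inner_smul_left, hx]

/-- The matrix coefficients of the operator are the inner products with the total family `e α β`.
Algebraic identities in `H` can therefore be checked on operators. -/
lemma inj {f g : H} (h : M.Op f = M.Op g) : f = g :=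
  M.ext_inner fun α β => by rw [M.inner_e, M.inner_e, h]

lemma induction {p : H → Prop} (hcl : IsClosed {f | p f}) (he : ∀ α β, p (M.e α β))
    (h0 : p 0) (hadd : ∀ f g, p f → p g → p (f + g)) (hsmul : ∀ (c : ℂ) f, p f → p (c • f))
    (f : H) : p f := by
  refine hcl.closure_subset_iff.2 (fun v hv => ?_) (M.dense f)
  induction hv using Submodule.span_induction with
  | mem x hx => obtain ⟨z, rfl⟩ := hx; exact he _ _
  | zero => exact h0
  | add x y _ _ hx hy => exact hadd _ _ hx hy
  | smul c x _ hx => exact hsmul _ _ hx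

lemma mul_assoc' (f g h : H) : B (B f g) h = B f (B g h) :=
  M.inj (by simp only [M.Op_mul, mul_assoc])

lemma conj_conj (f : H) : C (C f) = f := M.inj (by simp [M.Op_conj])

lemma conj_mul (f g : H) : C (B f g) = B (C g) (C f) :=
  M.inj (by simp only [M.Op_conj, M.Op_mul, ← ContinuousLinearMap.star_eq_adjoint, star_mul])

lemma conj_add (f g : H) : C (f + g) = C f + C g := M.inj (by simp [M.Op_conj])

lemma conj_sub (f g : H) : C (f - g) = C f - C g := M.inj (by simp [M.Op_conj])

lemma conj_smul (c : ℂ) (f : H) : C (c • f) = (starRingEnd ℂ c) • C f :=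
  M.inj (by simp [M.Op_conj, ← ContinuousLinearMap.star_eq_adjoint])

lemma conj_e (α β : K) : C (M.e α β) = M.e β α := M.inj (by simp [M.Op_conj, M.Op_e])

lemma mul_e (f : H) (α β : K) : B f (M.e α β) = M.e (M.Op f α) β :=
  M.inj (by ext x; simp [M.Op_mul, M.Op_e])

lemma e_mul (f : H) (α β : K) :
    B (M.e α β) f = M.e α (ContinuousLinearMap.adjoint (M.Op f) β) :=
  M.inj (by ext x; simp [M.Op_mul, M.Op_e, ContinuousLinearMap.adjoint_inner_left])

/-- Left multiplication by `C f` is adjoint to left multiplication by `f`. -/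
lemma inner_conj_mul (f g h : H) : inner ℂ (B (C f) g) h = inner ℂ g (B f h) := by
  refine M.induction (p := fun g => inner ℂ (B (C f) g) h = inner ℂ g (B f h)) ?_ ?_ ?_ ?_ ?_ g
  · exact isClosed_eq (by fun_prop) (by fun_prop)
  · intro α β
    simp [M.mul_e, M.inner_e, M.Op_conj, M.Op_mul, ContinuousLinearMap.adjoint_inner_left]
  · simp
  · intro f g hf hg; simp [hf, hg]
  · intro c f hf; simp [hf]

/-- Together with `inner_conj_mul` this is cyclicity of the trace for the pairing ⟨g, h⟩ = tr(g* h).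
By continuity it suffices to test `g` on rank one elements. -/
lemma inner_mul_right (f g h : H) : inner ℂ (B g f) h = inner ℂ g (B h (C f)) := by
  refine M.induction (p := fun g => inner ℂ (B g f) h = inner ℂ g (B h (C f))) ?_ ?_ ?_ ?_ ?_ g
  · refine isClosed_eq (Continuous.inner ?_ continuous_const) (by fun_prop)
    exact (B.flip f).continuous
  · intro α β
    simp [M.e_mul, M.inner_e, M.Op_conj, M.Op_mul]
  · simp
  · intro f g hf hg; simp [hf, hg]
  · intro c f hf; simp [hf]

/-- Moving one factor across the inner product gives ‖f* h‖² = ⟨h, f (f* h)⟩ ≤ ‖h‖ ‖f‖ ‖f* h‖, the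
norm of `f` being that of left multiplication. -/
lemma norm_conj_le (f : H) : ‖B (C f)‖ ≤ ‖B f‖ := by
  refine ContinuousLinearMap.opNorm_le_bound _ (norm_nonneg _) fun h => ?_
  rcases eq_or_ne (B (C f) h) 0 with h0 | h0
  · rw [h0, norm_zero]; positivity
  have h1 : ‖B (C f) h‖ * ‖B (C f) h‖ ≤ ‖h‖ * (‖B f‖ * ‖B (C f) h‖) := by
    rw [← inner_self_eq_norm_mul_norm (𝕜 := ℂ), M.inner_conj_mul]
    refine (RCLike.re_le_norm _).trans ((norm_inner_le_norm _ _).trans ?_)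
    gcongr
    exact (B f).le_opNorm _
  have h2 : 0 < ‖B (C f) h‖ := norm_pos_iff.2 h0
  nlinarith

lemma norm_conj (f : H) : ‖B (C f)‖ = ‖B f‖ := by
  refine le_antisymm (M.norm_conj_le f) ?_
  conv_lhs => rw [← M.conj_conj f]
  exact M.norm_conj_le _

lemma norm_mul_le (f g : H) : ‖B (B f g)‖ ≤ ‖B f‖ * ‖B g‖ := by
  have : B (B f g) = B f ∘L B g := by ext h; simp [M.mul_assoc']
  rw [this]; exact ContinuousLinearMap.opNorm_comp_le _ _

lemma proj_e {φ : K} (hφ : ‖φ‖ = 1) : B (M.e φ φ) (M.e φ φ) = M.e φ φ := by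
  simp [M.mul_e, M.Op_e, hφ]

lemma norm_sq_eq_proj {p : H} (hp : B p p = p) (hC : C p = p) (h : H) :
    ‖h‖ ^ 2 = ‖B p h‖ ^ 2 + ‖h - B p h‖ ^ 2 := by
  have h1 : inner ℂ (B p h) (h - B p h) = 0 := by
    nth_rewrite 1 [← hC]
    rw [M.inner_conj_mul, map_sub, ← M.mul_assoc', hp, sub_self, inner_zero_right]
  have := norm_add_sq_eq_norm_sq_add_norm_sq_of_inner_eq_zero _ _ h1
  simp only [add_sub_cancel] at this
  nlinarith

lemma norm_proj_le_one {p : H} (hp : B p p = p) (hC : C p = p) : ‖B p‖ ≤ 1 := by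
  refine ContinuousLinearMap.opNorm_le_bound _ zero_le_one fun h => ?_
  have := M.norm_sq_eq_proj hp hC h
  rw [one_mul]
  exact le_of_sq_le_sq (by nlinarith [sq_nonneg ‖h - B p h‖]) (norm_nonneg _)

/-- The compression `(1 - p) x (1 - p)`. -/
def cut (_ : HSModel B C K) (p x : H) : H := x - B p x - B x p + B p (B x p)

/-- The element is block diagonal for the splitting by the projections p and 1 - p, and each block
has norm at most N. This estimate produces the sharp bound 1 - r on the remainder of a state after
an eigenvector is split off. -/
lemma norm_smul_add_cut_le {p : H} (hp : B p p = p) (hC : C p = p) {x : H} {N : ℝ} (hN : 0 ≤ N)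
    (hx : ‖B x‖ ≤ N) : ‖B ((N : ℂ) • p + M.cut p x)‖ ≤ N := by
  refine ContinuousLinearMap.opNorm_le_bound _ hN fun h => ?_
  set k := h - B p h with hk
  have e1 : B ((N : ℂ) • p + M.cut p x) h = (N : ℂ) • B p h + (B x k - B p (B x k)) := by
    simp only [cut, hk, map_add, map_sub, map_smul, add_apply,
      sub_apply, smul_apply, M.mul_assoc']
    abel
  have e2 : B p (B ((N : ℂ) • p + M.cut p x) h) = (N : ℂ) • B p h := by
    rw [e1]
    simp only [map_add, map_sub, map_smul, ← M.mul_assoc', hp, sub_self, add_zero]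
  have e3 := M.norm_sq_eq_proj hp hC (B ((N : ℂ) • p + M.cut p x) h)
  rw [e2] at e3
  rw [e1] at e3 ⊢
  rw [add_sub_cancel_left, norm_smul] at e3
  have e4 := M.norm_sq_eq_proj hp hC h
  have e5 := M.norm_sq_eq_proj hp hC (B x k)
  have e6 : ‖B x k‖ ≤ N * ‖k‖ := (B x).le_of_opNorm_le hx k
  have e7 : ‖B x k‖ ^ 2 ≤ (N * ‖k‖) ^ 2 := pow_le_pow_left₀ (norm_nonneg _) e6 2
  refine le_of_sq_le_sq ?_ (by positivity)
  rw [e3, mul_pow N, e4, Complex.norm_real, Real.norm_eq_abs, mul_pow, sq_abs]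
  rw [← hk]
  nlinarith [sq_nonneg ‖B p (B x k)‖]

/-- A self-adjoint operator commutes with the projection onto an eigenvector, so compression to the
complement only removes the corresponding spectral term. -/
lemma Op_cut_e {ρ : H} {φ : K} {r : ℝ} (hρ : M.Op ρ φ = (r : ℂ) • φ) (hsa : C ρ = ρ)
    (hφ : ‖φ‖ = 1) : M.cut (M.e φ φ) ρ = ρ - (r : ℂ) • M.e φ φ := by
  have h1 : B ρ (M.e φ φ) = (r : ℂ) • M.e φ φ :=
    M.inj (by ext x; simp [M.Op_mul, M.Op_e, hρ, smul_comm r])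
  have h2 : B (M.e φ φ) ρ = (r : ℂ) • M.e φ φ := by
    rw [← M.conj_conj (B (M.e φ φ) ρ), M.conj_mul, hsa, M.conj_e, h1, M.conj_smul, M.conj_e,
      Complex.conj_ofReal]
  rw [cut, h1, h2, map_smul, M.proj_e hφ]
  abel

/-- Cyclicity of the trace: tr((1-p)x(1-p)ρ) = tr(x(1-p)ρ(1-p)). -/
lemma inner_conj_cut {p : H} (hC : C p = p) (x ρ : H) :
    inner ℂ (C (M.cut p x)) ρ = inner ℂ (C x) (M.cut p ρ) := by
  have h (y : H) : inner ℂ (B p y) ρ = inner ℂ y (B p ρ) := by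
    nth_rewrite 1 [← hC]; exact M.inner_conj_mul _ _ _
  have h' (y z : H) : inner ℂ (B y p) z = inner ℂ y (B z p) := by
    rw [M.inner_mul_right, hC]
  simp only [cut, M.conj_add, M.conj_sub, M.conj_mul, hC, inner_add_left, inner_sub_left,
    inner_add_right, inner_sub_right, h, h', M.mul_assoc']
  ring

/-- Rank one operators are compact, and compactness survives limits in operator norm. -/
lemma isCompactOperator_Op (f : H) : IsCompactOperator (M.Op f) := by
  refine M.induction (p := fun f => IsCompactOperator (M.Op f)) ?_ ?_ ?_ ?_ ?_ f
  · exact isClosed_setOfPred_isCompactOperator.preimage M.Op.continuous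
  · intro α β
    rw [M.Op_e, rankOne_def']
    have h : IsCompactOperator (ContinuousLinearMap.toSpanSingleton ℂ α) :=
      isCompactOperator_of_locallyCompactSpace_rng _
    exact h.comp_clm _
  · rw [map_zero]; exact isCompactOperator_zero
  · intro f g hf hg; rw [map_add]; exact hf.add hg
  · intro c f hf; rw [map_smul]; exact hf.smul c

end HSModel

end HilbertSchmidt

end LieQuant

/-! ### Purity of states with a Hilbert-Schmidt density -/

namespace LieQuant

open InnerProductSpace

/-- Comparing t with -t shows that t s + conj(t) s' vanishes; t = 1 and t = i then separate s from
s'. -/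
lemma eq_zero_of_sesquilinear_nonneg {c s s' : ℂ}
    (h : ∀ t : ℂ, 0 ≤ c + t * s + (starRingEnd ℂ t) * s') (hc : c = 0) : s = 0 ∧ s' = 0 := by
  subst hc
  have h1 := h 1
  have h2 := h (-1)
  have h3 := h Complex.I
  have h4 := h (-Complex.I)
  simp only [Complex.le_def, Complex.add_re, Complex.add_im, Complex.mul_re, Complex.mul_im,
    Complex.conj_re, Complex.conj_im, Complex.I_re, Complex.I_im, Complex.neg_re, Complex.neg_im,
    Complex.one_re, Complex.one_im, Complex.zero_re, Complex.zero_im] at h1 h2 h3 h4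
  constructor <;> apply Complex.ext <;> simp <;> linarith [h1.1, h1.2, h2.1, h2.2, h3.1, h3.2, h4.1, h4.2]

lemma nonneg_of_mul_ofReal_nonneg {z : ℂ} {r : ℝ} (hr : 0 < r) (h : 0 ≤ z * (r : ℂ)) : 0 ≤ z := by
  rw [Complex.le_def] at h ⊢
  simp only [Complex.zero_re, Complex.zero_im, Complex.re_mul_ofReal, Complex.im_mul_ofReal] at h ⊢
  exact ⟨nonneg_of_mul_nonneg_left h.1 hr, ((mul_eq_zero.1 h.2.symm).resolve_right hr.ne').symm⟩

section Purity

variable {K H A : Type*} [NormedAddCommGroup K] [InnerProductSpace ℂ K] [CompleteSpace K]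
  [NormedAddCommGroup H] [InnerProductSpace ℂ H] [NormedAddCommGroup A] [NormedSpace ℂ A]

namespace HSModel

variable {B : H →L[ℂ] H →L[ℂ] H} {C : H → H} (M : HSModel B C K) {ι : H →ₗ[ℂ] A}

/-- The functionals of norm one on a completion `A` of `H` that are positive on `H`. -/
def stateSet (_ : HSModel B C K) (ι : H →ₗ[ℂ] A) : Set (A →L[ℂ] ℂ) :=
  {Λ | ‖Λ‖ = 1 ∧ ∀ f : H, 0 ≤ Λ (ι (B (C f) f))}

omit [CompleteSpace K] [InnerProductSpace ℂ K] [NormedAddCommGroup K] in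
lemma norm_le_of_forall (hι : DenseRange ι) (hn : ∀ f, ‖ι f‖ = ‖B f‖) {Λ : A →L[ℂ] ℂ} {N : ℝ}
    (hN : 0 ≤ N) (h : ∀ f, ‖Λ (ι f)‖ ≤ N * ‖B f‖) : ‖Λ‖ ≤ N := by
  refine ContinuousLinearMap.opNorm_le_bound _ hN fun a => ?_
  refine hι.induction_on (p := fun a => ‖Λ a‖ ≤ N * ‖a‖) a
    (isClosed_le (by fun_prop) (by fun_prop)) fun f => ?_
  rw [hn]; exact h f

variable {ρ : H} {Λ : A →L[ℂ] ℂ}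
include M

lemma apply_conj_mul (hρ : ∀ f, Λ (ι f) = inner ℂ (C f) ρ) (g f : H) :
    Λ (ι (B (C g) f)) = inner ℂ g (B f ρ) := by
  rw [hρ, M.conj_mul, M.conj_conj, M.inner_conj_mul]

lemma apply_e (hρ : ∀ f, Λ (ι f) = inner ℂ (C f) ρ) (α β : K) :
    Λ (ι (M.e α β)) = inner ℂ β (M.Op ρ α) := by
  rw [hρ, M.conj_e, M.inner_e]

/-- On the rank one element `e β β` the positivity of Λ reads ‖β‖² ⟨β, ρ β⟩ ≥ 0. Over ℂ a
nonnegative quadratic form already implies self-adjointness. -/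
lemma isPositive_Op (hρ : ∀ f, Λ (ι f) = inner ℂ (C f) ρ) (hpos : ∀ f, 0 ≤ Λ (ι (B (C f) f))) :
    (M.Op ρ).IsPositive := by
  have key (β : K) : 0 ≤ inner ℂ β (M.Op ρ β) := by
    rcases eq_or_ne β 0 with rfl | hβ
    · simp
    have h1 := hpos (M.e β β)
    rw [M.apply_conj_mul hρ, M.inner_e, M.Op_mul, M.Op_e, ContinuousLinearMap.mul_def,
      ContinuousLinearMap.comp_apply, rankOne_apply, inner_smul_right, inner_self_eq_norm_sq_to_K] at h1
    exact nonneg_of_mul_ofReal_nonneg (r := ‖β‖ ^ 2) (by positivity) (by simpa using h1)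
  rw [ContinuousLinearMap.isPositive_iff_complex]
  intro x
  obtain ⟨r, hr, hr'⟩ := RCLike.nonneg_iff_exists_ofReal.1 (key x)
  have : inner ℂ (M.Op ρ x) x = (r : ℂ) := by
    rw [← inner_conj_symm, ← hr']; simp
  rw [this]
  simpa using hr

lemma conj_eq_self (hP : (M.Op ρ).IsPositive) : C ρ = ρ :=
  M.inj (by rw [M.Op_conj]; exact hP.isSelfAdjoint.adjoint_eq)

lemma norm_map_proj_le_one (hn : ∀ f, ‖ι f‖ = ‖B f‖) {φ : K} (hφ : ‖φ‖ = 1) :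
    ‖ι (M.e φ φ)‖ ≤ 1 := by
  rw [hn]; exact M.norm_proj_le_one (M.proj_e hφ) (M.conj_e φ φ)

/-- The vector state of a unit vector. -/
lemma exists_vectorState (hι : DenseRange ι) (hn : ∀ f, ‖ι f‖ = ‖B f‖) {φ : K} (hφ : ‖φ‖ = 1) :
    ∃ Λ ∈ M.stateSet ι, ∀ f, Λ (ι f) = inner ℂ (C f) (M.e φ φ) := by
  set p := M.e φ φ with hp
  have hp1 : ‖p‖ = 1 := by
    have : inner ℂ p p = (1 : ℂ) := by
      rw [hp, M.inner_e, M.Op_e, rankOne_apply, inner_smul_right, inner_self_eq_norm_sq_to_K, hφ]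
      simp
    rw [inner_self_eq_norm_sq_to_K] at this
    have h2 : ‖p‖ ^ 2 = 1 := Complex.ofReal_injective (by simpa using this)
    exact (pow_eq_one_iff_of_nonneg (norm_nonneg _) two_ne_zero).1 h2
  -- For p = |φ⟩⟨φ| the trace tr(f p) equals ⟨p, f p⟩ because p = p². In this form the functional is
  -- visibly bounded by the norm of left multiplication and visibly positive.
  have hform (f : H) : inner ℂ (C f) p = inner ℂ p (B f p) := by
    rw [← M.inner_conj_mul, M.inner_mul_right, M.conj_e, ← hp, hp, M.proj_e hφ]
  let L : H →ₗ[ℂ] ℂ :=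
    { toFun := fun f => inner ℂ p (B f p)
      map_add' := fun f g => by simp
      map_smul' := fun c f => by simp }
  have hL (f : H) : ‖L f‖ ≤ 1 * ‖ι f‖ := by
    rw [hn, one_mul]
    calc ‖inner ℂ p (B f p)‖ ≤ ‖p‖ * ‖B f p‖ := norm_inner_le_norm _ _
      _ ≤ 1 * (‖B f‖ * 1) := by
        have := (B f).le_opNorm p
        rw [hp1] at this ⊢
        gcongr
      _ = _ := by ring
  have hval (f : H) : L.extendOfNorm ι (ι f) = inner ℂ (C f) p := by
    rw [LinearMap.extendOfNorm_eq hι ⟨1, hL⟩, hform]; rfl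
  refine ⟨L.extendOfNorm ι, ⟨le_antisymm ?_ ?_, fun f => ?_⟩, hval⟩
  · exact LinearMap.opNorm_extendOfNorm_le hι zero_le_one hL
  -- The norm is attained at p, an element of norm at most 1 with value 1.
  · have h1 : L.extendOfNorm ι (ι p) = 1 := by
      rw [hval, M.conj_e, ← hp, inner_self_eq_norm_sq_to_K, hp1]; simp
    have h2 := (L.extendOfNorm ι).le_opNorm (ι p)
    rw [h1, norm_one] at h2
    have h3 := M.norm_map_proj_le_one hn hφ
    have h4 := norm_nonneg (L.extendOfNorm ι)
    nlinarith
  · have hpp : B p p = p := M.proj_e hφ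
    have hCp : C p = p := M.conj_e φ φ
    have h1 : inner ℂ f (B f p) = inner ℂ (B f p) (B f p) := by
      rw [M.inner_mul_right, hCp, M.mul_assoc', hpp]
    rw [M.apply_conj_mul (ρ := p) hval, h1, inner_self_eq_norm_sq_to_K]
    have h2 : (0 : ℝ) ≤ ‖B f p‖ ^ 2 := by positivity
    simp

/-- A compact self-adjoint operator without nonzero eigenvalue is zero; positivity fixes the sign of
the eigenvalue. -/
lemma exists_eigenvector (hP : (M.Op ρ).IsPositive) (h0 : M.Op ρ ≠ 0) :
    ∃ r : ℝ, 0 < r ∧ ∃ φ : K, ‖φ‖ = 1 ∧ M.Op ρ φ = (r : ℂ) • φ := by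
  have h1 := (ContinuousLinearMap.eq_zero_of_forall_hasEigenvalue_eq_zero
    (M.isCompactOperator_Op ρ) hP.isSymmetric).not.2 h0
  push Not at h1
  obtain ⟨μ, hμ, hμ0⟩ := h1
  obtain ⟨v, hv⟩ := hμ.exists_hasEigenvector
  have hv0 : ‖v‖ ≠ 0 := norm_ne_zero_iff.2 hv.2
  have hv1 : M.Op ρ v = μ • v := hv.apply_eq_smul
  have h2 : 0 ≤ inner ℂ v (M.Op ρ v) := hP.inner_nonneg_right v
  rw [hv1, inner_smul_right, inner_self_eq_norm_sq_to_K] at h2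
  have h4 : 0 ≤ μ :=
    nonneg_of_mul_ofReal_nonneg (r := ‖v‖ ^ 2) (by positivity) (by simpa using h2)
  obtain ⟨r, hr, hr'⟩ := RCLike.nonneg_iff_exists_ofReal.1 h4
  refine ⟨r, lt_of_le_of_ne hr ?_, ((‖v‖ : ℂ)⁻¹) • v, ?_, ?_⟩
  · rintro rfl; exact hμ0 (by rw [← hr']; simp)
  · rw [norm_smul]; simp [hv0]
  · rw [map_smul, hv1, ← hr', smul_comm]; rfl

lemma op_ne_zero (hι : DenseRange ι) (hρ : ∀ f, Λ (ι f) = inner ℂ (C f) ρ) (hΛ : ‖Λ‖ = 1) :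
    M.Op ρ ≠ 0 := by
  intro h
  have h0 : ρ = 0 := M.inj (by rw [h, map_zero])
  have : Λ = 0 := by
    ext a
    refine hι.induction_on (p := fun a => Λ a = 0) a (isClosed_eq (by fun_prop) (by fun_prop))
      fun f => ?_
    rw [hρ, h0, inner_zero_right]
  rw [this, norm_zero] at hΛ
  exact zero_ne_one hΛ

/-- Let p project onto an eigenvector φ of ρ with eigenvalue r > 0. The remainder Λ - rΛ_φ is the
compression f ↦ Λ((1-p)f(1-p)), hence positive, and its norm is at most 1 - r. So Λ is a proper
convex combination of Λ_φ and another state unless r = 1, and in both cases Λ = Λ_φ. -/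
lemma mul_self_of_extreme (hι : DenseRange ι) (hn : ∀ f, ‖ι f‖ = ‖B f‖)
    (hρ : ∀ f, Λ (ι f) = inner ℂ (C f) ρ) (hΛ : Λ ∈ extremePoints ℝ (M.stateSet ι)) :
    B ρ ρ = ρ := by
  have hP := M.isPositive_Op hρ hΛ.1.2
  obtain ⟨r, hr, φ, hφ, hφr⟩ := M.exists_eigenvector hP (M.op_ne_zero hι hρ hΛ.1.1)
  have hsa := M.conj_eq_self hP
  set p := M.e φ φ with hp
  have hpp : B p p = p := M.proj_e hφ
  have hCp : C p = p := M.conj_e φ φ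
  obtain ⟨Λφ, hΛφ, hvec⟩ := M.exists_vectorState hι hn hφ
  have hcut (f : H) : Λ (ι (M.cut p f)) = (Λ - (r : ℂ) • Λφ) (ι f) := by
    rw [hρ, M.inner_conj_cut hCp, M.Op_cut_e hφr hsa hφ, sub_apply, hρ, smul_apply, hvec,
      inner_sub_right, inner_smul_right]
    rfl
  have hΛp : Λ (ι p) = r := by
    rw [hp, M.apply_e hρ, hφr, inner_smul_right, inner_self_eq_norm_sq_to_K, hφ]; simp
  -- Apply Λ to N p + (1-p)(c f)(1-p), where N = ‖f‖ and the phase c makes the value of the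
  -- remainder nonnegative. The element has norm at most N and Λ takes the value N r + |(Λ -
  -- rΛ_φ)(f)| there.
  have hbound (f : H) : ‖(Λ - (r : ℂ) • Λφ) (ι f)‖ ≤ (1 - r) * ‖B f‖ := by
    obtain ⟨c, hc, hc'⟩ : ∃ c : ℂ, ‖c‖ = 1 ∧ c * (Λ - (r : ℂ) • Λφ) (ι f) =
        (‖(Λ - (r : ℂ) • Λφ) (ι f)‖ : ℂ) := by
      have := RCLike.exists_norm_eq_mul_self ((Λ - (r : ℂ) • Λφ) (ι f))
      obtain ⟨c, h1, h2⟩ := this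
      exact ⟨c, h1, h2.symm⟩
    have h1 := M.norm_smul_add_cut_le hpp hCp (x := c • f) (norm_nonneg (B f))
      (by rw [map_smul, norm_smul, hc, one_mul])
    have h2 : Λ (ι ((‖B f‖ : ℂ) • p + M.cut p (c • f))) =
        ((‖B f‖ * r + ‖(Λ - (r : ℂ) • Λφ) (ι f)‖ : ℝ) : ℂ) := by
      rw [map_add, map_add, map_smul, map_smul, hcut, hΛp, map_smul, map_smul, smul_eq_mul,
        smul_eq_mul, hc']
      push_cast
      rfl
    have h3 := Λ.le_opNorm (ι ((‖B f‖ : ℂ) • p + M.cut p (c • f)))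
    rw [h2, hΛ.1.1, hn, one_mul, Complex.norm_real, Real.norm_eq_abs] at h3
    have := (le_abs_self _).trans (h3.trans h1)
    linarith
  have hr1 : r ≤ 1 := by
    have h1 := Λ.le_opNorm (ι p)
    rw [hΛp, hΛ.1.1, one_mul, Complex.norm_real, Real.norm_eq_abs] at h1
    exact (le_abs_self _).trans (h1.trans (M.norm_map_proj_le_one hn hφ))
  have hΛ' : ‖Λ - (r : ℂ) • Λφ‖ ≤ 1 - r := norm_le_of_forall hι hn (by linarith) hbound
  have hfin : Λφ = Λ := by
    -- For r = 1 the remainder has norm 0; otherwise it is divided by 1 - r to become a state.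
    rcases eq_or_lt_of_le hr1 with rfl | hlt
    · rw [sub_self, norm_le_zero_iff, Complex.ofReal_one, one_smul, sub_eq_zero] at hΛ'
      exact hΛ'.symm
    · have h1r : 0 < 1 - r := by linarith
      set Λ₂ : A →L[ℂ] ℂ := (((1 - r)⁻¹ : ℝ) : ℂ) • (Λ - (r : ℂ) • Λφ) with hΛ₂
      have hsum : Λ = (r : ℂ) • Λφ + ((1 - r : ℝ) : ℂ) • Λ₂ := by
        rw [hΛ₂, smul_smul, ← Complex.ofReal_mul, mul_inv_cancel₀ h1r.ne', Complex.ofReal_one,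
          one_smul]
        abel
      have hle : ‖Λ₂‖ ≤ 1 := by
        rw [hΛ₂, norm_smul, Complex.norm_real, Real.norm_eq_abs, abs_of_pos (inv_pos.2 h1r)]
        rw [inv_mul_le_iff₀ h1r]
        linarith
      -- The triangle inequality in 1 = ‖Λ‖ ≤ r + (1 - r)‖Λ₂‖ leaves no room for a smaller norm.
      have hge : 1 ≤ ‖Λ₂‖ := by
        have h1 : ‖Λ‖ ≤ r * 1 + (1 - r) * ‖Λ₂‖ := by
          conv_lhs => rw [hsum]
          refine (norm_add_le _ _).trans ?_
          rw [norm_smul, norm_smul, Complex.norm_real, Complex.norm_real, Real.norm_eq_abs,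
            Real.norm_eq_abs, abs_of_pos hr, abs_of_pos h1r, hΛφ.1]
        rw [hΛ.1.1] at h1
        by_contra! hlt
        nlinarith
      have hmem : Λ₂ ∈ M.stateSet ι := by
        refine ⟨le_antisymm hle hge, fun f => ?_⟩
        rw [hΛ₂, smul_apply, ← hcut, smul_eq_mul]
        -- The compression of f* f is g* g with g = f(1-p), so the remainder inherits positivity
        -- from Λ.
        have h1 : M.cut p (B (C f) f) = B (C (f - B f p)) (f - B f p) := by
          rw [M.conj_sub, M.conj_mul, hCp, cut]
          simp only [map_sub, sub_apply, M.mul_assoc']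
          abel
        rw [h1]
        refine mul_nonneg ?_ (hΛ.1.2 _)
        exact_mod_cast (inv_pos.2 h1r).le
      refine (mem_extremePoints.1 hΛ).2 _ hΛφ _ hmem ⟨r, 1 - r, hr, h1r, by ring, ?_⟩ |>.1
      rw [hsum]; rfl
  -- The density is recovered from its functional, since every vector is of the form `C f`.
  have hρp : ρ = p := by
    refine ext_inner_left ℂ fun v => ?_
    rw [← M.conj_conj v, ← hρ, ← hfin, hvec]
  rw [hρp, hpp]

/-- A positive idempotent operator is an orthogonal projection. If its range contained two
orthonormal vectors φ, χ, then Λ would equal 2 on the projection onto their span, an element of norm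
at most 1. -/
lemma eq_e_of_mul_self (hι : DenseRange ι) (hn : ∀ f, ‖ι f‖ = ‖B f‖)
    (hρ : ∀ f, Λ (ι f) = inner ℂ (C f) ρ) (hΛ : Λ ∈ M.stateSet ι) (hid : B ρ ρ = ρ) :
    ∃ φ : K, ‖φ‖ = 1 ∧ ρ = M.e φ φ := by
  have hP := M.isPositive_Op hρ hΛ.2
  set P := M.Op ρ with hPdef
  have hPP (x : K) : P (P x) = P x := by
    rw [← ContinuousLinearMap.comp_apply, ← ContinuousLinearMap.mul_def, hPdef, ← M.Op_mul, hid]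
  have key (y : K) (hy : y ≠ 0) (hPy : P y = y) : ∃ φ : K, ‖φ‖ = 1 ∧ P φ = φ ∧
      ∃ c : ℂ, φ = c • y := by
    have : ‖y‖ ≠ 0 := norm_ne_zero_iff.2 hy
    exact ⟨((‖y‖ : ℂ)⁻¹) • y, by rw [norm_smul]; simp [this], by rw [map_smul, hPy], _, rfl⟩
  obtain ⟨x, hx⟩ : ∃ x, P x ≠ 0 := by
    by_contra! h
    exact M.op_ne_zero hι hρ hΛ.1 (by ext x; exact h x)
  obtain ⟨φ, hφ, hPφ, -⟩ := key _ hx (hPP x)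
  refine ⟨φ, hφ, M.inj ?_⟩
  by_contra hne
  -- If P is not the projection onto φ, some P z has a nonzero component orthogonal to φ. This
  -- component is again fixed by P.
  obtain ⟨z, hz⟩ : ∃ z, P z - inner ℂ φ z • φ ≠ 0 := by
    by_contra! h
    refine hne ?_
    ext z
    rw [M.Op_e, rankOne_apply, ← sub_eq_zero]
    exact h z
  have hort : inner ℂ φ (P z - inner ℂ φ z • φ) = 0 := by
    have : inner ℂ φ (P z) = inner ℂ φ z := by
      have := hP.isSymmetric φ z
      simp only [ContinuousLinearMap.coe_coe] at this
      rw [← this, hPφ]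
    rw [inner_sub_right, this, inner_smul_right, inner_self_eq_norm_sq_to_K, hφ]
    simp
  obtain ⟨χ, hχ, hPχ, c, hc⟩ := key _ hz (by rw [map_sub, hPP, map_smul, hPφ])
  have hφχ : inner ℂ φ χ = 0 := by rw [hc, inner_smul_right, hort, mul_zero]
  have hχφ : inner ℂ χ φ = 0 := by rw [← inner_conj_symm, hφχ, map_zero]
  set f := M.e φ φ + M.e χ χ with hf
  have hff : B f f = f := by
    rw [hf]
    refine M.inj ?_
    ext w
    simp [M.Op_mul, M.Op_e, hφ, hχ, hφχ, hχφ]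
  have hCf : C f = f := by rw [hf, M.conj_add, M.conj_e, M.conj_e]
  have h1 : Λ (ι f) = 2 := by
    rw [hf, map_add, map_add, M.apply_e hρ, M.apply_e hρ, ← hPdef, hPφ, hPχ,
      inner_self_eq_norm_sq_to_K, inner_self_eq_norm_sq_to_K, hφ, hχ]
    norm_num
  have h2 := Λ.le_opNorm (ι f)
  rw [h1, hΛ.1, one_mul, hn] at h2
  have h3 := h2.trans (M.norm_proj_le_one hff hCf)
  norm_num at h3

/-- The Cauchy-Schwarz argument: as g* g has value zero, positivity at k h + t g is a polynomial k²
Λ₁(h* h) + k z(t) that is nonnegative for all real k, which forces z(t) to vanish for every t. -/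
lemma apply_conj_mul_eq_zero {Λ₁ : A →L[ℂ] ℂ} (hΛ₁ : Λ₁ ∈ M.stateSet ι) {g : H}
    (hg : Λ₁ (ι (B (C g) g)) = 0) (h : H) :
    Λ₁ (ι (B (C h) g)) = 0 ∧ Λ₁ (ι (B (C g) h)) = 0 := by
  suffices hs : ∀ k : ℝ, ∀ t : ℂ, 0 ≤ (k : ℂ) ^ 2 * Λ₁ (ι (B (C h) h)) +
      k * (t * Λ₁ (ι (B (C h) g)) + (starRingEnd ℂ t) * Λ₁ (ι (B (C g) h))) by
    obtain ⟨r, hr, hr'⟩ := RCLike.nonneg_iff_exists_ofReal.1 (hΛ₁.2 h)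
    refine eq_zero_of_sesquilinear_nonneg (c := 0) (fun t => ?_) rfl
    rw [zero_add]
    set z := t * Λ₁ (ι (B (C h) g)) + (starRingEnd ℂ t) * Λ₁ (ι (B (C g) h)) with hz
    have hk (k : ℝ) : 0 ≤ k ^ 2 * r + k * z.re ∧ 0 = k * z.im := by
      have := hs k t
      rw [← hr', ← hz] at this
      have h2 := Complex.le_def.1 this
      simpa [← Complex.ofReal_pow] using h2
    rw [Complex.le_def]
    refine ⟨?_, by simpa using (hk 1).2⟩
    by_contra! hneg
    simp only [Complex.zero_re] at hneg
    rcases eq_or_lt_of_le hr with h0 | h0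
    · have := (hk 1).1; rw [← h0] at this; linarith
    -- This k minimizes k² r + k Re z, with minimum -(Re z)²/(4r).
    · have h5 := (hk (-z.re / (2 * r))).1
      have h6 : (-z.re / (2 * r)) ^ 2 * r + -z.re / (2 * r) * z.re = - (z.re ^ 2) / (4 * r) := by
        field_simp; ring
      rw [h6] at h5
      have : 0 < z.re ^ 2 / (4 * r) := by
        have := sq_pos_of_neg hneg
        positivity
      rw [neg_div] at h5
      linarith
  intro k t
  have := hΛ₁.2 ((k : ℂ) • h + t • g)
  rw [M.conj_add, M.conj_smul, M.conj_smul, Complex.conj_ofReal] at this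
  simp only [map_add, map_smul, add_apply, smul_apply, smul_eq_mul, hg, mul_zero, add_zero] at this
  convert this using 1
  ring

/-- If aΛ₁ + bΛ₂ = Λ, then Λ₁ vanishes on g* g for g = f - fρ because Λ does and both terms are
nonnegative. Thus f may be replaced by fρ, or by ρf on the other side, under Λ₁. Since ρ has rank
one, ρ(fk)ρ = Λ(fk)ρ, so Λ₁ is a multiple of Λ, and the norms identify the factor as 1. -/
lemma extreme_of_mul_self (hι : DenseRange ι) (hn : ∀ f, ‖ι f‖ = ‖B f‖)
    (hρ : ∀ f, Λ (ι f) = inner ℂ (C f) ρ) (hΛ : Λ ∈ M.stateSet ι) (hid : B ρ ρ = ρ) :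
    Λ ∈ extremePoints ℝ (M.stateSet ι) := by
  obtain ⟨φ, hφ, hρφ⟩ := M.eq_e_of_mul_self hι hn hρ hΛ hid
  have hCρ : C ρ = ρ := by rw [hρφ, M.conj_e]
  refine mem_extremePoints_iff_left.2 ⟨hΛ, ?_⟩
  rintro Λ₁ hΛ₁ Λ₂ hΛ₂ ⟨a, b, ha, hb, -, hab⟩
  have hzero (f : H) : Λ₁ (ι (B (C (f - B f ρ)) (f - B f ρ))) = 0 := by
    set g := f - B f ρ with hg
    have hgρ : B g ρ = 0 := by
      rw [hg, map_sub, sub_apply, M.mul_assoc', hid, sub_self]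
    have h1 : Λ (ι (B (C g) g)) = 0 := by rw [M.apply_conj_mul hρ, hgρ, inner_zero_right]
    rw [← hab] at h1
    have h2 : (a : ℂ) * Λ₁ (ι (B (C g) g)) + (b : ℂ) * Λ₂ (ι (B (C g) g)) = 0 := h1
    have ha' : (0 : ℂ) < a := by exact_mod_cast ha
    have hb' : (0 : ℂ) < b := by exact_mod_cast hb
    have h3 := mul_nonneg ha'.le (hΛ₁.2 g)
    have h4 := mul_nonneg hb'.le (hΛ₂.2 g)
    have h5 := ((add_eq_zero_iff_of_nonneg h3 h4).1 h2).1
    exact (mul_eq_zero.1 h5).resolve_left ha'.ne'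
  have hright (k f : H) : Λ₁ (ι (B k f)) = Λ₁ (ι (B k (B f ρ))) := by
    have := (M.apply_conj_mul_eq_zero hΛ₁ (hzero f) (C k)).1
    rwa [M.conj_conj, map_sub, map_sub, map_sub, sub_eq_zero] at this
  have hleft (f k : H) : Λ₁ (ι (B f k)) = Λ₁ (ι (B ρ (B f k))) := by
    have := (M.apply_conj_mul_eq_zero hΛ₁ (hzero (C f)) k).2
    rwa [M.conj_sub, M.conj_conj, M.conj_mul, M.conj_conj, hCρ, map_sub, sub_apply, map_sub,
      map_sub, sub_eq_zero, M.mul_assoc'] at this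
  have hprod (f k : H) : Λ₁ (ι (B f k)) = Λ (ι (B f k)) * Λ₁ (ι ρ) := by
    rw [hleft, hright, M.mul_assoc']
    have : B ρ (B f (B k ρ)) = Λ (ι (B f k)) • ρ := by
      have h1 : Λ (ι (B f k)) = inner ℂ φ (M.Op (B f k) φ) := by
        rw [hρ, hρφ, ← inner_conj_symm, M.inner_e, M.Op_conj,
          ContinuousLinearMap.adjoint_inner_right, inner_conj_symm]
      rw [h1, hρφ]
      refine M.inj ?_
      ext x
      simp [M.Op_mul, M.Op_e, smul_smul, mul_comm]
    rw [this, map_smul, map_smul, smul_eq_mul]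
  have hcont : Continuous ι :=
    (ι.mkContinuous ‖B‖ fun f => by rw [hn]; exact B.le_opNorm f).continuous
  have hall (f : H) : Λ₁ (ι f) = Λ (ι f) * Λ₁ (ι ρ) := by
    refine M.induction (p := fun f => Λ₁ (ι f) = Λ (ι f) * Λ₁ (ι ρ)) ?_ ?_ ?_ ?_ ?_ f
    · exact isClosed_eq (by fun_prop) (by fun_prop)
    · intro α β
      rcases eq_or_ne α 0 with rfl | hα
      · have : M.e 0 β = 0 := M.inj (by simp [M.Op_e])
        simp [this]
      -- The rank one element is up to the factor ‖α‖² a product, so the identity for products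
      -- reaches a total set.
      · have h1 := hprod (M.e α α) (M.e α β)
        have h2 : B (M.e α α) (M.e α β) = ((‖α‖ : ℂ) ^ 2) • M.e α β :=
          M.inj (by ext x; simp [M.Op_mul, M.Op_e, inner_self_eq_norm_sq_to_K, smul_smul, mul_comm])
        rw [h2, map_smul, map_smul, map_smul, smul_eq_mul, smul_eq_mul, mul_assoc] at h1
        exact mul_left_cancel₀ (by simpa using hα) h1
    · simp
    · intro f g hf hg; simp only [map_add, hf, hg]; ring
    · intro c f hf; simp only [map_smul, hf, smul_eq_mul]; ring
  have heq : Λ₁ = Λ₁ (ι ρ) • Λ := by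
    ext a
    refine hι.induction_on (p := fun a => Λ₁ a = (Λ₁ (ι ρ) • Λ) a) a
      (isClosed_eq (by fun_prop) (by fun_prop)) fun f => ?_
    rw [hall, smul_apply, smul_eq_mul, mul_comm]
  have hpos : 0 ≤ Λ₁ (ι ρ) := by
    have := hΛ₁.2 ρ
    rwa [hCρ, hid] at this
  have hone : Λ₁ (ι ρ) = 1 := by
    have h1 := congrArg norm heq
    rw [norm_smul, hΛ₁.1, hΛ.1, mul_one] at h1
    obtain ⟨r, hr, hr'⟩ := RCLike.nonneg_iff_exists_ofReal.1 hpos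
    rw [← hr'] at h1 ⊢
    have h2 : ‖(r : ℂ)‖ = r := by rw [Complex.norm_real, Real.norm_eq_abs, abs_of_nonneg hr]
    have h3 : (1 : ℝ) = r := h1.trans h2
    rw [← h3]; simp
  rw [heq, hone, one_smul]

/-- A normal state with density `ρ` is pure if and only if `ρ` is idempotent. -/
theorem mem_extremePoints_iff (hι : DenseRange ι) (hn : ∀ f, ‖ι f‖ = ‖B f‖)
    (hρ : ∀ f, Λ (ι f) = inner ℂ (C f) ρ) (hΛ : Λ ∈ M.stateSet ι) :
    Λ ∈ extremePoints ℝ (M.stateSet ι) ↔ B ρ ρ = ρ :=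
  ⟨M.mul_self_of_extreme hι hn hρ, M.extreme_of_mul_self hι hn hρ hΛ⟩

end HSModel
end Purity
end LieQuant

namespace LieQuant

/-! ### One-parameter subgroups and smoothness of the exponential map -/

section Exponential

variable {n : ℕ} {G : Type*} [Group G] [TopologicalSpace G] [ChartedSpace (E n) G]
  [LieGroup (𝓡 n) ∞ G]

lemma lieGroup_minSmoothness : LieGroup (𝓡 n) (minSmoothness ℝ 3) G := by
  rw [minSmoothness_of_isRCLikeNormedField]; infer_instance

/-- The left invariant vector field determined by `X`. -/
abbrev leftField (G : Type*) [Group G] [TopologicalSpace G] [ChartedSpace (E n) G] (X : E n) :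
    (g : G) → TangentSpace (𝓡 n) g :=
  mulInvariantVectorField (I := 𝓡 n) (G := G) (X : GroupLieAlgebra (𝓡 n) G)

omit [LieGroup (𝓡 n) ∞ G] in
lemma leftField_smul (c : ℝ) (X : E n) : leftField G (c • X) = c • leftField G X :=
  mulInvariantVectorField_smul (I := 𝓡 n) (G := G) c (X : GroupLieAlgebra (𝓡 n) G)

lemma mdifferentiable_mul_left (g : G) : MDifferentiable (𝓡 n) (𝓡 n) (fun h : G => g * h) :=
  (contMDiff_mul_left (I := 𝓡 n) (n := ∞)).mdifferentiable (by simp)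

lemma leftField_mul (X : E n) (g h : G) :
    leftField G X (g * h) = mfderiv (𝓡 n) (𝓡 n) (fun x : G => g * x) h (leftField G X h) := by
  have h1 : (fun x : G => g * h * x) = (fun x => g * x) ∘ (fun x => h * x) := by
    ext x; simp [mul_assoc]
  have h2 : HasMFDerivAt (𝓡 n) (𝓡 n) (fun x : G => g * x) (h * 1)
      (mfderiv (𝓡 n) (𝓡 n) (fun x : G => g * x) h : E n →L[ℝ] E n) := by
    rw [mul_one]
    exact (mdifferentiable_mul_left g h).hasMFDerivAt
  have h3 : HasMFDerivAt (𝓡 n) (𝓡 n) (fun x : G => g * h * x) 1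
      ((mfderiv (𝓡 n) (𝓡 n) (fun x : G => g * x) h : E n →L[ℝ] E n).comp
        (mfderiv (𝓡 n) (𝓡 n) (fun x : G => h * x) 1 : E n →L[ℝ] E n)) := by
    rw [h1]
    exact h2.comp 1 (mdifferentiable_mul_left h 1).hasMFDerivAt
  exact congrArg (fun L : E n →L[ℝ] E n => L X) h3.mfderiv

lemma isMIntegralCurve_mul_left {X : E n} {γ : ℝ → G}
    (hγ : IsMIntegralCurve (I := 𝓡 n) γ (leftField G X)) (g : G) :
    IsMIntegralCurve (I := 𝓡 n) (fun t => g * γ t) (leftField G X) := by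
  intro t
  have h1 := (mdifferentiable_mul_left (n := n) g (γ t)).hasMFDerivAt.comp t (hγ t)
  refine h1.congr_mfderiv (ContinuousLinearMap.ext fun (s : ℝ) => ?_)
  rw [leftField_mul]
  exact map_smul (mfderiv (𝓡 n) (𝓡 n) (fun x : G => g * x) (γ t) : E n →L[ℝ] E n) s
    (leftField G X (γ t) : E n)

lemma contMDiffAt_pow_of_contMDiffAt {f : E n → G} {X : E n}
    (hf : ContMDiffAt 𝓘(ℝ, E n) (𝓡 n) ∞ f X) (k : ℕ) :
    ContMDiffAt 𝓘(ℝ, E n) (𝓡 n) ∞ (fun Z => f Z ^ k) X := by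
  induction k with
  | zero => simpa using contMDiffAt_const
  | succ k ih => simp only [pow_succ]; exact ih.mul hf

variable [T2Space G]

lemma isMIntegralCurve_unique {X : E n} {γ γ' : ℝ → G}
    (hγ : IsMIntegralCurve (I := 𝓡 n) γ (leftField G X))
    (hγ' : IsMIntegralCurve (I := 𝓡 n) γ' (leftField G X)) (h : γ 0 = γ' 0) : γ = γ' := by
  have := lieGroup_minSmoothness (n := n) (G := G)
  have : IsManifold (𝓡 n) 1 G := IsManifold.of_le (n := ∞) (by simp)
  refine isMIntegralCurve_Ioo_eq_of_contMDiff_boundaryless (I := 𝓡 n) (t₀ := 0) ?_ hγ hγ' h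
  refine (contMDiff_mulInvariantVectorField (I := 𝓡 n) (G := G) X).of_le ?_
  rw [minSmoothness_of_isRCLikeNormedField]
  norm_num

lemma lexp_eq_of_curve {X : E n} {γ : ℝ → G}
    (hγ : IsMIntegralCurve (I := 𝓡 n) γ (leftField G X)) (h : γ 0 = 1) : lexp X = γ 1 := by
  have hex : ∃ γ : ℝ → G, γ 0 = 1 ∧ IsMIntegralCurve (I := 𝓡 n) γ (leftField G X) := ⟨γ, h, hγ⟩
  have : lexp X = hex.choose 1 := dif_pos hex
  rw [this, isMIntegralCurve_unique hex.choose_spec.2 hγ (hex.choose_spec.1.trans h.symm)]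

omit [LieGroup (𝓡 n) ∞ G] [T2Space G] in
lemma isMIntegralCurve_zero : IsMIntegralCurve (I := 𝓡 n) (fun _ : ℝ => (1 : G))
    (leftField G (0 : E n)) :=
  isMIntegralCurve_const (map_zero (mfderiv (𝓡 n) (𝓡 n) (fun x : G => 1 * x) 1 : E n →L[ℝ] E n))

@[simp] lemma lexp_zero : lexp (0 : E n) = (1 : G) := lexp_eq_of_curve isMIntegralCurve_zero rfl

variable [MeasurableSpace G] {m : Measure G} {O : Set (E n)} (hO : IsWeaklyExponential m O)
include hO

omit [LieGroup (𝓡 n) ∞ G] [T2Space G] in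
lemma exists_smul_mem (X : E n) : ∀ᶠ t : ℝ in 𝓝 0, t • X ∈ O := by
  have : Continuous fun t : ℝ => t • X := by fun_prop
  exact this.continuousAt.eventually (by simpa using hO.isOpen.mem_nhds hO.zero_mem)

/-- As `exp` is injective on `𝒪`, it does not take there the value `1` away from `0`, so that the
one-parameter subgroups exist. -/
lemma exists_curve (X : E n) :
    ∃ γ : ℝ → G, γ 0 = 1 ∧ IsMIntegralCurve (I := 𝓡 n) γ (leftField G X) := by
  rcases eq_or_ne X 0 with rfl | hX
  · exact ⟨_, rfl, isMIntegralCurve_zero⟩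
  obtain ⟨t, ht, ht0⟩ : ∃ t : ℝ, t • X ∈ O ∧ 0 < t := by
    have h1 := (exists_smul_mem hO X).filter_mono (nhdsWithin_le_nhds (s := Ioi 0))
    obtain ⟨t, h2, h3⟩ := (h1.and self_mem_nhdsWithin).exists
    exact ⟨t, h2, h3⟩
  have hne : (lexp (t • X) : G) ≠ 1 := fun h => by
    have := hO.injOn ht hO.zero_mem (h.trans lexp_zero.symm)
    exact (smul_ne_zero ht0.ne' hX) this
  have hex : ∃ γ : ℝ → G, γ 0 = 1 ∧ IsMIntegralCurve (I := 𝓡 n) γ (leftField G (t • X)) := by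
    by_contra h
    exact hne (dif_neg h)
  obtain ⟨γ, h0, hγ⟩ := hex
  refine ⟨γ ∘ (· * t⁻¹), by simp [h0], ?_⟩
  have := hγ.comp_mul t⁻¹
  rwa [← leftField_smul, smul_smul, inv_mul_cancel₀ ht0.ne', one_smul] at this

lemma isMIntegralCurve_lexp (X : E n) :
    IsMIntegralCurve (I := 𝓡 n) (fun t : ℝ => (lexp (t • X) : G)) (leftField G X) := by
  obtain ⟨γ, h0, hγ⟩ := exists_curve hO X
  have : (fun t : ℝ => (lexp (t • X) : G)) = γ := by
    ext t
    have := hγ.comp_mul t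
    rw [← leftField_smul] at this
    rw [lexp_eq_of_curve this (by simp [h0])]
    simp
  rwa [this]

lemma lexp_add_smul (s t : ℝ) (X : E n) :
    (lexp ((s + t) • X) : G) = lexp (s • X) * lexp (t • X) := by
  have h1 := (isMIntegralCurve_lexp hO X).comp_add s
  have h2 := isMIntegralCurve_mul_left (isMIntegralCurve_lexp hO X) (lexp (s • X))
  have := congrFun (isMIntegralCurve_unique h1 h2 (by simp)) t
  simpa [add_comm] using this

lemma lexp_neg (X : E n) : (lexp (-X) : G) = (lexp X)⁻¹ := by
  have := lexp_add_smul hO (-1) 1 X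
  simp only [neg_add_cancel, zero_smul, lexp_zero, neg_smul, one_smul] at this
  exact eq_inv_of_mul_eq_one_left this.symm

lemma lexp_half_mul_half (X : E n) :
    (lexp ((1 / 2 : ℝ) • X) * lexp ((1 / 2 : ℝ) • X) : G) = lexp X := by
  rw [← lexp_add_smul hO]; norm_num

lemma lexp_nat_smul (k : ℕ) (X : E n) : (lexp ((k : ℝ) • X) : G) = lexp X ^ k := by
  induction k with
  | zero => simp
  | succ k ih => rw [Nat.cast_succ, lexp_add_smul hO, ih, pow_succ, one_smul]

/-- Smoothness is given only on 𝒪. Since exp Z = exp(Z/k)^k and X/k lies in 𝒪 for large k, it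
spreads to the whole Lie algebra. -/
lemma contMDiff_lexp : ContMDiff 𝓘(ℝ, E n) (𝓡 n) ∞ (lexp : E n → G) := by
  intro X
  obtain ⟨k, hk, hk0⟩ : ∃ k : ℕ, ((k : ℝ)⁻¹) • X ∈ O ∧ 0 < k := by
    have h1 : Tendsto (fun k : ℕ => (k : ℝ)⁻¹) atTop (𝓝 0) := tendsto_inv_atTop_nhds_zero_nat
    exact ((h1.eventually (exists_smul_mem hO X)).and (eventually_gt_atTop 0)).exists
  have hk1 : (k : ℝ) ≠ 0 := by positivity
  have h2 : (lexp : E n → G) = fun Z => lexp (((k : ℝ)⁻¹) • Z) ^ k := by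
    ext Z
    rw [← lexp_nat_smul hO, smul_smul, mul_inv_cancel₀ hk1, one_smul]
  rw [h2]
  have h3 : ContMDiffAt 𝓘(ℝ, E n) (𝓡 n) ∞ (fun Z : E n => (lexp (((k : ℝ)⁻¹) • Z) : G)) X := by
    have h4 := (hO.smooth _ hk).contMDiffAt (hO.isOpen.mem_nhds hk)
    refine h4.comp X ?_
    rw [contMDiffAt_iff_contDiffAt]
    fun_prop
  exact contMDiffAt_pow_of_contMDiffAt h3 k

lemma continuous_lexp : Continuous (lexp (G := G) : E n → G) := (contMDiff_lexp hO).continuous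

omit [LieGroup (𝓡 n) ∞ G] [T2Space G] in
lemma llog_lexp {X : E n} (hX : X ∈ O) : llog O (lexp X : G) = X :=
  hO.injOn.leftInvOn_invFunOn hX

omit hO [LieGroup (𝓡 n) ∞ G] [T2Space G] [MeasurableSpace G] in
lemma llog_mem {g : G} (hg : g ∈ lexp (G := G) '' O) : llog O g ∈ O := Function.invFunOn_mem hg

omit hO [LieGroup (𝓡 n) ∞ G] [T2Space G] [MeasurableSpace G] in
lemma lexp_llog {g : G} (hg : g ∈ lexp (G := G) '' O) : lexp (llog O g) = g :=
  Function.invFunOn_eq hg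

omit [LieGroup (𝓡 n) ∞ G] [T2Space G] in
lemma contMDiffAt_llog {g : G} (hg : g ∈ lexp (G := G) '' O) :
    ContMDiffAt (𝓡 n) 𝓘(ℝ, E n) ∞ (llog (G := G) O) g :=
  (hO.smooth_inv _ hg).contMDiffAt (hO.isOpen_image.mem_nhds hg)

lemma one_mem_image : (1 : G) ∈ lexp (G := G) '' O := ⟨0, hO.zero_mem, lexp_zero⟩

lemma llog_one : llog O (1 : G) = 0 := by
  have := llog_lexp hO hO.zero_mem
  rwa [lexp_zero] at this

omit [LieGroup (𝓡 n) ∞ G] [T2Space G] in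
lemma neg_mem {X : E n} (hX : X ∈ O) : -X ∈ O := by
  simpa using hO.star X hX (-1) le_rfl (by norm_num)

end Exponential

end LieQuant

namespace LieQuant

/-! ### First derivatives in the logarithmic chart -/

section LogChart

variable {n : ℕ} {G : Type*} [Group G] [TopologicalSpace G] [ChartedSpace (E n) G]

variable (G) in
/-- The derivative of `exp` at `X`, left translated to the unit and read in the chart `exp⁻¹`. -/
def dexp (O : Set (E n)) (X : E n) : E n →L[ℝ] E n :=
  fderiv ℝ (fun Z => llog O (lexp (-X) * lexp Z : G)) X

/-- The derivative at the unit of the conjugation by `g`, read in the chart `exp⁻¹`. -/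
def adChart (O : Set (E n)) (g : G) : E n →L[ℝ] E n :=
  fderiv ℝ (fun Z => llog O (g * lexp Z * g⁻¹)) 0

variable [LieGroup (𝓡 n) ∞ G] [T2Space G]
  [MeasurableSpace G] {m : Measure G} {O : Set (E n)} (hO : IsWeaklyExponential m O)
  {V : Type*} [NormedAddCommGroup V] [NormedSpace ℝ V]
include hO

omit [LieGroup (𝓡 n) ∞ G] [T2Space G] in
lemma contDiffAt_llog_comp {f : V → G} {x : V} (hf : ContMDiffAt 𝓘(ℝ, V) (𝓡 n) ∞ f x)
    (hx : f x ∈ lexp (G := G) '' O) : ContDiffAt ℝ ∞ (fun z => llog O (f z)) x := by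
  rw [← contMDiffAt_iff_contDiffAt]
  exact (contMDiffAt_llog hO hx).comp x hf

omit [LieGroup (𝓡 n) ∞ G] [T2Space G] in
lemma differentiableAt_llog_comp {f : V → G} {x : V} (hf : ContMDiffAt 𝓘(ℝ, V) (𝓡 n) ∞ f x)
    (hx : f x ∈ lexp (G := G) '' O) : DifferentiableAt ℝ (fun z => llog O (f z)) x :=
  (contDiffAt_llog_comp hO hf hx).differentiableAt (by simp)

omit [LieGroup (𝓡 n) ∞ G] [T2Space G] in
lemma eventually_mem_image {Z : Type*} [TopologicalSpace Z] {f : Z → G} {x : Z}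
    (hf : ContinuousAt f x) (hx : f x ∈ lexp (G := G) '' O) :
    ∀ᶠ z in 𝓝 x, f z ∈ lexp (G := G) '' O :=
  hf.eventually (hO.isOpen_image.mem_nhds hx)

lemma contMDiff_lexp_comp {f : V → E n} {x : V} (hf : ContDiffAt ℝ ∞ f x) :
    ContMDiffAt 𝓘(ℝ, V) (𝓡 n) ∞ (fun z => (lexp (f z) : G)) x :=
  (contMDiff_lexp hO).contMDiffAt.comp x (contMDiffAt_iff_contDiffAt.2 hf)

lemma contMDiffAt_mul_lexp_mul (a b : G) (x : E n) :
    ContMDiffAt 𝓘(ℝ, E n) (𝓡 n) ∞ (fun z : E n => a * lexp z * b) x :=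
  ((contMDiffAt_const.mul (contMDiff_lexp_comp hO contDiffAt_id)).mul contMDiffAt_const)

omit [LieGroup (𝓡 n) ∞ G] [T2Space G] in
lemma eventually_mem_zero : ∀ᶠ Z in 𝓝 (0 : E n), Z ∈ O := hO.isOpen.mem_nhds hO.zero_mem

/-- The chart `exp⁻¹` takes products near the unit to sums, to first order. -/
lemma hasFDerivAt_llog_mul {f h : V → G} {x : V} (hf : ContinuousAt f x) (hh : ContinuousAt h x)
    (hf1 : f x = 1) (hh1 : h x = 1) {f' h' : V →L[ℝ] E n}
    (hf' : HasFDerivAt (fun z => llog O (f z)) f' x)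
    (hh' : HasFDerivAt (fun z => llog O (h z)) h' x) :
    HasFDerivAt (fun z => llog O (f z * h z)) (f' + h') x := by
  set β : E n × E n → E n := fun z => llog O (lexp z.1 * lexp z.2 : G) with hβ
  have hd : DifferentiableAt ℝ β (0, 0) := by
    refine differentiableAt_llog_comp hO ?_ (by simpa using one_mem_image hO)
    exact (contMDiff_lexp_comp hO contDiffAt_fst).mul (contMDiff_lexp_comp hO contDiffAt_snd)
  have hinl : (fderiv ℝ β (0, 0)).comp (ContinuousLinearMap.inl ℝ (E n) (E n)) = .id ℝ _ := by
    have h1 : HasFDerivAt (fun Z : E n => β (Z, 0)) _ 0 :=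
      HasFDerivAt.comp (g := β) (f := fun Z : E n => (Z, (0 : E n))) 0 hd.hasFDerivAt
        (hasFDerivAt_prodMk_left (𝕜 := ℝ) (0 : E n) (0 : E n))
    have h2 : (fun Z : E n => β (Z, 0)) =ᶠ[𝓝 0] id := by
      filter_upwards [eventually_mem_zero hO] with Z hZ
      simp [hβ, llog_lexp hO hZ]
    exact h1.unique ((hasFDerivAt_id _).congr_of_eventuallyEq h2)
  have hinr : (fderiv ℝ β (0, 0)).comp (ContinuousLinearMap.inr ℝ (E n) (E n)) = .id ℝ _ := by
    have h1 : HasFDerivAt (fun Z : E n => β (0, Z)) _ 0 :=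
      HasFDerivAt.comp (g := β) (f := fun Z : E n => ((0 : E n), Z)) 0 hd.hasFDerivAt
        (hasFDerivAt_prodMk_right (𝕜 := ℝ) (0 : E n) (0 : E n))
    have h2 : (fun Z : E n => β (0, Z)) =ᶠ[𝓝 0] id := by
      filter_upwards [eventually_mem_zero hO] with Z hZ
      simp [hβ, llog_lexp hO hZ]
    exact h1.unique ((hasFDerivAt_id _).congr_of_eventuallyEq h2)
  have h0 : (llog O (f x), llog O (h x)) = ((0, 0) : E n × E n) := by
    rw [hf1, hh1, llog_one hO]
  have h3 : HasFDerivAt (fun z => β (llog O (f z), llog O (h z))) _ x :=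
    HasFDerivAt.comp (g := β) (g' := fderiv ℝ β (0, 0)) x (by rw [h0]; exact hd.hasFDerivAt)
      (hf'.prodMk hh')
  refine (h3.congr_of_eventuallyEq ?_).congr_fderiv ?_
  · filter_upwards [eventually_mem_image hO hf (by rw [hf1]; exact one_mem_image hO),
      eventually_mem_image hO hh (by rw [hh1]; exact one_mem_image hO)] with z h1 h2
    simp [hβ, lexp_llog h1, lexp_llog h2]
  · ext1 v
    have h4 := DFunLike.congr_fun hinl (f' v)
    have h5 := DFunLike.congr_fun hinr (h' v)
    simp only [ContinuousLinearMap.comp_apply, ContinuousLinearMap.inl_apply,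
      ContinuousLinearMap.inr_apply, ContinuousLinearMap.id_apply,
      ContinuousLinearMap.prod_apply, add_apply] at h4 h5 ⊢
    rw [← h4, ← h5, ← map_add]
    simp [h4, h5]

lemma hasFDerivAt_adChart (g : G) :
    HasFDerivAt (fun Z => llog O (g * lexp Z * g⁻¹)) (adChart O g) (0 : E n) :=
  (differentiableAt_llog_comp hO (contMDiffAt_mul_lexp_mul hO g g⁻¹ 0)
    (by simpa using one_mem_image hO)).hasFDerivAt

lemma hasFDerivAt_llog_conj (g : G) {f : V → G} {x : V} (hf : ContinuousAt f x) (hf1 : f x = 1)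
    {f' : V →L[ℝ] E n} (hf' : HasFDerivAt (fun z => llog O (f z)) f' x) :
    HasFDerivAt (fun z => llog O (g * f z * g⁻¹)) ((adChart O g).comp f') x := by
  have h1 : HasFDerivAt (fun z => llog O (g * lexp (llog O (f z)) * g⁻¹)) _ x :=
    HasFDerivAt.comp (g := fun Z : E n => llog O (g * lexp Z * g⁻¹)) x
      (by rw [hf1, llog_one hO]; exact hasFDerivAt_adChart hO g) hf'
  refine h1.congr_of_eventuallyEq ?_
  filter_upwards [eventually_mem_image hO hf (by rw [hf1]; exact one_mem_image hO)] with z h1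
  rw [lexp_llog h1]

omit [LieGroup (𝓡 n) ∞ G] [T2Space G] in
lemma hasFDerivAt_llog_lexp : HasFDerivAt (fun Z : E n => llog O (lexp Z : G)) (.id ℝ (E n)) 0 := by
  refine (hasFDerivAt_id _).congr_of_eventuallyEq ?_
  filter_upwards [eventually_mem_zero hO] with Z hZ
  simp [llog_lexp hO hZ]

lemma adChart_mul (g h : G) : adChart O (g * h) = (adChart O g).comp (adChart O h) := by
  have h1 := hasFDerivAt_llog_conj hO g (f := fun Z => h * lexp Z * h⁻¹) (x := 0)
    (contMDiffAt_mul_lexp_mul hO h h⁻¹ 0).continuousAt (by simp) (hasFDerivAt_adChart hO h)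
  refine (hasFDerivAt_adChart hO (g * h)).unique ?_
  have h2 : (fun Z : E n => llog O (g * h * lexp Z * (g * h)⁻¹)) =
      fun z => llog O (g * (h * lexp z * h⁻¹) * g⁻¹) := by
    ext1 z; simp [mul_assoc]
  rw [h2]
  exact h1

lemma adChart_one : adChart O (1 : G) = .id ℝ (E n) := by
  refine (hasFDerivAt_adChart hO (1 : G)).unique ?_
  simpa using hasFDerivAt_llog_lexp hO

lemma hasFDerivAt_dexp (X : E n) :
    HasFDerivAt (fun Z => llog O (lexp (-X) * lexp Z : G)) (dexp G O X) X := by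
  refine (differentiableAt_llog_comp hO ?_ ?_).hasFDerivAt
  · simpa using contMDiffAt_mul_lexp_mul hO (lexp (-X) : G) 1 X
  · simpa [lexp_neg hO] using one_mem_image hO

lemma continuous_mul_lexp (g : G) : Continuous fun Z : E n => g * lexp Z := by
  have : Continuous fun Z : E n => g * lexp Z * 1 := continuous_iff_continuousAt.2 fun X =>
    (contMDiffAt_mul_lexp_mul hO g 1 X).continuousAt
  simpa using this

lemma dexp_zero : dexp G O 0 = .id ℝ (E n) := by
  refine (hasFDerivAt_dexp hO (0 : E n)).unique ?_
  simpa using hasFDerivAt_llog_lexp hO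

/-- Differentiate exp(-2X) exp(2Z) = [exp(-X) (exp(-X) exp Z) exp X] · [exp(-X) exp Z] at Z = X.
This doubling equation later identifies the derivative of exp with φ(ad X). -/
lemma dexp_two_smul (X : E n) :
    (2 : ℝ) • dexp G O ((2 : ℝ) • X) =
      (adChart O (lexp (-X) : G)).comp (dexp G O X) + dexp G O X := by
  have h1 := (hasFDerivAt_dexp hO ((2 : ℝ) • X)).comp X
    ((hasFDerivAt_id (𝕜 := ℝ) X).const_smul (2 : ℝ))
  have hc : ContinuousAt (fun Z : E n => (lexp (-X) * lexp Z : G)) X :=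
    (continuous_mul_lexp hO _).continuousAt
  have h2 := hasFDerivAt_llog_conj hO (lexp (-X) : G) hc (by simp [lexp_neg hO])
    (hasFDerivAt_dexp hO X)
  have hc' : ContinuousAt (fun Z : E n => (lexp (-X) * (lexp (-X) * lexp Z) * (lexp (-X))⁻¹ : G)) X := by
    have := (contMDiffAt_mul_lexp_mul hO (lexp (-X) * lexp (-X) : G) (lexp (-X))⁻¹ X).continuousAt
    simpa [mul_assoc] using this
  have h3 := hasFDerivAt_llog_mul hO hc' hc (by simp [lexp_neg hO]) (by simp [lexp_neg hO]) h2
    (hasFDerivAt_dexp hO X)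
  rw [h3.unique (h1.congr_of_eventuallyEq (Eventually.of_forall fun Z => ?_))]
  · ext1 v; simp
  · have h4 (Y : E n) : (lexp ((2 : ℝ) • Y) : G) = lexp Y * lexp Y := by
      rw [show (2 : ℝ) = 1 + 1 by norm_num, lexp_add_smul hO, one_smul]
    simp [← smul_neg, h4, mul_assoc]

/-- The element exp(X) exp(-Z) is the inverse of the conjugate of exp(-X) exp(Z) by exp X, and
inversion is negation in the logarithmic chart. -/
lemma dexp_neg (X : E n) : dexp G O (-X) = (adChart O (lexp X : G)).comp (dexp G O X) := by
  have h1 := (hasFDerivAt_dexp hO (-X)).comp X (hasFDerivAt_id (𝕜 := ℝ) X).neg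
  have hc : ContinuousAt (fun Z : E n => (lexp (-X) * lexp Z : G)) X :=
    (continuous_mul_lexp hO _).continuousAt
  have h2 := (hasFDerivAt_llog_conj hO (lexp X : G) hc (by simp [lexp_neg hO])
    (hasFDerivAt_dexp hO X)).neg
  have hc' : ContinuousAt (fun Z : E n => (lexp Z * lexp (-X) : G)) X := by
    simpa using (contMDiffAt_mul_lexp_mul hO (1 : G) (lexp (-X)) X).continuousAt
  have h3 := h1.unique (h2.congr_of_eventuallyEq ?_)
  · have h4 := congrArg Neg.neg h3
    simpa using h4
  · filter_upwards [eventually_mem_image hO hc'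
      (by simpa [lexp_neg hO] using one_mem_image hO)] with Z hZ
    obtain ⟨Y, hY, hYZ⟩ := hZ
    have h5 : (lexp X * lexp (-Z) : G) = lexp (-Y) := by
      rw [lexp_neg hO Y, hYZ]; simp [lexp_neg hO]
    have h6 : (lexp X * (lexp (-X) * lexp Z) * (lexp X)⁻¹ : G) = lexp Y := by
      rw [hYZ]; simp [lexp_neg hO]
    simp only [Function.comp_apply, neg_neg]
    simp [h5, h6, llog_lexp hO hY, llog_lexp hO (neg_mem hO hY)]

/-- The map W ↦ log(exp X exp W) is a differentiable left inverse near X of Z ↦ log(exp(-X) exp Z).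
-/
lemma det_dexp_ne_zero {X : E n} (hX : X ∈ O) : (dexp G O X).det ≠ 0 := by
  have h1 : HasFDerivAt (fun W : E n => llog O (lexp X * lexp W : G))
      (fderiv ℝ (fun W : E n => llog O (lexp X * lexp W : G)) 0) 0 := by
    refine (differentiableAt_llog_comp hO ?_ ?_).hasFDerivAt
    swap
    · simpa using ⟨X, hX, rfl⟩
    simpa using contMDiffAt_mul_lexp_mul hO (lexp X : G) 1 0
  have h0 : llog O (lexp (-X) * lexp X : G) = (0 : E n) := by
    rw [lexp_neg hO, inv_mul_cancel, llog_one hO]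
  have h2 : HasFDerivAt (fun Z : E n => llog O (lexp X * lexp (llog O (lexp (-X) * lexp Z : G)) : G)) _ X :=
    HasFDerivAt.comp (g := fun W => llog O (lexp X * lexp W : G)) X (by rw [h0]; exact h1)
      (hasFDerivAt_dexp hO X)
  have h3 := h2.unique ((hasFDerivAt_id X).congr_of_eventuallyEq ?_)
  · intro h
    have h4 := congrArg ContinuousLinearMap.det h3
    have h5 : ∀ A B : E n →L[ℝ] E n, (A.comp B).det = A.det * B.det := fun A B =>
      LinearMap.det_comp (A : E n →ₗ[ℝ] E n) (B : E n →ₗ[ℝ] E n)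
    rw [h5, h, mul_zero] at h4
    have h6 : (ContinuousLinearMap.id ℝ (E n)).det = 1 := LinearMap.det_id
    rw [h6] at h4
    exact zero_ne_one h4
  · filter_upwards [eventually_mem_image hO (continuous_mul_lexp hO (lexp (-X) : G)).continuousAt
      (by simpa [lexp_neg hO] using one_mem_image hO), hO.isOpen.mem_nhds hX] with Z hZ hZO
    rw [lexp_llog hZ, lexp_neg hO, mul_inv_cancel_left, llog_lexp hO hZO, id]

/-- The derivative in question is a partial derivative, on the diagonal, of a function that is
jointly smooth there. -/
lemma continuous_dexp : Continuous (dexp G O) := by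
  rw [continuous_iff_continuousAt]
  intro X
  set F : E n × E n → E n := fun z => llog O (lexp (-z.1) * lexp z.2 : G) with hF
  have hsm (z : E n × E n) (hz : (lexp (-z.1) * lexp z.2 : G) ∈ lexp (G := G) '' O) :
      ContDiffAt ℝ ∞ F z :=
    contDiffAt_llog_comp hO ((contMDiff_lexp_comp hO contDiffAt_fst.neg).mul
      (contMDiff_lexp_comp hO contDiffAt_snd)) hz
  have hmem (Y : E n) : (lexp (-(Y, Y).1) * lexp (Y, Y).2 : G) ∈ lexp (G := G) '' O := by
    simpa [lexp_neg hO] using one_mem_image hO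
  have h1 (Y : E n) : dexp G O Y =
      (fderiv ℝ F (Y, Y)).comp (ContinuousLinearMap.inr ℝ (E n) (E n)) := by
    have h2 : HasFDerivAt (fun Z : E n => F (Y, Z)) _ Y :=
      ((hsm _ (hmem Y)).differentiableAt (by simp)).hasFDerivAt.comp Y
        (hasFDerivAt_prodMk_right (𝕜 := ℝ) Y Y)
    exact (hasFDerivAt_dexp hO Y).unique h2
  rw [show dexp G O = fun Y => (fderiv ℝ F (Y, Y)).comp (ContinuousLinearMap.inr ℝ (E n) (E n))
    from funext h1]
  have h3 : ContinuousAt (fderiv ℝ F) (X, X) :=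
    ((hsm _ (hmem X)).fderiv_right (m := 0) (by simp)).continuousAt
  have h4 : ContinuousAt (fun Y : E n => fderiv ℝ F (Y, Y)) X :=
    ContinuousAt.comp (f := fun Y : E n => (Y, Y)) h3 (by fun_prop)
  exact h4.clm_comp continuousAt_const

end LogChart

end LieQuant

namespace LieQuant

/-! ### The adjoint action and the Lie bracket in exponential coordinates -/

section Bracket

variable {n : ℕ} {G : Type*} [Group G] [TopologicalSpace G] [ChartedSpace (E n) G]
  [LieGroup (𝓡 n) ∞ G] [T2Space G]
  [MeasurableSpace G] {m : Measure G} {O : Set (E n)} (hO : IsWeaklyExponential m O)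

omit [LieGroup (𝓡 n) ∞ G] [T2Space G] in
lemma leftField_one (X : E n) : leftField G X (1 : G) = X := by
  have h : (fun x : G => 1 * x) = id := by ext x; simp
  change (mfderiv (𝓡 n) (𝓡 n) (fun x : G => 1 * x) 1 : E n →L[ℝ] E n) X = X
  rw [h]
  exact congrArg (fun L : E n →L[ℝ] E n => L X) (mfderiv_id (I := 𝓡 n) (x := (1 : G)))

include hO

lemma mdifferentiableAt_lexp (X : E n) :
    MDifferentiableAt 𝓘(ℝ, E n) (𝓡 n) (lexp : E n → G) X :=
  (contMDiff_lexp hO).mdifferentiable (by simp) X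

lemma mdifferentiableAt_llog {g : G} (hg : g ∈ lexp (G := G) '' O) :
    MDifferentiableAt (𝓡 n) 𝓘(ℝ, E n) (llog (G := G) O) g :=
  (contMDiffAt_llog hO hg).mdifferentiableAt (by simp)

/-- The curve t ↦ exp(tX) is an integral curve of the left invariant field of X, so its velocity at
0 is X. -/
lemma hasMFDerivAt_lexp_zero :
    HasMFDerivAt 𝓘(ℝ, E n) (𝓡 n) (lexp : E n → G) 0 (ContinuousLinearMap.id ℝ (E n)) := by
  have h := (mdifferentiableAt_lexp hO (0 : E n)).hasMFDerivAt
  have h1 : (mfderiv 𝓘(ℝ, E n) (𝓡 n) (lexp : E n → G) 0 : E n →L[ℝ] E n) =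
      ContinuousLinearMap.id ℝ (E n) := by
    refine ContinuousLinearMap.ext fun (X : E n) => ?_
    have h2 : HasMFDerivAt 𝓘(ℝ, ℝ) 𝓘(ℝ, E n) (fun t : ℝ => t • X) 0
        ((1 : ℝ →L[ℝ] ℝ).smulRight X : ℝ →L[ℝ] E n) :=
      ((hasDerivAt_id (0 : ℝ)).smul_const X).hasFDerivAt.hasMFDerivAt.congr_mfderiv
        (by ext1; simp)
    have h' : HasMFDerivAt 𝓘(ℝ, E n) (𝓡 n) (lexp : E n → G) ((0 : ℝ) • X)
        (mfderiv 𝓘(ℝ, E n) (𝓡 n) (lexp : E n → G) 0 : E n →L[ℝ] E n) := by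
      rw [zero_smul]; exact h
    have h3 := hasMFDerivAt_unique (h'.comp 0 h2) (isMIntegralCurve_lexp hO X 0)
    have h4 := congrArg (fun L : ℝ →L[ℝ] E n => L 1) h3
    have h5 : (leftField G X (lexp ((0 : ℝ) • X)) : E n) = X := by
      rw [zero_smul, lexp_zero, leftField_one]
    have h6 : (mfderiv 𝓘(ℝ, E n) (𝓡 n) (lexp : E n → G) 0 : E n →L[ℝ] E n) ((1 : ℝ) • X) =
      (1 : ℝ) • (leftField G X (lexp ((0 : ℝ) • X)) : E n) := h4
    rw [h5, one_smul] at h6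
    exact h6.trans (one_smul ℝ X)
  rw [← h1]
  exact h

lemma hasMFDerivAt_llog_one :
    HasMFDerivAt (𝓡 n) 𝓘(ℝ, E n) (llog (G := G) O) 1 (ContinuousLinearMap.id ℝ (E n)) := by
  have h := (mdifferentiableAt_llog hO (one_mem_image hO)).hasMFDerivAt
  have h' : HasMFDerivAt (𝓡 n) 𝓘(ℝ, E n) (llog (G := G) O) (lexp (0 : E n))
        (mfderiv (𝓡 n) 𝓘(ℝ, E n) (llog (G := G) O) 1 : E n →L[ℝ] E n) := by
      rw [lexp_zero]; exact h
  have h1 := h'.comp 0 (hasMFDerivAt_lexp_zero hO)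
  have h2 := hasMFDerivAt_unique h1 (hasFDerivAt_llog_lexp hO).hasMFDerivAt
  have h3 : (mfderiv (𝓡 n) 𝓘(ℝ, E n) (llog (G := G) O) 1 : E n →L[ℝ] E n) =
    ContinuousLinearMap.id ℝ (E n) := h2
  rw [← h3]
  exact h

/-- Both exp at 0 and log at 1 have the identity as derivative, so the intrinsic derivative at the
unit can be read in the logarithmic chart. -/
lemma AdL_eq_adChart (g : G) : AdL (n := n) g = adChart O g := by
  have h0 : ContMDiff (𝓡 n) (𝓡 n) ∞ (fun h : G => g * h * g⁻¹) :=
    (contMDiff_const.mul contMDiff_id).mul contMDiff_const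
  have h1 : HasMFDerivAt (𝓡 n) (𝓡 n) (fun h : G => g * h * g⁻¹) (lexp (0 : E n))
      (AdL (n := n) g) := by
    rw [lexp_zero]
    exact (h0.mdifferentiable (by simp) 1).hasMFDerivAt
  have h2 : HasMFDerivAt (𝓡 n) 𝓘(ℝ, E n) (llog (G := G) O) (g * lexp (0 : E n) * g⁻¹)
      (ContinuousLinearMap.id ℝ (E n)) := by
    rw [show g * lexp (0 : E n) * g⁻¹ = 1 by simp]; exact hasMFDerivAt_llog_one hO
  have h3 := h2.comp 0 (h1.comp 0 (hasMFDerivAt_lexp_zero hO))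
  have h4 := hasMFDerivAt_unique h3 (hasFDerivAt_adChart hO g).hasMFDerivAt
  exact h4

lemma contDiffAt_bch {X Y : E n} (h : (lexp X * lexp Y : G) ∈ lexp (G := G) '' O) :
    ContDiffAt ℝ ∞ (fun z : E n × E n => bch G O z.1 z.2) (X, Y) :=
  contDiffAt_llog_comp hO
    ((contMDiff_lexp_comp hO contDiffAt_fst).mul (contMDiff_lexp_comp hO contDiffAt_snd)) h

/-- In exponential coordinates, the left invariant vector field of `X` is
`Z ↦ ∂/∂W (Z ⋄ W) X` at `W = 0`. -/
lemma mpullback_leftField {Z : E n} (hZ : Z ∈ O) (X : E n) :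
    VectorField.mpullback 𝓘(ℝ, E n) (𝓡 n) (lexp : E n → G) (leftField G X) Z =
      fderiv ℝ (fun z : E n × E n => bch G O z.1 z.2) (Z, 0) (0, X) := by
  have hZ' : (lexp Z * lexp (0 : E n) : G) ∈ lexp (G := G) '' O := by simpa using ⟨Z, hZ, rfl⟩
  set A : E n →L[ℝ] E n := mfderiv 𝓘(ℝ, E n) (𝓡 n) (lexp : E n → G) Z with hA
  set B : E n →L[ℝ] E n := mfderiv (𝓡 n) 𝓘(ℝ, E n) (llog (G := G) O) (lexp Z) with hB
  have hA1 : HasMFDerivAt 𝓘(ℝ, E n) (𝓡 n) (lexp : E n → G) Z A :=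
    (mdifferentiableAt_lexp hO Z).hasMFDerivAt
  have hB1 : HasMFDerivAt (𝓡 n) 𝓘(ℝ, E n) (llog (G := G) O) (lexp Z) B :=
    (mdifferentiableAt_llog hO ⟨Z, hZ, rfl⟩).hasMFDerivAt
  have hBA : B.comp A = .id ℝ (E n) := by
    refine hasMFDerivAt_unique (hB1.comp Z hA1)
      (((hasFDerivAt_id (𝕜 := ℝ) Z).hasMFDerivAt).congr_of_eventuallyEq ?_)
    filter_upwards [hO.isOpen.mem_nhds hZ] with W hW
    simp [llog_lexp hO hW]
  have hAB : A.comp B = .id ℝ (E n) := by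
    have hA2 : HasMFDerivAt 𝓘(ℝ, E n) (𝓡 n) (lexp : E n → G) (llog O (lexp Z : G)) A := by
      rw [llog_lexp hO hZ]; exact hA1
    refine hasMFDerivAt_unique (hA2.comp _ hB1)
      ((hasMFDerivAt_id (lexp Z : G)).congr_of_eventuallyEq ?_)
    filter_upwards [hO.isOpen_image.mem_nhds ⟨Z, hZ, rfl⟩] with g hg
    simp [lexp_llog hg]
  -- The pullback of a vector field applies the inverse of the derivative of exp, which is the
  -- derivative of log because the two maps are mutually inverse near Z and exp Z.
  have hinv : A.inverse = B := ContinuousLinearMap.inverse_eq hAB hBA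
  have h1 : HasMFDerivAt (𝓡 n) (𝓡 n) (fun h : G => lexp Z * h) (lexp (0 : E n))
      (mfderiv (𝓡 n) (𝓡 n) (fun h : G => lexp Z * h) 1 : E n →L[ℝ] E n) := by
    rw [lexp_zero]
    exact (mdifferentiable_mul_left _ 1).hasMFDerivAt
  have h2 : HasMFDerivAt (𝓡 n) 𝓘(ℝ, E n) (llog (G := G) O) (lexp Z * lexp (0 : E n)) B := by
    rw [lexp_zero, mul_one]; exact hB1
  have h3 := h2.comp 0 (h1.comp 0 (hasMFDerivAt_lexp_zero hO))
  have h4 : HasFDerivAt (fun W : E n => bch G O Z W)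
      ((fderiv ℝ (fun z : E n × E n => bch G O z.1 z.2) (Z, 0)).comp
        (ContinuousLinearMap.inr ℝ (E n) (E n))) 0 :=
    HasFDerivAt.comp (g := fun z : E n × E n => bch G O z.1 z.2) (f := fun W : E n => (Z, W)) 0
      ((contDiffAt_bch hO hZ').differentiableAt (by simp)).hasFDerivAt
      (hasFDerivAt_prodMk_right (𝕜 := ℝ) Z (0 : E n))
  have h5 := congrArg (fun L : E n →L[ℝ] E n => L X) (hasMFDerivAt_unique h3 h4.hasMFDerivAt)
  have h6 : B ((mfderiv (𝓡 n) (𝓡 n) (fun h : G => lexp Z * h) 1 : E n →L[ℝ] E n) X) =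
    fderiv ℝ (fun z : E n × E n => bch G O z.1 z.2) (Z, 0) (0, X) := h5
  rw [← h6, ← hinv]
  rfl

/-- The Lie bracket is the antisymmetrized second derivative of `⋄` at `0`. -/
lemma adL_apply_eq (X Y : E n) :
    adL G X Y =
      fderiv ℝ (fderiv ℝ (fun z : E n × E n => bch G O z.1 z.2)) 0 (X, 0) (0, Y) -
      fderiv ℝ (fderiv ℝ (fun z : E n × E n => bch G O z.1 z.2)) 0 (Y, 0) (0, X) := by
  have := lieGroup_minSmoothness (n := n) (G := G)
  have : IsManifold (𝓡 n) (minSmoothness ℝ 2) G := IsManifold.of_le (n := ∞) (by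
    rw [minSmoothness_of_isRCLikeNormedField]; exact ENat.LEInfty.out)
  set β := fun z : E n × E n => bch G O z.1 z.2 with hβ
  have h0 : (lexp (0 : E n) * lexp (0 : E n) : G) ∈ lexp (G := G) '' O := by
    simpa using one_mem_image hO
  have hL (X : E n) : HasFDerivAt (fun Z : E n => fderiv ℝ β (Z, 0) (0, X))
      (((ContinuousLinearMap.apply ℝ (E n) ((0, X) : E n × E n)).comp
        (fderiv ℝ (fderiv ℝ β) 0)).comp (ContinuousLinearMap.inl ℝ (E n) (E n))) 0 := by
    have h2 : HasFDerivAt (fderiv ℝ β) (fderiv ℝ (fderiv ℝ β) 0) ((0 : E n), (0 : E n)) :=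
      (((contDiffAt_bch hO h0).fderiv_right (m := 1) (one_add_one_eq_two.trans_le ENat.LEInfty.out)).differentiableAt
        one_ne_zero).hasFDerivAt
    have h3 := HasFDerivAt.comp (g := fderiv ℝ β) (f := fun Z : E n => (Z, (0 : E n))) 0 h2
      (hasFDerivAt_prodMk_left (𝕜 := ℝ) (0 : E n) (0 : E n))
    exact (ContinuousLinearMap.apply ℝ (E n) ((0, X) : E n × E n)).hasFDerivAt.comp 0 h3
  have hV (X : E n) : MDifferentiableAt (𝓡 n) (𝓡 n).tangent
      (fun g : G => (⟨g, leftField G X g⟩ : TangentBundle (𝓡 n) G)) (lexp (0 : E n)) :=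
    (contMDiff_mulInvariantVectorField (I := 𝓡 n) (G := G) X).mdifferentiable
      (by rw [minSmoothness_of_isRCLikeNormedField]; norm_num) _
  -- Naturality of the bracket moves the computation to the vector space, where the bracket is a
  -- difference of derivatives of the coordinate fields Z ↦ ∂₂β(Z, 0)X.
  have hpull := VectorField.mpullback_mlieBracket (I := 𝓘(ℝ, E n)) (I' := 𝓡 n)
    (f := (lexp : E n → G)) (x₀ := 0) (n := ∞) (hV X) (hV Y) (contMDiff_lexp hO 0)
    (by rw [minSmoothness_of_isRCLikeNormedField]; exact ENat.LEInfty.out)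
  have hev (X : E n) : VectorField.mpullback 𝓘(ℝ, E n) (𝓡 n) (lexp : E n → G) (leftField G X)
      =ᶠ[𝓝 0] fun Z => fderiv ℝ β (Z, 0) (0, X) := by
    filter_upwards [eventually_mem_zero hO] with Z hZ using mpullback_leftField hO hZ X
  have hlie (V W : E n → E n) : VectorField.mlieBracket 𝓘(ℝ, E n) V W (0 : E n) =
      fderiv ℝ W 0 (V 0) - fderiv ℝ V 0 (W 0) :=
    (congrFun (VectorField.mlieBracketWithin_eq_lieBracketWithin (𝕜 := ℝ) (V := V) (W := W)
      (s := univ)) 0).trans (congrFun (VectorField.lieBracketWithin_univ (𝕜 := ℝ) (E := E n) (V := V) (W := W)) (0 : E n))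
  have hid (A : E n →L[ℝ] E n) (hA : A = .id ℝ (E n)) (v : E n) : A.inverse v = v := by
    rw [hA, ContinuousLinearMap.inverse_id]; rfl
  replace hpull := hpull.trans (((hev X).mlieBracket_vectorField_eq (hev Y)).trans (hlie _ _))
  have h1 : (mfderiv 𝓘(ℝ, E n) (𝓡 n) (lexp : E n → G) 0 : E n →L[ℝ] E n) = .id ℝ (E n) :=
    (hasMFDerivAt_lexp_zero hO).mfderiv
  have h2 : (adL G X Y : E n) = VectorField.mpullback 𝓘(ℝ, E n) (𝓡 n) (lexp : E n → G)
      (VectorField.mlieBracket (𝓡 n) (leftField G X) (leftField G Y)) 0 := by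
    have h3 : VectorField.mlieBracket (𝓡 n) (leftField G X) (leftField G Y)
        (lexp (0 : E n)) = (adL G X Y : E n) := by rw [lexp_zero]; rfl
    rw [VectorField.mpullback_apply, h3]
    exact (hid _ h1 _).symm
  rw [h2, hpull]
  have h4 (X : E n) : fderiv ℝ β (0, 0) (0, X) = X := by
    rw [← mpullback_leftField hO hO.zero_mem, VectorField.mpullback_apply, lexp_zero,
      leftField_one]
    exact hid _ h1 _
  change fderiv ℝ (fun Z => fderiv ℝ β (Z, 0) (0, Y)) 0 (fderiv ℝ β (0, 0) (0, X)) -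
    fderiv ℝ (fun Z => fderiv ℝ β (Z, 0) (0, X)) 0 (fderiv ℝ β (0, 0) (0, Y)) = _
  rw [(hL X).fderiv, (hL Y).fderiv, h4, h4]
  rfl

end Bracket

end LieQuant

namespace LieQuant

/-! ### The function φ on a Banach algebra and its doubling equation -/

section PhiFun

variable {𝔸 : Type*} [NormedRing 𝔸] [NormedAlgebra ℝ 𝔸] [CompleteSpace 𝔸]

/-- The entire function `φ(x) = (1 - e^{-x}) / x` on a Banach algebra. -/
def phiFun (A : 𝔸) : 𝔸 := ∑' k : ℕ, ((-1 : ℝ) ^ k / ((k + 1).factorial : ℝ)) • A ^ k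

lemma continuous_exp_smul : Continuous fun z : 𝔸 × ℝ => NormedSpace.exp (z.2 • z.1) := by
  letI := NormedAlgebra.restrictScalars ℚ ℝ 𝔸
  exact (NormedSpace.exp_continuous (𝔸 := 𝔸)).comp (by fun_prop)

lemma continuous_exp_smul_const (A : 𝔸) : Continuous fun s : ℝ => NormedSpace.exp (s • A) :=
  continuous_exp_smul.comp (Continuous.prodMk_right A)

lemma exp_add_smul (s t : ℝ) (A : 𝔸) :
    NormedSpace.exp ((s + t) • A) = NormedSpace.exp (s • A) * NormedSpace.exp (t • A) := by
  letI := NormedAlgebra.restrictScalars ℚ ℝ 𝔸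
  rw [add_smul, NormedSpace.exp_add_of_commute]
  exact ((Commute.refl A).smul_left s).smul_right t

/-- Integrate the exponential series termwise over [0, 1]. The integral makes continuity and the
doubling equation evident. -/
lemma phiFun_eq_integral (A : 𝔸) :
    phiFun A = ∫ s in (0 : ℝ)..1, NormedSpace.exp (s • (-A)) := by
  have h1 : HasSum (fun k : ℕ => ∫ s in (0 : ℝ)..1, ((k.factorial : ℝ)⁻¹ * (-s) ^ k) • A ^ k)
      (∫ s in (0 : ℝ)..1, NormedSpace.exp (s • (-A))) := by
    refine intervalIntegral.hasSum_integral_of_dominated_convergence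
      (fun k _ => ‖((k.factorial : ℝ)⁻¹) • A ^ k‖) (fun k => ?_) (fun k => ?_) ?_ ?_ ?_
    · exact (by fun_prop : Continuous fun s : ℝ =>
        ((k.factorial : ℝ)⁻¹ * (-s) ^ k) • A ^ k).aestronglyMeasurable
    · refine Eventually.of_forall fun s hs => ?_
      rw [uIoc_of_le zero_le_one] at hs
      rw [mul_comm, mul_smul, norm_smul]
      refine mul_le_of_le_one_left (norm_nonneg _) ?_
      rw [norm_pow, norm_neg, Real.norm_of_nonneg hs.1.le]
      exact pow_le_one₀ hs.1.le hs.2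
    · exact Eventually.of_forall fun s _ => NormedSpace.norm_expSeries_summable' A
    · exact intervalIntegrable_const
    · refine Eventually.of_forall fun s _ => ?_
      have h := (NormedSpace.expSeries_summable' (𝕂 := ℝ) (s • (-A))).hasSum
      rw [← congrFun (NormedSpace.exp_eq_tsum ℝ) (s • (-A))] at h
      refine h.congr_fun fun k => ?_
      rw [smul_neg, ← neg_smul, smul_pow, smul_smul]
  rw [← h1.tsum_eq]
  refine tsum_congr fun k => ?_
  rw [intervalIntegral.integral_smul_const]
  congr 1
  rw [intervalIntegral.integral_const_mul]
  have h2 : ∀ s : ℝ, (-s) ^ k = (-1) ^ k * s ^ k := fun s => by rw [neg_pow]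
  rw [show (fun s : ℝ => (-s) ^ k) = fun s => (-1) ^ k * s ^ k from funext h2,
    intervalIntegral.integral_const_mul, integral_pow, Nat.factorial_succ]
  have : (k.factorial : ℝ) ≠ 0 := by positivity
  push_cast
  rw [zero_pow k.succ_ne_zero, one_pow, sub_zero]
  field_simp

lemma continuous_phiFun : Continuous (phiFun (𝔸 := 𝔸)) := by
  rw [show phiFun (𝔸 := 𝔸) = fun A => ∫ s in (0 : ℝ)..1, NormedSpace.exp (s • (-A)) from
    funext phiFun_eq_integral]
  refine intervalIntegral.continuous_parametric_intervalIntegral_of_continuous' ?_ 0 1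
  exact continuous_exp_smul.comp (by fun_prop : Continuous fun z : 𝔸 × ℝ => (-z.1, z.2))

/-- The left side is the integral of e^{-sA} over [0, 2]; cut it at 1 and shift the upper half,
which pulls out e^{-A}. -/
lemma phiFun_two_smul (A : 𝔸) :
    (2 : ℝ) • phiFun ((2 : ℝ) • A) = NormedSpace.exp (-A) * phiFun A + phiFun A := by
  simp only [phiFun_eq_integral]
  have hI (a b : ℝ) : IntervalIntegrable (fun s : ℝ => NormedSpace.exp (s • (-A))) volume a b :=
    (continuous_exp_smul_const (-A)).intervalIntegrable a b
  have h1 : (fun s : ℝ => NormedSpace.exp (s • (-((2 : ℝ) • A)))) =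
      fun s => (fun s : ℝ => NormedSpace.exp (s • (-A))) (2 * s) := by
    ext1 s
    congr 1
    rw [← smul_neg, smul_smul, mul_comm]
  rw [h1, intervalIntegral.smul_integral_comp_mul_left (fun s : ℝ => NormedSpace.exp (s • (-A))) 2,
    ← intervalIntegral.integral_add_adjacent_intervals (hI (2 * 0) 1) (hI 1 (2 * 1)), add_comm]
  congr 1
  · have h2 : (fun s : ℝ => NormedSpace.exp (-A) * NormedSpace.exp (s • (-A))) =
        fun s => (fun s : ℝ => NormedSpace.exp (s • (-A))) (1 + s) := by
      ext1 s
      simp only [exp_add_smul, one_smul]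
    have h3 := (ContinuousLinearMap.mul ℝ 𝔸 (NormedSpace.exp (-A))).intervalIntegral_comp_comm
      (hI 0 1)
    simp only [ContinuousLinearMap.mul_apply'] at h3
    rw [← h3, h2, intervalIntegral.integral_comp_add_left (fun s : ℝ => NormedSpace.exp (s • (-A)))]
    norm_num
  · simp

lemma phiFun_zero : phiFun (0 : 𝔸) = 1 := by
  simp [phiFun_eq_integral, NormedSpace.exp_zero]

/-- The power series has infinite radius of convergence. Analyticity along lines through 0 will show
that the critical points of exp form a null set. -/
lemma analyticOnNhd_phiFun_smul (A : 𝔸) : AnalyticOnNhd ℝ (fun t : ℝ => phiFun (t • A)) univ := by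
  set c : ℕ → ℝ := fun k => (-1 : ℝ) ^ k / ((k + 1).factorial : ℝ) with hc
  have hr : (FormalMultilinearSeries.ofScalars 𝔸 c).radius = ⊤ := by
    refine FormalMultilinearSeries.ofScalars_radius_eq_top_of_tendsto 𝔸 c
      (Eventually.of_forall fun k => by simp [hc, Nat.factorial_ne_zero]) ?_
    have h : (fun k : ℕ => ‖c k.succ‖ / ‖c k‖) = fun k : ℕ => 1 / (((k + 1 : ℕ) : ℝ) + 1) := by
      ext1 k
      simp only [hc, norm_div, norm_pow, norm_neg, norm_one, one_pow, Nat.succ_eq_add_one]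
      rw [Nat.factorial_succ (k + 1)]
      have : ((k + 1).factorial : ℝ) ≠ 0 := by positivity
      simp only [RCLike.norm_natCast]
      push_cast
      field_simp
    rw [h]
    exact (tendsto_add_atTop_iff_nat 1).2 tendsto_one_div_add_atTop_nhds_zero_nat
  have h1 := (FormalMultilinearSeries.ofScalars 𝔸 c).hasFPowerSeriesOnBall (by rw [hr]; simp)
  have h2 : (FormalMultilinearSeries.ofScalars 𝔸 c).sum = phiFun := by
    ext1 x
    exact congrFun (FormalMultilinearSeries.ofScalarsSum_eq_tsum c) x
  rw [hr, h2] at h1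
  intro t _
  have h3 : AnalyticAt ℝ (phiFun (𝔸 := 𝔸)) (t • A) := h1.analyticAt_of_mem (by simp)
  refine h3.fun_comp_of_eq (f := fun t : ℝ => t • A) ?_ rfl
  exact analyticAt_id.smul analyticAt_const

omit [CompleteSpace 𝔸] in
lemma norm_exp_le [NormOneClass 𝔸] (A : 𝔸) : ‖NormedSpace.exp A‖ ≤ Real.exp ‖A‖ := by
  rw [Real.exp_eq_exp_ℝ, NormedSpace.exp_eq_tsum ℝ, NormedSpace.exp_eq_tsum ℝ]
  have h := NormedSpace.norm_expSeries_summable' (𝕂 := ℝ) A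
  refine (norm_tsum_le_tsum_norm h).trans
    (h.tsum_le_tsum (fun k => ?_) (NormedSpace.expSeries_summable' ‖A‖))
  rw [norm_smul, norm_inv, RCLike.norm_natCast, smul_eq_mul]
  gcongr
  exact norm_pow_le A k

/-- A one-parameter group is the exponential of its derivative at `0`. -/
lemma eq_exp_of_hasDerivAt {A : ℝ → 𝔸} {D : 𝔸} (hA : ∀ s t, A (s + t) = A s * A t)
    (h0 : A 0 = 1) (hD : HasDerivAt A D 0) : A 1 = NormedSpace.exp D := by
  have hd (t : ℝ) : HasDerivAt A (A t * D) t := by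
    have h2 : HasDerivAt A D (t - t) := by rwa [sub_self]
    refine ((HasDerivAt.comp_sub_const t t h2).const_mul (A t)).congr_of_eventuallyEq
      (Eventually.of_forall fun s => ?_)
    simp only [← hA]
    simp
  have hf (t : ℝ) : HasDerivAt (fun t => A t * NormedSpace.exp (t • (-D))) 0 t := by
    have h := (hd t).fun_mul (hasDerivAt_exp_smul_const' (-D) t)
    rwa [neg_mul, mul_neg, mul_assoc, add_neg_cancel] at h
  have hc := is_const_of_deriv_eq_zero (fun t => (hf t).differentiableAt) (fun t => (hf t).deriv) 1 0
  have h1 : NormedSpace.exp ((1 : ℝ) • (-D)) * NormedSpace.exp ((-1 : ℝ) • (-D)) = 1 := by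
    rw [← exp_add_smul]; simp [NormedSpace.exp_zero]
  simp only [h0, zero_smul, NormedSpace.exp_zero, mul_one] at hc
  have h2 := congrArg (fun L => L * NormedSpace.exp ((-1 : ℝ) • (-D))) hc
  simp only [mul_assoc, h1, mul_one, one_mul] at h2
  simpa using h2

/-- The difference Δ of two solutions satisfies 2Δ(2t) = (e^{-tD} + 1)Δ(t), hence ‖Δ(2t)‖ ≤
e^{‖tD‖}‖Δ(t)‖. Starting from 2^{-N}, the exponents of N doublings add up to at most ‖D‖, while
Δ(2^{-N}) tends to Δ(0) = 0. -/
lemma eq_phiFun_of_doubling [NormOneClass 𝔸] {f : ℝ → 𝔸} {D : 𝔸} (hf : Continuous f)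
    (h0 : f 0 = 1)
    (h : ∀ t, (2 : ℝ) • f (2 * t) = NormedSpace.exp (-(t • D)) * f t + f t) :
    f 1 = phiFun D := by
  set Δ : ℝ → 𝔸 := fun t => f t - phiFun (t • D) with hΔ
  have h1 (t : ℝ) : ‖Δ (2 * t)‖ ≤ Real.exp ‖t • D‖ * ‖Δ t‖ := by
    have h2 : (2 : ℝ) • Δ (2 * t) = NormedSpace.exp (-(t • D)) * Δ t + Δ t := by
      simp only [hΔ, smul_sub, h, mul_smul, phiFun_two_smul]
      noncomm_ring
    have h3 : ‖NormedSpace.exp (-(t • D))‖ ≤ Real.exp ‖t • D‖ := by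
      have := norm_exp_le (-(t • D))
      rwa [norm_neg] at this
    have h4 : (1 : ℝ) ≤ Real.exp ‖t • D‖ := Real.one_le_exp (norm_nonneg _)
    have h5 := congrArg norm h2
    rw [norm_smul, Real.norm_of_nonneg zero_le_two] at h5
    have h6 := norm_add_le (NormedSpace.exp (-(t • D)) * Δ t) (Δ t)
    have h9 := norm_mul_le (NormedSpace.exp (-(t • D))) (Δ t)
    have h7 := mul_le_mul_of_nonneg_right h3 (norm_nonneg (Δ t))
    have h8 := mul_le_mul_of_nonneg_right h4 (norm_nonneg (Δ t))
    linarith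
  have h2 (t : ℝ) (N : ℕ) : ‖Δ (2 ^ N * t)‖ ≤ Real.exp (2 ^ N * ‖t • D‖) * ‖Δ t‖ := by
    induction N with
    | zero =>
      simpa using le_mul_of_one_le_left (norm_nonneg (Δ t)) (Real.one_le_exp (norm_nonneg _))
    | succ N ih =>
      rw [pow_succ', mul_assoc]
      refine (h1 _).trans ?_
      rw [mul_smul, norm_smul, Real.norm_of_nonneg (by positivity)]
      refine (mul_le_mul_of_nonneg_left ih (Real.exp_pos _).le).trans ?_
      rw [← mul_assoc, ← Real.exp_add, mul_assoc, two_mul]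
  have h3 (N : ℕ) : ‖Δ 1‖ ≤ Real.exp ‖D‖ * ‖Δ ((2 : ℝ) ^ N)⁻¹‖ := by
    have h4 := h2 ((2 : ℝ) ^ N)⁻¹ N
    have h5 : (2 : ℝ) ^ N ≠ 0 := by positivity
    rwa [mul_inv_cancel₀ h5, norm_smul, Real.norm_of_nonneg (by positivity), ← mul_assoc,
      mul_inv_cancel₀ h5, one_mul] at h4
  have hΔ0 : Δ 0 = 0 := by simp [hΔ, h0, phiFun_zero]
  have h4 : Tendsto (fun N : ℕ => Real.exp ‖D‖ * ‖Δ ((2 : ℝ) ^ N)⁻¹‖) atTop (𝓝 0) := by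
    have h6 : Continuous Δ := hf.sub (continuous_phiFun.comp (by fun_prop))
    have h7 : Tendsto (fun N : ℕ => ((2 : ℝ) ^ N)⁻¹) atTop (𝓝 0) := by
      simp_rw [← inv_pow]
      exact tendsto_pow_atTop_nhds_zero_of_lt_one (by norm_num) (by norm_num)
    have h8 := ((h6.tendsto 0).comp h7).norm.const_mul (Real.exp ‖D‖)
    simpa [hΔ0] using h8
  have h5 : Δ 1 = 0 := norm_le_zero_iff.1 (ge_of_tendsto' h4 h3)
  simpa [hΔ] using sub_eq_zero.1 h5

end PhiFun

/-! ### The derivative of the exponential map -/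

section DexpFormula

variable {n : ℕ} {G : Type*} [Group G] [TopologicalSpace G] [ChartedSpace (E n) G]
  [LieGroup (𝓡 n) ∞ G] [T2Space G]
  [MeasurableSpace G] {m : Measure G} {O : Set (E n)} (hO : IsWeaklyExponential m O)

omit [T2Space G] [MeasurableSpace G] in
lemma phiAd_eq (X : E n) : phiAd G X = phiFun (adL G X) := rfl

omit [T2Space G] [MeasurableSpace G] in
lemma adL_smul (t : ℝ) (X : E n) : adL G (t • X) = t • adL G X := by
  have := lieGroup_minSmoothness (n := n) (G := G)
  ext1 Y
  exact smul_lie (L := GroupLieAlgebra (𝓡 n) G) (M := GroupLieAlgebra (𝓡 n) G) t X Y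

include hO

/-- With β(Z, W) = Z ⋄ W, the identity exp Z exp W = (exp Z exp W exp(-Z)) exp Z gives ∂₂β(Z, 0) =
∂₁β(0, Z) ∘ Ad_{exp Z}. Differentiating along Z = tX at t = 0 expresses the derivative of Ad as a
difference of second derivatives of β, which by their symmetry is the bracket. -/
lemma hasDerivAt_adChart_zero (X : E n) :
    HasDerivAt (fun t : ℝ => adChart O (lexp (t • X) : G)) (adL G X) 0 := by
  set β := fun z : E n × E n => bch G O z.1 z.2 with hβ
  set ι₁ := ContinuousLinearMap.inl ℝ (E n) (E n)
  set ι₂ := ContinuousLinearMap.inr ℝ (E n) (E n)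
  have hmem {Z : E n} (hZ : Z ∈ O) : (lexp Z * lexp (0 : E n) : G) ∈ lexp (G := G) '' O := by
    simpa using ⟨Z, hZ, rfl⟩
  have hmem' {Z : E n} (hZ : Z ∈ O) : (lexp (0 : E n) * lexp Z : G) ∈ lexp (G := G) '' O := by
    simpa using ⟨Z, hZ, rfl⟩
  have h2 : HasFDerivAt (fderiv ℝ β) (fderiv ℝ (fderiv ℝ β) 0) ((0 : E n), (0 : E n)) :=
    (((contDiffAt_bch hO (hmem hO.zero_mem)).fderiv_right (m := 1)
      (one_add_one_eq_two.trans_le ENat.LEInfty.out)).differentiableAt one_ne_zero).hasFDerivAt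
  have hL : HasDerivAt (fun t : ℝ => (fderiv ℝ β (t • X, 0)).comp ι₂)
      ((fderiv ℝ (fderiv ℝ β) 0 (X, 0)).comp ι₂) 0 := by
    have h3 : HasDerivAt (fun t : ℝ => (t • X, (0 : E n))) (X, 0) 0 := by
      simpa using ((hasDerivAt_id (0 : ℝ)).smul_const X).prodMk (hasDerivAt_const (0 : ℝ) (0 : E n))
    have h4 := HasFDerivAt.comp_hasDerivAt (f := fun t : ℝ => (t • X, (0 : E n))) (0 : ℝ)
      (by simpa using h2) h3
    simpa using h4.clm_comp (hasDerivAt_const (0 : ℝ) ι₂)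
  have hR : HasDerivAt (fun t : ℝ => (fderiv ℝ β (0, t • X)).comp ι₁)
      ((fderiv ℝ (fderiv ℝ β) 0 (0, X)).comp ι₁) 0 := by
    have h3 : HasDerivAt (fun t : ℝ => ((0 : E n), t • X)) (0, X) 0 := by
      simpa using (hasDerivAt_const (0 : ℝ) (0 : E n)).prodMk ((hasDerivAt_id (0 : ℝ)).smul_const X)
    have h4 := HasFDerivAt.comp_hasDerivAt (f := fun t : ℝ => ((0 : E n), t • X)) (0 : ℝ)
      (by simpa using h2) h3
    simpa using h4.clm_comp (hasDerivAt_const (0 : ℝ) ι₁)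
  have hA : DifferentiableAt ℝ (fun t : ℝ => adChart O (lexp (t • X) : G)) 0 := by
    set γ : E n × E n → E n := fun z => llog O (lexp z.1 * lexp z.2 * lexp (-z.1) : G) with hγ
    have hs (Z : E n) : ContDiffAt ℝ ∞ γ (Z, 0) := by
      refine contDiffAt_llog_comp hO (((contMDiff_lexp_comp hO contDiffAt_fst).mul
        (contMDiff_lexp_comp hO contDiffAt_snd)).mul (contMDiff_lexp_comp hO contDiffAt_fst.neg)) ?_
      simpa [lexp_neg hO] using one_mem_image hO
    have h1 (Z : E n) : adChart O (lexp Z : G) = (fderiv ℝ γ (Z, 0)).comp ι₂ := by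
      refine (hasFDerivAt_adChart hO (lexp Z : G)).unique ?_
      have := HasFDerivAt.comp (g := γ) (f := fun W : E n => (Z, W)) 0
        ((hs Z).differentiableAt (by simp)).hasFDerivAt
        (hasFDerivAt_prodMk_right (𝕜 := ℝ) Z (0 : E n))
      refine this.congr_of_eventuallyEq (Eventually.of_forall fun W => ?_)
      simp [hγ, lexp_neg hO]
    simp_rw [h1]
    have h3 : DifferentiableAt ℝ (fderiv ℝ γ) ((0 : ℝ) • X, (0 : E n)) :=
      ((hs _).fderiv_right (m := 1)
        (one_add_one_eq_two.trans_le ENat.LEInfty.out)).differentiableAt one_ne_zero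
    have h4 : DifferentiableAt ℝ (fun t : ℝ => fderiv ℝ γ (t • X, 0)) 0 :=
      DifferentiableAt.comp (f := fun t : ℝ => (t • X, (0 : E n))) (0 : ℝ) h3 (by fun_prop)
    exact h4.clm_comp (differentiableAt_const _)
  have hLRA {Z : E n} (hZ : Z ∈ O) : (fderiv ℝ β (Z, 0)).comp ι₂ =
      ((fderiv ℝ β (0, Z)).comp ι₁).comp (adChart O (lexp Z : G)) := by
    have h3 := HasFDerivAt.comp (g := β) (f := fun W : E n => (Z, W)) 0
      ((contDiffAt_bch hO (hmem hZ)).differentiableAt (by simp)).hasFDerivAt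
      (hasFDerivAt_prodMk_right (𝕜 := ℝ) Z (0 : E n))
    have h4 := HasFDerivAt.comp (g := β) (f := fun W : E n => (W, Z)) 0
      ((contDiffAt_bch hO (hmem' hZ)).differentiableAt (by simp)).hasFDerivAt
      (hasFDerivAt_prodMk_left (𝕜 := ℝ) (0 : E n) Z)
    have h5 : llog O (lexp Z * lexp (0 : E n) * (lexp Z)⁻¹ : G) = (0 : E n) := by
      simp [llog_one hO]
    have h6 := HasFDerivAt.comp (g := fun W : E n => β (W, Z))
      (f := fun W : E n => llog O (lexp Z * lexp W * (lexp Z)⁻¹ : G)) 0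
      (by rw [h5]; exact h4) (hasFDerivAt_adChart hO (lexp Z : G))
    refine h3.unique (h6.congr_of_eventuallyEq ?_)
    have hc : ContinuousAt (fun W : E n => (lexp Z * lexp W * (lexp Z)⁻¹ : G)) 0 :=
      (contMDiffAt_mul_lexp_mul hO _ _ _).continuousAt
    filter_upwards [eventually_mem_image hO hc (by simpa using one_mem_image hO)] with W hW
    simp [hβ, bch, lexp_llog hW]
  have hR0 : (fderiv ℝ β (0, 0)).comp ι₁ = .id ℝ (E n) := by
    have h4 := HasFDerivAt.comp (g := β) (f := fun W : E n => (W, (0 : E n))) 0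
      ((contDiffAt_bch hO (hmem hO.zero_mem)).differentiableAt (by simp)).hasFDerivAt
      (hasFDerivAt_prodMk_left (𝕜 := ℝ) (0 : E n) (0 : E n))
    refine h4.unique ((hasFDerivAt_id (𝕜 := ℝ) (0 : E n)).congr_of_eventuallyEq ?_)
    filter_upwards [eventually_mem_zero hO] with W hW
    simp [hβ, bch, llog_lexp hO hW]
  have h7 := hR.clm_comp hA.hasDerivAt
  have h8 := hL.unique (h7.congr_of_eventuallyEq (by
    filter_upwards [exists_smul_mem hO X] with t ht using hLRA ht))
  refine hA.hasDerivAt.congr_deriv (ContinuousLinearMap.ext fun Y => ?_)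
  have h9 := congrArg (fun L : E n →L[ℝ] E n => L Y) h8
  simp only [zero_smul, lexp_zero, adChart_one hO, hR0, ContinuousLinearMap.comp_id,
    ContinuousLinearMap.id_comp] at h9
  have hsymm : IsSymmSndFDerivAt ℝ β ((0 : E n), (0 : E n)) :=
    (contDiffAt_bch hO (hmem hO.zero_mem)).isSymmSndFDerivAt
      (by rw [minSmoothness_of_isRCLikeNormedField]; exact ENat.LEInfty.out)
  rw [adL_apply_eq hO]
  have h10 := hsymm.eq (Y, 0) (0, X)
  refine eq_sub_of_add_eq' (Eq.trans ?_ h9.symm)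
  exact congrArg (· + _) h10

/-- `Ad_{exp X} = e^{ad X}`. -/
lemma adChart_lexp (X : E n) : adChart O (lexp X : G) = NormedSpace.exp (adL G X) := by
  have h := eq_exp_of_hasDerivAt (A := fun t : ℝ => adChart O (lexp (t • X) : G)) (D := adL G X)
    (fun s t => ?_) ?_ (hasDerivAt_adChart_zero hO X)
  · simpa using h
  · simp only [lexp_add_smul hO]
    exact adChart_mul hO _ _
  · simp only [zero_smul, lexp_zero]
    exact adChart_one hO

/-- The derivative of the exponential map, left translated to the unit, is `φ(ad X)`. -/
lemma dexp_eq_phiAd (X : E n) : dexp G O X = phiAd G X := by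
  -- In dimension 0 the operator algebra is trivial and its unit does not have norm 1.
  rcases subsingleton_or_nontrivial (E n) with hn | hn
  · exact Subsingleton.elim _ _
  have h := eq_phiFun_of_doubling (f := fun t : ℝ => dexp G O (t • X)) (D := adL G X)
    ((continuous_dexp hO).comp (by fun_prop)) ?_ (fun t => ?_)
  · rw [phiAd_eq]
    simpa using h
  · simp only [zero_smul]
    exact dexp_zero hO
  · have h1 : adL G (-(t • X)) = -(t • adL G X) := by
      rw [← neg_smul, adL_smul]
      exact ContinuousLinearMap.ext fun Y => neg_smul t (adL G X Y)
    have h2 := dexp_two_smul hO (t • X)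
    rw [adChart_lexp hO, h1] at h2
    simp only [mul_smul]
    exact h2

end DexpFormula

end LieQuant

namespace LieQuant

/-! ### An invariant measure built from the exponential map -/

section ExpMeasure

variable {n : ℕ} {G : Type*} [Group G] [TopologicalSpace G] [ChartedSpace (E n) G]
  [LieGroup (𝓡 n) ∞ G] [T2Space G] [IsTopologicalGroup G] [SecondCountableTopology G]
  [MeasurableSpace G] [BorelSpace G] {m : Measure G} {O : Set (E n)}
  (hO : IsWeaklyExponential m O)

include hO

omit [IsTopologicalGroup G] [SecondCountableTopology G] in
lemma measurable_lexp : Measurable (lexp : E n → G) := (continuous_lexp hO).measurable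

omit [SecondCountableTopology G] [BorelSpace G] in
lemma mul_lexp_mul_isOpen (g h : G) : IsOpen {X ∈ O | g * lexp X * h ∈ lexp (G := G) '' O} :=
  hO.isOpen.inter (hO.isOpen_image.preimage
    ((continuous_const.mul (continuous_lexp hO)).mul continuous_const))

omit [SecondCountableTopology G] [BorelSpace G] [IsTopologicalGroup G] in
lemma differentiableAt_llog_mul_lexp_mul {g h : G} {X : E n}
    (hX : g * lexp X * h ∈ lexp (G := G) '' O) :
    DifferentiableAt ℝ (fun Z : E n => llog O (g * lexp Z * h)) X :=
  differentiableAt_llog_comp hO (contMDiffAt_mul_lexp_mul hO g h X) hX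

omit [SecondCountableTopology G] [BorelSpace G] [IsTopologicalGroup G] in
/-- In exponential coordinates, the map `κ : q ↦ g q h` satisfies
`dexp (κ X) ∘ κ'(X) = Ad_{h⁻¹} ∘ dexp X`. -/
lemma dexp_comp_fderiv_mul_mul {g h : G} {X : E n} (hX : g * lexp X * h ∈ lexp (G := G) '' O) :
    (dexp G O (llog O (g * lexp X * h))).comp (fderiv ℝ (fun Z => llog O (g * lexp Z * h)) X) =
      (adChart O h⁻¹).comp (dexp G O X) := by
  have h2 := HasFDerivAt.comp (f := fun Z : E n => llog O (g * lexp Z * h)) X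
    (hasFDerivAt_dexp hO (llog O (g * lexp X * h)))
    (differentiableAt_llog_mul_lexp_mul hO hX).hasFDerivAt
  have hc : ContinuousAt (fun Z : E n => (lexp (-X) * lexp Z : G)) X :=
    (continuous_mul_lexp hO _).continuousAt
  have h3 := hasFDerivAt_llog_conj hO h⁻¹ hc (by simp [lexp_neg hO]) (hasFDerivAt_dexp hO X)
  refine h2.unique (h3.congr_of_eventuallyEq ?_)
  have hc' : ContinuousAt (fun Z : E n => g * lexp Z * h) X :=
    (contMDiffAt_mul_lexp_mul hO g h X).continuousAt
  filter_upwards [eventually_mem_image hO hc' hX] with Z hZ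
  simp only [Function.comp_apply, lexp_neg hO, lexp_llog hX, lexp_llog hZ]
  simp [mul_assoc]

variable [m.IsHaarMeasure] [LocallyCompactSpace G]

/-- In exponential coordinates, Haar null sets are Lebesgue null. -/
lemma volume_preimage_lexp_eq_zero {N : Set G} (hN : MeasurableSet N) (h0 : m N = 0) :
    volume (O ∩ lexp (G := G) ⁻¹' N) = 0 := by
  set ν : Measure G := (volume.restrict O).map lexp with hν
  have hlexp := measurable_lexp (G := G) hO
  have hmeas : MeasurableSet {z : G × G | z.1 * z.2 ∈ N} := measurable_mul hN
  -- Fubini on {(x, y) : xy ∈ N}: the slices in y are m-null by left invariance, so almost every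
  -- slice in x is null for the transported Lebesgue measure ν.
  have h1 : (ν.prod m) {z : G × G | z.1 * z.2 ∈ N} = 0 := by
    rw [Measure.measure_prod_null hmeas]
    refine Eventually.of_forall fun x => ?_
    change m ((fun y => x * y) ⁻¹' N) = 0
    rw [measure_preimage_mul, h0]
  have h2 : (m.prod ν) (Prod.swap ⁻¹' {z : G × G | z.1 * z.2 ∈ N}) = 0 := by
    rw [← Measure.map_apply measurable_swap hmeas, Measure.prod_swap, h1]
  rw [Measure.measure_prod_null (measurable_swap hmeas)] at h2
  have h3 : Dense {g : G | ν {x | x * g ∈ N} = 0} := Measure.dense_of_ae h2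
  have h4 : ∃ u : ℕ → G, (∀ k, u k ∈ {g : G | ν {x | x * g ∈ N} = 0}) ∧
      Tendsto u atTop (𝓝 1) := mem_closure_iff_seq_limit.1 (h3 1)
  obtain ⟨u, hu, hu1⟩ := h4
  have h5 (k : ℕ) : volume ((fun Z : E n => llog O (1 * lexp Z * u k)) ''
      {X ∈ O | 1 * lexp X * u k ∈ lexp (G := G) '' O ∧ lexp X * u k ∈ N}) = 0 := by
    refine addHaar_image_eq_zero_of_differentiableOn_of_addHaar_eq_zero _
      (fun X hX => (differentiableAt_llog_mul_lexp_mul hO hX.2.1).differentiableWithinAt) ?_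
    have h6 : ν {x | x * u k ∈ N} = 0 := hu k
    have hm : MeasurableSet {x | x * u k ∈ N} := measurable_mul_const (u k) hN
    rw [hν, Measure.map_apply hlexp hm, Measure.restrict_apply (hlexp hm)] at h6
    refine measure_mono_null ?_ h6
    exact fun X hX => ⟨hX.2.2, hX.1⟩
  refine measure_mono_null ?_ (measure_iUnion_null h5)
  rintro Y ⟨hYO, hYN⟩
  have h6 : Tendsto (fun k => lexp Y * (u k)⁻¹) atTop (𝓝 (lexp Y * 1⁻¹ : G)) :=
    tendsto_const_nhds.mul hu1.inv
  have h8 : (lexp Y * 1⁻¹ : G) ∈ lexp (G := G) '' O := by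
    rw [inv_one, mul_one]; exact ⟨Y, hYO, rfl⟩
  obtain ⟨k, X, hX, hXk⟩ := (h6.eventually (hO.isOpen_image.mem_nhds h8)).exists
  have h7 : lexp X * u k = lexp Y := by rw [hXk, inv_mul_cancel_right]
  refine mem_iUnion.2 ⟨k, X, ⟨hX, ?_, ?_⟩, ?_⟩
  · rw [one_mul, h7]; exact ⟨Y, hYO, rfl⟩
  · rw [h7]; exact hYN
  · simp only [one_mul, h7, llog_lexp hO hYO]

omit [IsTopologicalGroup G] [SecondCountableTopology G] [m.IsHaarMeasure] [LocallyCompactSpace G] [BorelSpace G] in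
lemma measurable_abs_det_dexp : Measurable fun X : E n => ENNReal.ofReal |(dexp G O X).det| :=
  ENNReal.measurable_ofReal.comp
    ((ContinuousLinearMap.continuous_det.comp (continuous_dexp hO)).abs.measurable)

/-- Two-sided translation in exponential coordinates. -/
lemma lintegral_mul_lexp_mul (g h : G) (f : G → ℝ≥0∞) :
    ∫⁻ Y in O, ENNReal.ofReal |(dexp G O Y).det| * f (lexp Y) =
      ∫⁻ X in O, ENNReal.ofReal |(adChart O h⁻¹).det| *
        (ENNReal.ofReal |(dexp G O X).det| * f (g * lexp X * h)) := by
  set κ : E n → E n := fun Z => llog O (g * lexp Z * h) with hκ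
  -- The points moved out of 𝒰 correspond to a translate of a Haar null set, and such sets are
  -- already known to be Lebesgue null.
  have hnull (g h : G) : {X ∈ O | g * lexp X * h ∈ lexp (G := G) '' O} =ᵐ[volume] O := by
    have hU : MeasurableSet (lexp (n := n) (G := G) '' O)ᶜ := hO.isOpen_image.measurableSet.compl
    have hN : m ((fun x => g * x) ⁻¹' ((fun x => x * h) ⁻¹' (lexp (n := n) (G := G) '' O)ᶜ)) = 0 := by
      rw [measure_preimage_mul, measure_mul_right_null, hO.null_compl]
    refine (LE.le.eventuallyLE fun X hX => hX.1).antisymm (ae_le_set.2 ?_)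
    refine measure_mono_null ?_ (volume_preimage_lexp_eq_zero hO
      (measurable_const_mul g (measurable_mul_const h hU)) hN)
    exact fun X hX => ⟨hX.1, fun h' => hX.2 ⟨hX.1, h'⟩⟩
  set W := {X ∈ O | g * lexp X * h ∈ lexp (G := G) '' O} with hW
  have hWm : MeasurableSet W := (mul_lexp_mul_isOpen hO g h).measurableSet
  have himage : κ '' W = {X ∈ O | g⁻¹ * lexp X * h⁻¹ ∈ lexp (G := G) '' O} := by
    ext Y
    constructor
    · rintro ⟨X, ⟨hX1, hX2⟩, rfl⟩
      refine ⟨llog_mem hX2, ?_⟩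
      simp only [hκ, lexp_llog hX2]
      exact ⟨X, hX1, by group⟩
    · rintro ⟨hY, X, hX, hXY⟩
      have h1 : g * lexp X * h = lexp Y := by rw [hXY]; group
      refine ⟨X, ⟨hX, by rw [h1]; exact ⟨Y, hY, rfl⟩⟩, ?_⟩
      simp only [hκ, h1, llog_lexp hO hY]
  have hinj : InjOn κ W := by
    intro X hX Y hY hXY
    have h1 := congrArg (lexp (G := G)) hXY
    simp only [hκ, lexp_llog hX.2, lexp_llog hY.2, mul_left_inj, mul_right_inj] at h1
    exact hO.injOn hX.1 hY.1 h1
  have h1 := lintegral_image_eq_lintegral_abs_det_fderiv_mul volume hWm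
    (fun X hX => (differentiableAt_llog_mul_lexp_mul hO hX.2).hasFDerivAt.hasFDerivWithinAt) hinj
    (fun Y => ENNReal.ofReal |(dexp G O Y).det| * f (lexp Y))
  rw [himage, Measure.restrict_congr_set (hnull g⁻¹ h⁻¹)] at h1
  rw [h1, ← Measure.restrict_congr_set (hnull g h)]
  refine setLIntegral_congr_fun hWm fun X hX => ?_
  -- The Jacobian of the translation cancels against the density, up to the constant |det Ad_{h⁻¹}|.
  have h2 := congrArg ContinuousLinearMap.det (dexp_comp_fderiv_mul_mul hO hX.2)
  have h5 : ∀ A B : E n →L[ℝ] E n, (A.comp B).det = A.det * B.det := fun A B =>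
    LinearMap.det_comp (A : E n →ₗ[ℝ] E n) (B : E n →ₗ[ℝ] E n)
  rw [h5, h5] at h2
  rw [← mul_assoc, ← mul_assoc, ← ENNReal.ofReal_mul (abs_nonneg _),
    ← ENNReal.ofReal_mul (abs_nonneg _), ← abs_mul, ← abs_mul, ← h2, mul_comm, lexp_llog hX.2,
    mul_comm (ContinuousLinearMap.det (fderiv _ _ _))]
  rw [mul_comm]

/-- The measure `|det dexp| dX` on `𝒪`, transported to `G` by the exponential map. -/
def expMeasure (G : Type*) [Group G] [TopologicalSpace G] [ChartedSpace (E n) G]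
    [MeasurableSpace G] (O : Set (E n)) : Measure G :=
  ((volume.restrict O).withDensity fun X => ENNReal.ofReal |(dexp G O X).det|).map lexp

omit [IsTopologicalGroup G] [SecondCountableTopology G] [m.IsHaarMeasure] [LocallyCompactSpace G] in
lemma lintegral_expMeasure {f : G → ℝ≥0∞} (hf : Measurable f) :
    ∫⁻ g, f g ∂expMeasure G O = ∫⁻ X in O, ENNReal.ofReal |(dexp G O X).det| * f (lexp X) := by
  rw [expMeasure, lintegral_map hf (measurable_lexp hO),
    lintegral_withDensity_eq_lintegral_mul _ (measurable_abs_det_dexp hO)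
      (g := fun X => f (lexp X)) (hf.comp (measurable_lexp hO))]
  rfl

lemma isMulLeftInvariant_expMeasure : (expMeasure G O).IsMulLeftInvariant := by
  refine ⟨fun g => Measure.ext_of_lintegral _ fun f hf => ?_⟩
  rw [lintegral_map hf (measurable_const_mul g), lintegral_expMeasure hO hf,
    lintegral_expMeasure hO (f := fun x => f (g * x)) (hf.comp (measurable_const_mul g)), lintegral_mul_lexp_mul hO g 1]
  simp only [inv_one, adChart_one hO, mul_one]
  have : (ContinuousLinearMap.id ℝ (E n)).det = 1 := LinearMap.det_id
  simp [this]

-- The logarithm takes K ∩ 𝒰 into a compact set, which has finite volume and on which the continuous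
-- density is bounded.
omit [IsTopologicalGroup G] [SecondCountableTopology G] [m.IsHaarMeasure] [LocallyCompactSpace G] in
lemma isFiniteMeasureOnCompacts_expMeasure : IsFiniteMeasureOnCompacts (expMeasure G O) := by
  refine ⟨fun K hK => ?_⟩
  set S := K ∩ lexp (G := G) '' O
  have hS : IsCompact (closure S) := hK.closure_of_subset inter_subset_left
  have hC := hO.precompact S inter_subset_right hS
  set C := closure (llog O '' S)
  obtain ⟨c, hc⟩ := hC.exists_bound_of_continuousOn (f := fun X => (dexp G O X).det)
    (ContinuousLinearMap.continuous_det.comp (continuous_dexp hO)).continuousOn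
  have h1 : expMeasure G O K = ∫⁻ X in O, ENNReal.ofReal |(dexp G O X).det| *
      K.indicator 1 (lexp X) := by
    rw [← lintegral_expMeasure hO (measurable_one.indicator hK.measurableSet),
      lintegral_indicator_one hK.measurableSet]
  rw [h1]
  calc ∫⁻ X in O, ENNReal.ofReal |(dexp G O X).det| * K.indicator 1 (lexp X)
      ≤ ∫⁻ X in O, C.indicator (fun _ => ENNReal.ofReal c) X := by
        refine setLIntegral_mono_ae (Measurable.aemeasurable
          (measurable_const.indicator hC.measurableSet)) (Eventually.of_forall fun X hX => ?_)
        by_cases hK' : (lexp X : G) ∈ K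
        · have hXC : X ∈ C := subset_closure ⟨lexp X, ⟨hK', X, hX, rfl⟩, llog_lexp hO hX⟩
          rw [indicator_of_mem hK', indicator_of_mem hXC, Pi.one_apply, mul_one]
          exact ENNReal.ofReal_le_ofReal (hc X hXC)
        · rw [indicator_of_notMem hK', mul_zero]
          exact zero_le
    _ ≤ ∫⁻ X, C.indicator (fun _ => ENNReal.ofReal c) X := setLIntegral_le_lintegral _ _
    _ = ENNReal.ofReal c * volume C := by
        rw [lintegral_indicator hC.measurableSet, setLIntegral_const]
    _ < ⊤ := ENNReal.mul_lt_top ENNReal.ofReal_lt_top hC.measure_lt_top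

end ExpMeasure

end LieQuant

namespace LieQuant

/-! ### Null sets, averages and determinants on Euclidean space -/

section Euclidean

variable {n : ℕ}

lemma analyticOnNhd_det {f : ℝ → (E n →L[ℝ] E n)} (hf : AnalyticOnNhd ℝ f univ) :
    AnalyticOnNhd ℝ (fun t => (f t).det) univ := by
  set b := (EuclideanSpace.basisFun (Fin n) ℝ).toBasis with hb
  have h1 : (fun t => (f t).det) = fun t => ∑ σ : Equiv.Perm (Fin n),
      ((Equiv.Perm.sign σ : ℤ) : ℝ) * ∏ i, (f t (b i)) (σ i) := by
    ext1 t
    change LinearMap.det (f t : E n →ₗ[ℝ] E n) = _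
    rw [← LinearMap.det_toMatrix b, Matrix.det_apply']
    refine Finset.sum_congr rfl fun σ _ => ?_
    congr 1
    refine Finset.prod_congr rfl fun i _ => ?_
    simp [LinearMap.toMatrix_apply, hb]
  rw [h1]
  intro t ht
  refine Finset.analyticAt_fun_sum _ fun σ _ => analyticAt_const.mul
    (Finset.analyticAt_fun_prod _ fun i _ => ?_)
  have h2 := ((EuclideanSpace.proj (σ i) : E n →L[ℝ] ℝ).comp
    (ContinuousLinearMap.apply ℝ (E n) (b i))).analyticAt (f t)
  exact h2.fun_comp_of_eq (hf t ht) rfl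

/-- A set that meets every line through `0` in a null set is null. -/
lemma volume_eq_zero_of_lines {S : Set (E n)} (hS : MeasurableSet S)
    (h : ∀ X : E n, volume {t : ℝ | t • X ∈ S} = 0) : volume S = 0 := by
  have hm : MeasurableSet {z : E n × ℝ | z.2 • z.1 ∈ S} :=
    (by fun_prop : Continuous fun z : E n × ℝ => z.2 • z.1).measurable hS
  have h1 : ((volume : Measure (E n)).prod (volume : Measure ℝ)) {z | z.2 • z.1 ∈ S} = 0 := by
    rw [Measure.measure_prod_null hm]
    exact Eventually.of_forall h
  have h2 : ((volume : Measure ℝ).prod (volume : Measure (E n)))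
      (Prod.swap ⁻¹' {z : E n × ℝ | z.2 • z.1 ∈ S}) = 0 := by
    rw [← Measure.map_apply measurable_swap hm, Measure.prod_swap, h1]
  rw [Measure.measure_prod_null (measurable_swap hm)] at h2
  have h3 : ∀ᵐ t : ℝ, t ≠ 0 := by simp [ae_iff]
  -- By Fubini almost every dilate of the set is null, and one nonzero factor suffices.
  obtain ⟨t, ht, ht0⟩ := (h2.and h3).exists
  have h4 : volume ((fun X : E n => t • X) ⁻¹' S) = 0 := ht
  rw [Measure.addHaar_preimage_smul volume ht0, mul_eq_zero] at h4
  refine h4.resolve_left ?_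
  rw [ENNReal.ofReal_eq_zero, not_le]
  positivity

/-- The averages of a continuous function over small balls converge to its value. -/
lemma tendsto_average_ball {D : E n → ℝ≥0∞} (hD : ContinuousAt D 0) (h0 : D 0 ≠ ⊤) :
    Tendsto (fun r : ℝ => (∫⁻ X in Metric.ball 0 r, D X) / volume (Metric.ball (0 : E n) r))
      (𝓝[>] 0) (𝓝 (D 0)) := by
  rw [ENNReal.tendsto_nhds h0]
  intro ε hε
  have h1 := (ENNReal.tendsto_nhds h0).1 hD ε hε
  obtain ⟨δ, hδ, hb⟩ := Metric.eventually_nhds_iff_ball.1 h1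
  filter_upwards [Ioo_mem_nhdsGT hδ] with r hr
  have hsub : Metric.ball (0 : E n) r ⊆ Metric.ball 0 δ := Metric.ball_subset_ball hr.2.le
  have hv0 : volume (Metric.ball (0 : E n) r) ≠ 0 := (Metric.measure_ball_pos _ _ hr.1).ne'
  have hv1 : volume (Metric.ball (0 : E n) r) ≠ ⊤ := measure_ball_lt_top.ne
  constructor
  · rw [ENNReal.le_div_iff_mul_le (Or.inl hv0) (Or.inl hv1), ← setLIntegral_const]
    exact setLIntegral_mono' measurableSet_ball fun X hX => (hb X (hsub hX)).1
  · rw [ENNReal.div_le_iff hv0 hv1, ← setLIntegral_const]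
    exact setLIntegral_mono' measurableSet_ball fun X hX => (hb X (hsub hX)).2

end Euclidean

/-! ### Haar measure in exponential coordinates and the boundary of 𝒪 -/

section HaarFormula

variable {n : ℕ} {G : Type*} [Group G] [TopologicalSpace G] [ChartedSpace (E n) G]
  [LieGroup (𝓡 n) ∞ G] [T2Space G] [IsTopologicalGroup G] [SecondCountableTopology G]
  [MeasurableSpace G] [BorelSpace G] {m : Measure G} {O : Set (E n)}
  (hO : IsWeaklyExponential m O)

include hO

omit [IsTopologicalGroup G] [SecondCountableTopology G] [BorelSpace G] in
lemma isClosed_det_dexp : IsClosed {X : E n | (dexp G O X).det = 0} :=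
  isClosed_eq (ContinuousLinearMap.continuous_det.comp (continuous_dexp hO)) continuous_const

omit [IsTopologicalGroup G] [SecondCountableTopology G] [BorelSpace G] in
/-- The critical points of the exponential map form a null set. -/
lemma volume_det_dexp_eq_zero : volume {X : E n | (dexp G O X).det = 0} = 0 := by
  refine volume_eq_zero_of_lines (isClosed_det_dexp hO).measurableSet fun X => ?_
  -- On each line through 0 the function det φ(t ad X) is analytic and nonzero at t = 0, so its
  -- zeros are discrete.
  have h1 : AnalyticOnNhd ℝ (fun t : ℝ => (dexp G O (t • X)).det) univ := by
    simp only [dexp_eq_phiAd hO, phiAd_eq, adL_smul]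
    exact analyticOnNhd_det (analyticOnNhd_phiFun_smul (adL G X))
  have h2 : (dexp G O ((0 : ℝ) • X)).det ≠ 0 := by
    rw [zero_smul]; exact det_dexp_ne_zero hO hO.zero_mem
  have h3 := h1.preimage_zero_mem_codiscrete h2
  have h4 := ae_restrict_le_codiscreteWithin (μ := (volume : Measure ℝ)) MeasurableSet.univ h3
  rw [Measure.restrict_univ] at h4
  refine measure_mono_null (fun t ht => ?_) h4
  simpa using ht

variable [m.IsHaarMeasure] [LocallyCompactSpace G]

/-- Uniqueness of Haar measure. The factor is not zero because the density is nonzero on the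
nonempty open set 𝒪. -/
lemma exists_expMeasure_eq_smul : ∃ k : ℝ≥0∞, k ≠ 0 ∧ k ≠ ⊤ ∧ expMeasure G O = k • m := by
  have := isMulLeftInvariant_expMeasure hO
  have := isFiniteMeasureOnCompacts_expMeasure hO
  have h := Measure.isMulLeftInvariant_eq_smul (expMeasure G O) m
  refine ⟨(expMeasure G O).haarScalarFactor m, fun h0 => ?_, ENNReal.coe_ne_top, h⟩
  rw [ENNReal.coe_eq_zero] at h0
  rw [h0, zero_smul] at h
  have h1 := lintegral_expMeasure hO (f := fun _ => 1) measurable_const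
  rw [h, lintegral_zero_measure] at h1
  have h2 : 0 < ∫⁻ X in O, ENNReal.ofReal |(dexp G O X).det| * 1 := by
    simp only [mul_one]
    rw [lintegral_pos_iff_support (measurable_abs_det_dexp hO)]
    refine lt_of_lt_of_le (hO.isOpen.measure_pos volume ⟨0, hO.zero_mem⟩) ?_
    rw [← Measure.restrict_apply_self]
    refine measure_mono fun X hX => ?_
    simpa using det_dexp_ne_zero hO hX
  exact h2.ne h1

omit [IsTopologicalGroup G] [SecondCountableTopology G] [m.IsHaarMeasure] [LocallyCompactSpace G] in
lemma expMeasure_image {B : Set (E n)} (hB : IsOpen B) (hBO : B ⊆ O) :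
    expMeasure G O (lexp '' B) = ∫⁻ X in B, ENNReal.ofReal |(dexp G O X).det| := by
  have himage : lexp (G := G) '' B = lexp '' O ∩ llog O ⁻¹' B := by
    ext g
    constructor
    · rintro ⟨X, hX, rfl⟩
      refine ⟨⟨X, hBO hX, rfl⟩, ?_⟩
      rwa [mem_preimage, llog_lexp hO (hBO hX)]
    · rintro ⟨hg, hg'⟩
      exact ⟨_, hg', lexp_llog hg⟩
  have hmeas : MeasurableSet (lexp (G := G) '' B) := by
    rw [himage]
    exact (hO.smooth_inv.continuousOn.isOpen_inter_preimage hO.isOpen_image hB).measurableSet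
  rw [← lintegral_indicator_one hmeas, lintegral_expMeasure hO (measurable_one.indicator hmeas),
    ← inter_eq_self_of_subset_left hBO, ← setLIntegral_indicator hB.measurableSet]
  refine setLIntegral_congr_fun hO.isOpen.measurableSet fun X hX => ?_
  by_cases hXB : X ∈ B
  · simp only [inter_eq_self_of_subset_left hBO]
    rw [indicator_of_mem (mem_image_of_mem _ hXB), indicator_of_mem hXB]
    simp
  · have : (lexp X : G) ∉ lexp (G := G) '' B := by
      rintro ⟨Y, hY, hXY⟩
      exact hXB (hO.injOn (hBO hY) hX hXY ▸ hY)
    simp only [inter_eq_self_of_subset_left hBO]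
    rw [indicator_of_notMem this, indicator_of_notMem hXB, mul_zero]

/-- On small balls the quotient defining the density is a constant times the average of |det dexp|,
whose limit is |det dexp(0)| = 1. So the limit exists and is the Haar constant. -/
lemma unitDensity_spec : unitDensity n m ≠ 0 ∧ unitDensity n m ≠ ⊤ ∧
    m = unitDensity n m • expMeasure G O := by
  obtain ⟨k, hk0, hk1, hk⟩ := exists_expMeasure_eq_smul hO
  have hm : m = k⁻¹ • expMeasure G O := by
    rw [hk, smul_smul, ENNReal.inv_mul_cancel hk0 hk1, one_smul]
  have h1 : (dexp G O (0 : E n)).det = 1 := by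
    rw [dexp_zero hO]; exact LinearMap.det_id
  have hlim := tendsto_average_ball (D := fun X : E n => ENNReal.ofReal |(dexp G O X).det|)
    (ENNReal.continuous_ofReal.comp
      (ContinuousLinearMap.continuous_det.comp (continuous_dexp hO)).abs).continuousAt (by simp)
  have hlim2 := ENNReal.Tendsto.const_mul (a := k⁻¹) hlim (Or.inr (by simpa using hk0))
  simp only [h1, abs_one, ENNReal.ofReal_one, mul_one] at hlim2
  have hu : unitDensity n m = k⁻¹ := by
    refine Tendsto.limUnder_eq (hlim2.congr' ?_)
    obtain ⟨δ, hδ, hb⟩ := Metric.isOpen_iff.1 hO.isOpen 0 hO.zero_mem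
    filter_upwards [Ioo_mem_nhdsGT hδ] with r hr
    have h2 : m (lexp (n := n) (G := G) '' Metric.ball 0 r) =
        k⁻¹ * expMeasure G O (lexp (n := n) (G := G) '' Metric.ball 0 r) := by
      conv_lhs => rw [hm]
      rfl
    rw [h2, expMeasure_image hO Metric.isOpen_ball ((Metric.ball_subset_ball hr.2.le).trans hb),
      mul_div_assoc]
  rw [hu]
  exact ⟨by simpa using hk1, by simpa using hk0, hm⟩

/-- Integration in exponential coordinates. -/
lemma lintegral_eq_lintegral_lexp {f : G → ℝ≥0∞} (hf : Measurable f) :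
    ∫⁻ g, f g ∂m = ∫⁻ X in O, ENNReal.ofReal |(phiAd G X).det| * f (lexp X) ∂(measX n m) := by
  conv_lhs => rw [(unitDensity_spec hO).2.2]
  rw [lintegral_smul_measure, lintegral_expMeasure hO hf, measX, Measure.restrict_smul,
    lintegral_smul_measure]
  simp only [dexp_eq_phiAd hO]

/-- The modular function is |det Ad|, read off from the two-sided translation formula in exponential
coordinates. -/
lemma lintegral_mul_right (h : G) {f : G → ℝ≥0∞} (hf : Measurable f) :
    ∫⁻ g, f g ∂m = ENNReal.ofReal |(AdL (n := n) h⁻¹).det| * ∫⁻ g, f (g * h) ∂m := by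
  rw [(unitDensity_spec hO).2.2, lintegral_smul_measure, lintegral_smul_measure,
    lintegral_expMeasure hO hf,
    lintegral_expMeasure hO (f := fun g => f (g * h)) (hf.comp (measurable_mul_const h)),
    lintegral_mul_lexp_mul hO 1 h, lintegral_const_mul', AdL_eq_adChart hO]
  · simp only [one_mul, smul_eq_mul]
    ring
  · exact ENNReal.ofReal_ne_top

-- If exp Y lay in 𝒰, then log ∘ exp would be continuous at Y and the identity on 𝒪. Passing to the
-- limit from 𝒪 would give Y = log(exp Y) ∈ 𝒪.
omit [IsTopologicalGroup G] [SecondCountableTopology G] [m.IsHaarMeasure] [LocallyCompactSpace G] [BorelSpace G] in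
lemma lexp_notMem_of_mem_frontier {Y : E n} (hY : Y ∈ closure O \ O) :
    (lexp Y : G) ∉ lexp (G := G) '' O := by
  intro h
  have h1 : Tendsto (fun Z : E n => llog O (lexp Z : G)) (𝓝[O] Y) (𝓝 (llog O (lexp Y : G))) :=
    (((contMDiffAt_llog hO h).continuousAt).comp (continuous_lexp hO).continuousAt).mono_left
      nhdsWithin_le_nhds
  have h2 : Tendsto (fun Z : E n => llog O (lexp Z : G)) (𝓝[O] Y) (𝓝 Y) := by
    refine (tendsto_id.mono_left nhdsWithin_le_nhds).congr' ?_
    filter_upwards [self_mem_nhdsWithin] with Z hZ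
    rw [llog_lexp hO hZ, id]
  have : (𝓝[O] Y).NeBot := mem_closure_iff_nhdsWithin_neBot.1 hY.1
  have h3 := tendsto_nhds_unique h1 h2
  exact hY.2 (h3 ▸ llog_mem h)

/-- The boundary of `𝒪` is a null set. -/
lemma volume_closure_diff : volume (closure O \ O) = 0 := by
  -- Near a boundary point Y that is not critical, Z ↦ log(exp(-Y) exp Z) is a local diffeomorphism.
  -- It takes boundary points to the logarithm of exp(-Y) 𝒰ᶜ, a Haar null and hence Lebesgue null
  -- set, and the local inverse brings this back.
  have h1 : volume ((closure O \ O) \ {X : E n | (dexp G O X).det = 0}) = 0 := by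
    refine measure_null_of_locally_null _ fun Y hY => ?_
    set e := (dexp G O Y).toContinuousLinearEquivOfDetNeZero hY.2 with he
    have hmem : (lexp (-Y) * lexp Y * 1 : G) ∈ lexp (G := G) '' O := by
      simpa [lexp_neg hO] using one_mem_image hO
    set f : E n → E n := fun Z => llog O (lexp (-Y) * lexp Z : G) with hf
    have hcd : ContDiffAt ℝ ∞ f Y := by
      have := contDiffAt_llog_comp hO (contMDiffAt_mul_lexp_mul hO (lexp (-Y) : G) 1 Y) hmem
      simpa using this
    have hder : HasFDerivAt f (e : E n →L[ℝ] E n) Y := by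
      simpa [he] using hasFDerivAt_dexp hO Y
    have hstr := hcd.hasStrictFDerivAt' hder (by simp)
    have hinv : ContDiffAt ℝ ∞ (hcd.localInverse hder (by simp)) (f Y) :=
      hcd.to_localInverse hder (by simp)
    have hinv1 : ∀ᶠ W in 𝓝 (f Y), DifferentiableAt ℝ (hcd.localInverse hder (by simp)) W := by
      filter_upwards [(hinv.of_le (m := 1) (by simp)).eventually (by simp)] with W hW
      exact hW.differentiableAt one_ne_zero
    have hc : ContinuousAt (fun Z : E n => (lexp (-Y) * lexp Z : G)) Y :=
      (continuous_mul_lexp hO _).continuousAt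
    have hev : ∀ᶠ Z in 𝓝 Y, hcd.localInverse hder (by simp) (f Z) = Z ∧
        DifferentiableAt ℝ (hcd.localInverse hder (by simp)) (f Z) ∧
        (lexp (-Y) * lexp Z : G) ∈ lexp (G := G) '' O :=
      hstr.eventually_left_inverse.and ((hcd.continuousAt.eventually hinv1).and
        (eventually_mem_image hO hc (by simpa using hmem)))
    refine ⟨_, inter_mem_nhdsWithin _ hev, ?_⟩
    have hU : MeasurableSet (lexp (n := n) (G := G) '' O)ᶜ := hO.isOpen_image.measurableSet.compl
    have hN : m ((fun x => lexp Y * x) ⁻¹' (lexp (n := n) (G := G) '' O)ᶜ) = 0 := by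
      rw [measure_preimage_mul, hO.null_compl]
    have h2 := volume_preimage_lexp_eq_zero hO (measurable_const_mul (lexp Y : G) hU) hN
    have h3 := addHaar_image_eq_zero_of_differentiableOn_of_addHaar_eq_zero volume
      (s := (O ∩ lexp (G := G) ⁻¹' ((fun x => lexp Y * x) ⁻¹' (lexp (n := n) (G := G) '' O)ᶜ)) ∩
        {W | DifferentiableAt ℝ (hcd.localInverse hder (by simp)) W})
      (fun W hW => hW.2.differentiableWithinAt) (measure_mono_null inter_subset_left h2)
    refine measure_mono_null ?_ h3
    rintro Z ⟨hZ, hZ1, hZ2, hZ3⟩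
    refine ⟨f Z, ⟨⟨llog_mem hZ3, ?_⟩, hZ2⟩, hZ1⟩
    simp only [mem_preimage, hf, lexp_llog hZ3]
    rw [lexp_neg hO, mul_inv_cancel_left]
    exact lexp_notMem_of_mem_frontier hO hZ.1
  refine measure_mono_null (fun X hX => ?_) (measure_union_null h1 (volume_det_dexp_eq_zero hO))
  by_cases h : (dexp G O X).det = 0
  · exact Or.inr h
  · exact Or.inl ⟨hX, h⟩

end HaarFormula

end LieQuant

namespace LieQuant

/-! ### Hilbert-Schmidt models from elementary tensors -/

section OfTensor

variable {K H : Type*} [NormedAddCommGroup K] [InnerProductSpace ℂ K] [CompleteSpace K]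
  [NormedAddCommGroup H] [InnerProductSpace ℂ H] [CompleteSpace H]

/-- A product and an involution that act on elementary tensors as on rank one operators make up a
model of the Hilbert-Schmidt operators. -/
def HSModel.ofTensor {B : H →L[ℂ] H →L[ℂ] H} {C : H → H} (e : K →L[ℂ] K →L⋆[ℂ] H)
    (he : ∀ α β α' β', inner ℂ (e α β) (e α' β') = inner ℂ α α' * inner ℂ β' β)
    (hd : Dense (Submodule.span ℂ (range fun z : K × K => e z.1 z.2) : Set H))
    (hB : ∀ α β α' β', B (e α β) (e α' β') = inner ℂ β α' • e α β')
    (hC : ∀ α β, C (e α β) = e β α) (hCc : Continuous C) (hCadd : ∀ f g, C (f + g) = C f + C g)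
    (hCsmul : ∀ (c : ℂ) f, C (c • f) = starRingEnd ℂ c • C f) : HSModel B C K := by
  -- The operator of f is forced by ⟨α, f β⟩ = ⟨e α β, f⟩, that is, β goes to the adjoint of α ↦ e α
  -- β applied to f.
  let Op₀ : H →ₗ[ℂ] K →ₗ[ℂ] K := LinearMap.mk₂ ℂ
    (fun f β => ContinuousLinearMap.adjoint (e.flip β) f)
    (fun f g β => map_add _ f g) (fun c f β => map_smul _ c f)
    (fun f β γ => by simp [map_add])
    (fun c f β => by rw [map_smulₛₗ, map_smulₛₗ]; simp)
  have hnorm (α β : K) : ‖e α β‖ = ‖α‖ * ‖β‖ := by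
    have h1 : (‖e α β‖ : ℂ) ^ 2 = ((‖α‖ * ‖β‖ : ℝ) : ℂ) ^ 2 := by
      have h := he α β α β
      rw [inner_self_eq_norm_sq_to_K, inner_self_eq_norm_sq_to_K, inner_self_eq_norm_sq_to_K] at h
      simpa [mul_pow] using h
    have h2 : ‖e α β‖ ^ 2 = (‖α‖ * ‖β‖) ^ 2 := by exact_mod_cast h1
    exact (pow_left_inj₀ (norm_nonneg _) (by positivity) two_ne_zero).1 h2
  let Op : H →L[ℂ] K →L[ℂ] K := Op₀.mkContinuous₂ 1 fun f β => by
    change ‖ContinuousLinearMap.adjoint (e.flip β) f‖ ≤ _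
    have h1 : ‖ContinuousLinearMap.adjoint (e.flip β)‖ ≤ ‖β‖ := by
      rw [LinearIsometryEquiv.norm_map]
      refine ContinuousLinearMap.opNorm_le_bound _ (norm_nonneg _) fun α => ?_
      rw [ContinuousLinearMap.flip_apply, hnorm, mul_comm]
    refine (ContinuousLinearMap.le_of_opNorm_le _ h1 f).trans ?_
    rw [one_mul, mul_comm]
  have hOp (f : H) (α β : K) : inner ℂ α (Op f β) = inner ℂ (e α β) f :=
    ContinuousLinearMap.adjoint_inner_right (e.flip β) α f
  have hOpe (α β : K) : Op (e α β) = InnerProductSpace.rankOne ℂ α β := by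
    refine ContinuousLinearMap.ext fun γ => ext_inner_left ℂ fun δ => ?_
    rw [hOp, he, InnerProductSpace.rankOne_apply, inner_smul_right, mul_comm]
  refine ⟨fun α β => e α β, Op, hOpe, fun α β f => (hOp f α β).symm, hd, ?_, ?_⟩
  · intro f g
    -- Both sides are continuous bilinear maps, so they need only be compared on elementary tensors.
    have h1 : ((ContinuousLinearMap.compL ℂ H H (K →L[ℂ] K) Op).comp B) =
        ((ContinuousLinearMap.compL ℂ H (K →L[ℂ] K) (K →L[ℂ] K)).flip Op).comp
          ((ContinuousLinearMap.mul ℂ (K →L[ℂ] K)).comp Op) := by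
      refine ContinuousLinearMap.ext_on hd ?_
      rintro _ ⟨z, rfl⟩
      refine ContinuousLinearMap.ext_on hd ?_
      rintro _ ⟨w, rfl⟩
      simp only [ContinuousLinearMap.comp_apply, ContinuousLinearMap.compL_apply,
        ContinuousLinearMap.flip_apply, ContinuousLinearMap.mul_apply', hB, map_smul, hOpe]
      ext1 γ
      simp [InnerProductSpace.rankOne_apply, ContinuousLinearMap.mul_def, smul_smul, mul_comm]
    exact congrArg (fun L => L f g) h1
  · intro f
    have hcl : IsClosed {f | Op (C f) = ContinuousLinearMap.adjoint (Op f)} :=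
      isClosed_eq (Op.continuous.comp hCc)
        (ContinuousLinearMap.adjoint.continuous.comp Op.continuous)
    refine hcl.closure_subset_iff.2 (fun v hv => ?_) (hd f)
    induction hv using Submodule.span_induction with
    | mem x hx =>
      obtain ⟨z, rfl⟩ := hx
      change Op (C (e z.1 z.2)) = ContinuousLinearMap.adjoint (Op (e z.1 z.2))
      rw [hC, hOpe, hOpe, InnerProductSpace.adjoint_rankOne]
    | zero =>
      have : C 0 = 0 := by simpa using hCsmul 0 0
      simp [this]
    | add x y _ _ hx hy =>
      rw [mem_ofPred_eq] at hx hy ⊢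
      rw [hCadd, map_add, map_add, map_add, hx, hy]
    | smul c x _ hx =>
      rw [mem_ofPred_eq] at hx ⊢
      rw [hCsmul, map_smul, map_smul, hx, map_smulₛₗ]

end OfTensor

/-! ### Tensor products of square integrable functions -/

section TensorL2

variable {α β : Type*} [MeasurableSpace α] [MeasurableSpace β] {μ : Measure α} {ν : Measure β}

lemma memLp_two_mul_prod [SFinite μ] [SFinite ν] {f : α → ℂ} {g : β → ℂ} (hf : MemLp f 2 μ)
    (hg : MemLp g 2 ν) : MemLp (fun z : α × β => f z.1 * g z.2) 2 (μ.prod ν) := by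
  have h1 : AEStronglyMeasurable (fun z : α × β => f z.1 * g z.2) (μ.prod ν) :=
    hf.1.comp_fst.mul hg.1.comp_snd
  rw [memLp_two_iff_integrable_sq_norm h1]
  have h2 := ((memLp_two_iff_integrable_sq_norm hf.1).1 hf).mul_prod
    ((memLp_two_iff_integrable_sq_norm hg.1).1 hg)
  simpa [mul_pow] using h2

variable [SFinite μ] [SFinite ν]

/-- The tensor product of square integrable functions. -/
def tensorFun (f : Lp ℂ 2 μ) (g : Lp ℂ 2 ν) : Lp ℂ 2 (μ.prod ν) :=
  (memLp_two_mul_prod (Lp.memLp f) (Lp.memLp g)).toLp _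

lemma coeFn_tensorFun (f : Lp ℂ 2 μ) (g : Lp ℂ 2 ν) :
    tensorFun f g =ᵐ[μ.prod ν] fun z => f z.1 * g z.2 := MemLp.coeFn_toLp _

lemma ae_fst {p : α → Prop} (h : ∀ᵐ x ∂μ, p x) : ∀ᵐ z ∂μ.prod ν, p z.1 :=
  Measure.quasiMeasurePreserving_fst.ae h

lemma ae_snd {p : β → Prop} (h : ∀ᵐ x ∂ν, p x) : ∀ᵐ z ∂μ.prod ν, p z.2 :=
  Measure.quasiMeasurePreserving_snd.ae h

lemma tensorFun_inner (f f' : Lp ℂ 2 μ) (g g' : Lp ℂ 2 ν) :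
    inner ℂ (tensorFun f g) (tensorFun f' g') = inner ℂ f f' * inner ℂ g g' := by
  rw [L2.inner_def, L2.inner_def, L2.inner_def, ← integral_prod_mul]
  refine integral_congr_ae ?_
  filter_upwards [coeFn_tensorFun f g, coeFn_tensorFun f' g'] with z h1 h2
  rw [h1, h2]
  simp only [RCLike.inner_apply, map_mul]
  ring

lemma norm_tensorFun (f : Lp ℂ 2 μ) (g : Lp ℂ 2 ν) : ‖tensorFun f g‖ = ‖f‖ * ‖g‖ := by
  have h1 : (‖tensorFun f g‖ : ℂ) ^ 2 = ((‖f‖ * ‖g‖ : ℝ) : ℂ) ^ 2 := by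
    have h := tensorFun_inner f f g g
    rw [inner_self_eq_norm_sq_to_K, inner_self_eq_norm_sq_to_K, inner_self_eq_norm_sq_to_K] at h
    simpa [mul_pow] using h
  have h2 : ‖tensorFun f g‖ ^ 2 = (‖f‖ * ‖g‖) ^ 2 := by exact_mod_cast h1
  exact (pow_left_inj₀ (norm_nonneg _) (by positivity) two_ne_zero).1 h2

/-- The tensor product of square integrable functions, as a continuous bilinear map. -/
def tensorL : Lp ℂ 2 μ →L[ℂ] Lp ℂ 2 ν →L[ℂ] Lp ℂ 2 (μ.prod ν) :=
  LinearMap.mkContinuous₂ (LinearMap.mk₂ ℂ tensorFun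
    (fun f f' g => by
      apply Lp.ext
      filter_upwards [coeFn_tensorFun (f + f') g, coeFn_tensorFun f g, coeFn_tensorFun f' g,
        Lp.coeFn_add (tensorFun f g) (tensorFun f' g), ae_fst (ν := ν) (Lp.coeFn_add f f')]
        with z h1 h2 h3 h4 h5
      simp only [h1, h4, Pi.add_apply, h2, h3, h5]; ring)
    (fun c f g => by
      apply Lp.ext
      filter_upwards [coeFn_tensorFun (c • f) g, coeFn_tensorFun f g,
        Lp.coeFn_smul c (tensorFun f g), ae_fst (ν := ν) (Lp.coeFn_smul c f)]
        with z h1 h2 h4 h5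
      simp only [h1, h4, Pi.smul_apply, h2, h5, smul_eq_mul]; ring)
    (fun f g g' => by
      apply Lp.ext
      filter_upwards [coeFn_tensorFun f (g + g'), coeFn_tensorFun f g, coeFn_tensorFun f g',
        Lp.coeFn_add (tensorFun f g) (tensorFun f g'), ae_snd (μ := μ) (Lp.coeFn_add g g')]
        with z h1 h2 h3 h4 h5
      simp only [h1, h4, Pi.add_apply, h2, h3, h5]; ring)
    (fun c f g => by
      apply Lp.ext
      filter_upwards [coeFn_tensorFun f (c • g), coeFn_tensorFun f g,
        Lp.coeFn_smul c (tensorFun f g), ae_snd (μ := μ) (Lp.coeFn_smul c g)]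
        with z h1 h2 h4 h5
      simp only [h1, h4, Pi.smul_apply, h2, h5, smul_eq_mul]; ring)) 1
    (fun f g => by
      change ‖tensorFun f g‖ ≤ _
      rw [norm_tensorFun, one_mul])

lemma tensorL_apply (f : Lp ℂ 2 μ) (g : Lp ℂ 2 ν) : tensorL f g = tensorFun f g := rfl

end TensorL2

section Totality

variable {α β : Type*} [MeasurableSpace α] [MeasurableSpace β] {μ : Measure α} {ν : Measure β}
  [SigmaFinite μ] [SigmaFinite ν]

/-- A square integrable function whose integrals over rectangles vanish is zero. -/
lemma ae_eq_zero_of_integral_rectangle {k : α × β → ℂ} (hk : MemLp k 2 (μ.prod ν))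
    (h : ∀ s t, MeasurableSet s → MeasurableSet t → μ s < ⊤ → ν t < ⊤ →
      ∫ z in s ×ˢ t, k z ∂μ.prod ν = 0) : k =ᵐ[μ.prod ν] 0 := by
  have h1 (i : ℕ) : k =ᵐ[(μ.prod ν).restrict (spanningSets μ i ×ˢ spanningSets ν i)] 0 := by
    set R := spanningSets μ i ×ˢ spanningSets ν i with hR
    have hRm : MeasurableSet R :=
      (measurableSet_spanningSets μ i).prod (measurableSet_spanningSets ν i)
    have hRf : (μ.prod ν) R < ⊤ := by
      rw [hR, Measure.prod_prod]
      exact ENNReal.mul_lt_top (measure_spanningSets_lt_top μ i) (measure_spanningSets_lt_top ν i)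
    have : IsFiniteMeasure ((μ.prod ν).restrict R) := ⟨by simpa using hRf⟩
    have hint : Integrable k ((μ.prod ν).restrict R) := (hk.restrict R).integrable one_le_two
    refine hint.ae_eq_zero_of_forall_setIntegral_eq_zero fun S hS _ => ?_
    have htot : ∫ z in R, k z ∂μ.prod ν = 0 :=
      h _ _ (measurableSet_spanningSets μ i) (measurableSet_spanningSets ν i)
        (measure_spanningSets_lt_top μ i) (measure_spanningSets_lt_top ν i)
    -- Rectangles are a generating π-system, and sets of vanishing integral are closed under
    -- complement and disjoint union once the total integral vanishes.
    induction S, hS using MeasurableSpace.induction_on_inter generateFrom_prod.symm isPiSystem_prod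
      with
    | empty => simp
    | basic S hS =>
      obtain ⟨s, hs, t, ht, rfl⟩ := hS
      rw [Measure.restrict_restrict (MeasurableSet.prod hs ht), hR, prod_inter_prod]
      exact h _ _ (hs.inter (measurableSet_spanningSets μ i))
        (ht.inter (measurableSet_spanningSets ν i))
        ((measure_mono inter_subset_right).trans_lt (measure_spanningSets_lt_top μ i))
        ((measure_mono inter_subset_right).trans_lt (measure_spanningSets_lt_top ν i))
    | compl S hS ih =>
      have h2 := integral_add_compl hS hint
      rw [ih (measure_lt_top _ _), zero_add] at h2
      rw [h2, htot]
    | iUnion f hd hf ih =>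
      rw [integral_iUnion hf hd hint.integrableOn]
      simp [fun i => ih i (measure_lt_top _ _)]
  have h2 : (⋃ i, spanningSets μ i ×ˢ spanningSets ν i) = univ := by
    refine eq_univ_of_forall fun z => ?_
    obtain ⟨i, hi⟩ := mem_iUnion.1 ((iUnion_spanningSets μ).symm ▸ mem_univ z.1)
    obtain ⟨j, hj⟩ := mem_iUnion.1 ((iUnion_spanningSets ν).symm ▸ mem_univ z.2)
    exact mem_iUnion.2 ⟨max i j, monotone_spanningSets μ (le_max_left i j) hi,
      monotone_spanningSets ν (le_max_right i j) hj⟩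
  rw [← Measure.restrict_univ (μ := μ.prod ν), ← h2]
  exact (ae_restrict_iUnion_iff _ _).2 h1

lemma dense_span_tensorL : Dense (Submodule.span ℂ
    (range fun z : Lp ℂ 2 μ × Lp ℂ 2 ν => tensorL z.1 z.2) : Set (Lp ℂ 2 (μ.prod ν))) := by
  rw [Submodule.dense_iff_topologicalClosure_eq_top, Submodule.topologicalClosure_eq_top_iff,
    Submodule.eq_bot_iff]
  intro k hk
  rw [Submodule.mem_orthogonal] at hk
  refine Lp.eq_zero_iff_ae_eq_zero.2 (ae_eq_zero_of_integral_rectangle (Lp.memLp k) fun s t hs ht hs' ht' => ?_)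
  set f : Lp ℂ 2 μ := indicatorConstLp 2 hs hs'.ne 1
  set g : Lp ℂ 2 ν := indicatorConstLp 2 ht ht'.ne 1
  have h1 := hk _ (Submodule.subset_span ⟨(f, g), rfl⟩)
  rw [L2.inner_def] at h1
  rw [← h1, ← integral_indicator (hs.prod ht)]
  refine integral_congr_ae ?_
  filter_upwards [coeFn_tensorFun f g, ae_fst (ν := ν) (indicatorConstLp_coeFn (p := 2) (hs := hs)
    (hμs := hs'.ne) (c := (1 : ℂ))), ae_snd (μ := μ) (indicatorConstLp_coeFn (p := 2) (hs := ht)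
    (hμs := ht'.ne) (c := (1 : ℂ)))] with z h2 h3 h4
  simp only [tensorL_apply, h2, f, g, h3, h4, RCLike.inner_apply]
  by_cases h5 : z.1 ∈ s <;> by_cases h6 : z.2 ∈ t <;> simp [indicator, h5, h6]

lemma dense_span_tensorL_of_dense {D₁ : Set (Lp ℂ 2 μ)} {D₂ : Set (Lp ℂ 2 ν)}
    (h₁ : Dense (Submodule.span ℂ D₁ : Set (Lp ℂ 2 μ)))
    (h₂ : Dense (Submodule.span ℂ D₂ : Set (Lp ℂ 2 ν))) :
    Dense (Submodule.span ℂ (image2 (fun f g => tensorL f g) D₁ D₂) :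
      Set (Lp ℂ 2 (μ.prod ν))) := by
  set S := (Submodule.span ℂ (image2 (fun f g => tensorL f g) D₁ D₂) :
    Submodule ℂ (Lp ℂ 2 (μ.prod ν))).topologicalClosure with hS
  have hcl : IsClosed (S : Set (Lp ℂ 2 (μ.prod ν))) := Submodule.isClosed_topologicalClosure _
  have hmem : ∀ f ∈ D₁, ∀ g ∈ D₂, tensorL f g ∈ S := fun f hf g hg =>
    Submodule.le_topologicalClosure _ (Submodule.subset_span ⟨f, hf, g, hg, rfl⟩)
  have hmem1 : ∀ f ∈ D₁, ∀ g, tensorL f g ∈ S := by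
    intro f hf g
    have h3 : Submodule.span ℂ D₂ ≤ S.comap
        (tensorL (μ := μ) (ν := ν) f : Lp ℂ 2 ν →ₗ[ℂ] Lp ℂ 2 (μ.prod ν)) :=
      Submodule.span_le.2 fun g hg => hmem f hf g hg
    exact (hcl.preimage (tensorL (μ := μ) (ν := ν) f).continuous).closure_subset_iff.2 h3 (h₂ g)
  have hmem2 : ∀ f g, tensorL f g ∈ S := by
    intro f g
    have h3 : Submodule.span ℂ D₁ ≤
        S.comap ((tensorL (μ := μ) (ν := ν)).flip g : Lp ℂ 2 μ →ₗ[ℂ] Lp ℂ 2 (μ.prod ν)) :=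
      Submodule.span_le.2 fun f hf => hmem1 f hf g
    exact (hcl.preimage ((tensorL (μ := μ) (ν := ν)).flip g).continuous).closure_subset_iff.2 h3
      (h₁ f)
  rw [Submodule.dense_iff_topologicalClosure_eq_top, ← hS, eq_top_iff]
  intro k _
  have h3 : Submodule.span ℂ (range fun z : Lp ℂ 2 μ × Lp ℂ 2 ν => tensorL z.1 z.2) ≤ S :=
    Submodule.span_le.2 (by rintro _ ⟨z, rfl⟩; exact hmem2 _ _)
  exact hcl.closure_subset_iff.2 h3 (dense_span_tensorL k)

end Totality

end LieQuant

namespace LieQuant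

/-! ### The density F -/

section Density

variable {n : ℕ} {G : Type*} [Group G] [TopologicalSpace G] [ChartedSpace (E n) G]
  [LieGroup (𝓡 n) ∞ G] [MeasurableSpace G] {m : Measure G} {O : Set (E n)}

omit [MeasurableSpace G] in
lemma continuous_adL : Continuous (adL (n := n) G) := by
  have := lieGroup_minSmoothness (n := n) (G := G)
  let L : E n →ₗ[ℝ] (E n →L[ℝ] E n) :=
    { toFun := adL G
      map_add' := fun X X' => ContinuousLinearMap.ext fun Y => add_lie
        (L := GroupLieAlgebra (𝓡 n) G) (M := GroupLieAlgebra (𝓡 n) G) X X' Y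
      map_smul' := adL_smul }
  exact L.continuous_of_finiteDimensional

variable [T2Space G] (hO : IsWeaklyExponential m O)
include hO

lemma AdL_mul (g h : G) : AdL (n := n) (g * h) = (AdL g).comp (AdL h) := by
  simp only [AdL_eq_adChart hO, adChart_mul hO]

lemma AdL_one : AdL (n := n) (1 : G) = .id ℝ (E n) := by
  rw [AdL_eq_adChart hO, adChart_one hO]

lemma det_AdL_mul (g h : G) :
    (AdL (n := n) (g * h)).det = (AdL (n := n) g).det * (AdL (n := n) h).det := by
  rw [AdL_mul hO]
  exact LinearMap.det_comp ((AdL g : E n →L[ℝ] E n) : E n →ₗ[ℝ] E n)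
    ((AdL h : E n →L[ℝ] E n) : E n →ₗ[ℝ] E n)

lemma det_AdL_one : (AdL (n := n) (1 : G)).det = 1 := by
  rw [AdL_one hO]; exact LinearMap.det_id

lemma det_AdL_ne_zero (g : G) : (AdL (n := n) g).det ≠ 0 := fun h => by
  have := det_AdL_mul (n := n) hO g g⁻¹
  rw [mul_inv_cancel, det_AdL_one hO, h, zero_mul] at this
  exact one_ne_zero this

lemma continuous_det_AdL_lexp : Continuous fun X : E n => (AdL (n := n) (lexp X : G)).det := by
  simp only [AdL_eq_adChart hO, adChart_lexp hO]
  have h : Continuous fun X : E n => NormedSpace.exp ((1 : ℝ) • adL G X) :=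
    continuous_exp_smul.comp (continuous_adL.prodMk continuous_const)
  simp only [one_smul] at h
  exact ContinuousLinearMap.continuous_det.comp h

omit [T2Space G] hO [MeasurableSpace G] in
lemma continuous_det_phiAd : Continuous fun X : E n => (phiAd G X).det :=
  ContinuousLinearMap.continuous_det.comp (continuous_phiFun.comp continuous_adL)

lemma continuous_Fdens : Continuous (Fdens (n := n) G) :=
  (continuous_det_phiAd.mul ((continuous_det_AdL_lexp hO).comp
    (continuous_const_smul (1 / 2 : ℝ)))).abs.sqrt

omit [MeasurableSpace G] [T2Space G] hO in
lemma Fdens_nonneg (X : E n) : 0 ≤ Fdens G X := Real.sqrt_nonneg _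

omit [MeasurableSpace G] [T2Space G] hO in
lemma Fdens_sq (X : E n) : Fdens G X ^ 2 =
    |(phiAd G X).det| * |(AdL (n := n) (lexp ((1 / 2 : ℝ) • X) : G)).det| := by
  rw [Fdens, Real.sq_sqrt (abs_nonneg _), abs_mul]

lemma Fdens_pos {X : E n} (hX : X ∈ O) : 0 < Fdens G X := by
  refine Real.sqrt_pos.2 (abs_pos.2 (mul_ne_zero ?_ (det_AdL_ne_zero hO _)))
  rw [← dexp_eq_phiAd hO]
  exact det_dexp_ne_zero hO hX

/-- Passing to -X multiplies det φ(ad X) by det Ad_{exp X}, and exp X exp(-X/2) = exp(X/2). The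
Ad-factor in F thus makes F even, as compatibility of conjugation with adjoints requires. -/
lemma Fdens_neg (X : E n) : Fdens G (-X) = Fdens G X := by
  have h1 : (phiAd G (-X)).det = (AdL (n := n) (lexp X : G)).det * (phiAd G X).det := by
    rw [← dexp_eq_phiAd hO, ← dexp_eq_phiAd hO, dexp_neg hO, AdL_eq_adChart hO]
    exact LinearMap.det_comp (adChart O (lexp X : G) : E n →ₗ[ℝ] E n)
      (dexp G O X : E n →ₗ[ℝ] E n)
  rw [Fdens, Fdens, h1, mul_comm (ContinuousLinearMap.det _) (phiAd G X).det, mul_assoc,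
    ← det_AdL_mul hO]
  congr 4
  rw [← lexp_half_mul_half hO X, smul_neg, lexp_neg hO, mul_inv_cancel_right]

end Density

/-! ### The unitary correspondence between kernels and functions on G × 𝒪 -/

section Symmetrization

variable {n : ℕ} {G : Type*} [Group G] [TopologicalSpace G] [ChartedSpace (E n) G]
  [LieGroup (𝓡 n) ∞ G] [T2Space G] [IsTopologicalGroup G] [SecondCountableTopology G]
  [MeasurableSpace G] [BorelSpace G] {m : Measure G} {O : Set (E n)}

variable (G) in
/-- The change of variables `(q, X) ↦ (q exp(-X/2), q exp(X/2))`. -/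
def symMap (z : G × E n) : G × G :=
  (z.1 * (lexp ((1 / 2 : ℝ) • z.2))⁻¹, z.1 * lexp ((1 / 2 : ℝ) • z.2))

/-- The function `F(X) k(q exp(-X/2), q exp(X/2))` on `G × 𝒪` determined by a kernel `k`. -/
def symFun (O : Set (E n)) (k : G × G → ℂ) (z : G × E n) : ℂ :=
  O.indicator (fun X => (Fdens G X : ℂ) * k (symMap G (z.1, X))) z.2

/-- The logarithm on `𝒰`, extended by zero. -/
def logFun (O : Set (E n)) (g : G) : E n := (lexp (G := G) '' O).indicator (llog O) g

/-- The kernel that corresponds to a function on `G × 𝒪`. -/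
def unsymFun (O : Set (E n)) (u : G × E n → ℂ) (w : G × G) : ℂ :=
  {w : G × G | w.1⁻¹ * w.2 ∈ lexp (n := n) '' O}.indicator (fun w =>
    ((Fdens G (logFun (n := n) O (w.1⁻¹ * w.2)) : ℝ) : ℂ)⁻¹ *
      u (w.1 * lexp ((1 / 2 : ℝ) • logFun O (w.1⁻¹ * w.2)), logFun O (w.1⁻¹ * w.2))) w

variable (hO : IsWeaklyExponential m O)
include hO

omit [SecondCountableTopology G] [BorelSpace G] in
lemma continuous_symMap : Continuous (symMap (n := n) G) := by
  have h : Continuous fun z : G × E n => (lexp ((1 / 2 : ℝ) • z.2) : G) :=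
    (continuous_lexp hO).comp (by fun_prop)
  exact (continuous_fst.mul h.inv).prodMk (continuous_fst.mul h)

lemma measurable_symMap : Measurable (symMap (n := n) G) := by
  have h : Measurable fun z : G × E n => (lexp ((1 / 2 : ℝ) • z.2) : G) :=
    (measurable_lexp hO).comp (by fun_prop)
  exact (measurable_fst.mul h.inv).prodMk (measurable_fst.mul h)

lemma measurable_symFun {k : G × G → ℂ} (hk : Measurable k) : Measurable (symFun O k) := by
  have h1 : symFun O k = (Prod.snd ⁻¹' O).indicator
      fun z : G × E n => (Fdens G z.2 : ℂ) * k (symMap G z) := by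
    ext z; rfl
  rw [h1]
  refine Measurable.indicator ?_ (measurable_snd hO.isOpen.measurableSet)
  have h2 : Measurable fun z : G × E n => (Fdens G z.2 : ℂ) :=
    Complex.measurable_ofReal.comp ((continuous_Fdens hO).measurable.comp measurable_snd)
  exact h2.mul (hk.comp (measurable_symMap hO))

variable [m.IsHaarMeasure] [LocallyCompactSpace G]

lemma sigmaFinite_measX : SigmaFinite (measX n m) := by
  have h : measX n m = (unitDensity n m).toNNReal • volume := by
    rw [measX]
    conv_lhs => rw [← ENNReal.coe_toNNReal (unitDensity_spec hO).2.1]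
    rfl
  rw [h]
  infer_instance

/-- The symmetrization map takes the measure `F² dn` on `G × 𝒪` to the product measure. -/
lemma lintegral_symMap {f : G × G → ℝ≥0∞} (hf : Measurable f) :
    ∫⁻ w, f w ∂m.prod m =
      ∫⁻ z, (Prod.snd ⁻¹' O).indicator
        (fun z : G × E n => ENNReal.ofReal (Fdens G z.2 ^ 2) * f (symMap G z)) z ∂measN n m := by
  have := sigmaFinite_measX hO
  have hOm : MeasurableSet (Prod.snd ⁻¹' O : Set (G × E n)) :=
    measurable_snd hO.isOpen.measurableSet
  have hF : Measurable fun X : E n => ENNReal.ofReal (Fdens G X ^ 2) :=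
    ENNReal.measurable_ofReal.comp ((continuous_Fdens hO).measurable.pow_const 2)
  have hphi : Measurable fun X : E n => ENNReal.ofReal |(phiAd G X).det| :=
    ENNReal.measurable_ofReal.comp (continuous_det_phiAd (G := G)).abs.measurable
  have hlexp := measurable_lexp (G := G) hO
  have hG : Measurable fun z : G × E n =>
      ENNReal.ofReal |(phiAd G z.2).det| * f (z.1, z.1 * lexp z.2) :=
    (hphi.comp measurable_snd).mul (hf.comp (measurable_fst.prodMk
      (measurable_fst.mul (hlexp.comp measurable_snd))))
  rw [lintegral_prod _ hf.aemeasurable]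
  -- Substitute b = a exp X, interchange the integrals, then a = q exp(-X/2). The Jacobians |det
  -- φ(ad X)| and |det Ad_{exp(X/2)}| multiply to F².
  calc ∫⁻ a, ∫⁻ b, f (a, b) ∂m ∂m
      = ∫⁻ a, ∫⁻ X in O, ENNReal.ofReal |(phiAd G X).det| * f (a, a * lexp X) ∂(measX n m) ∂m := by
        refine lintegral_congr fun a => ?_
        rw [← lintegral_mul_left_eq_self (fun b => f (a, b)) a]
        exact lintegral_eq_lintegral_lexp hO (f := fun c => f (a, a * c)) (by fun_prop)
    _ = ∫⁻ X in O, ∫⁻ a, ENNReal.ofReal |(phiAd G X).det| * f (a, a * lexp X) ∂m ∂(measX n m) :=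
        lintegral_lintegral_swap hG.aemeasurable
    _ = ∫⁻ X in O, ∫⁻ q, ENNReal.ofReal (Fdens G X ^ 2) * f (symMap G (q, X)) ∂m ∂(measX n m) := by
        refine lintegral_congr fun X => ?_
        rw [lintegral_const_mul _ (by fun_prop : Measurable fun a => f (a, a * lexp X)),
          lintegral_const_mul _ (by
            exact hf.comp ((measurable_symMap hO).comp measurable_prodMk_right)),
          lintegral_mul_right hO (n := n) (lexp ((1 / 2 : ℝ) • X))⁻¹
            (by fun_prop : Measurable fun a => f (a, a * lexp X)), inv_inv, Fdens_sq,
          ENNReal.ofReal_mul (abs_nonneg _), mul_assoc]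
        congr 3
        ext1 q
        simp only [symMap]
        congr 2
        rw [mul_assoc, ← lexp_half_mul_half hO X, inv_mul_cancel_left]
    _ = ∫⁻ X, O.indicator (fun X =>
          ∫⁻ q, ENNReal.ofReal (Fdens G X ^ 2) * f (symMap G (q, X)) ∂m) X ∂(measX n m) := by
        rw [lintegral_indicator hO.isOpen.measurableSet]
    _ = _ := by
        rw [measN, lintegral_prod_symm]
        · refine lintegral_congr fun X => ?_
          by_cases hX : X ∈ O
          · simp [indicator, hX]
          · simp [indicator, hX]
        · exact (((hF.comp measurable_snd).mul (hf.comp (measurable_symMap hO))).indicator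
            hOm).aemeasurable

/-- As F is positive on 𝒪, a null set of pairs has a preimage that is null inside G × 𝒪.
Symmetrization is therefore well defined on classes. -/
lemma ae_symMap {p : G × G → Prop} (h : ∀ᵐ w ∂m.prod m, p w) :
    ∀ᵐ z ∂measN n m, z.2 ∈ O → p (symMap G z) := by
  set T := toMeasurable (m.prod m) {w | ¬ p w} with hT
  have hT0 : (m.prod m) T = 0 := by rw [hT, measure_toMeasurable]; exact h
  have hTm : MeasurableSet T := measurableSet_toMeasurable _ _
  have h1 := lintegral_symMap hO (f := T.indicator 1) (measurable_one.indicator hTm)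
  rw [lintegral_indicator_one hTm, hT0, eq_comm, lintegral_eq_zero_iff] at h1
  · filter_upwards [h1] with z hz hzO
    by_contra hp
    have h2 : symMap G z ∈ T := subset_toMeasurable _ _ hp
    have h3 : z ∈ (Prod.snd ⁻¹' O : Set (G × E n)) := hzO
    rw [indicator_of_mem h3, indicator_of_mem h2] at hz
    have h4 := Fdens_pos hO hzO
    simp at hz
    exact absurd hz h4.ne'
  · refine Measurable.indicator ?_ (measurable_snd hO.isOpen.measurableSet)
    exact (ENNReal.measurable_ofReal.comp (((continuous_Fdens hO).measurable.comp
      measurable_snd).pow_const 2)).mul ((measurable_one.indicator hTm).comp (measurable_symMap hO))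

lemma eLpNorm_symFun {k : G × G → ℂ} (hk : Measurable k) :
    eLpNorm (symFun O k) 2 (measN n m) = eLpNorm k 2 (m.prod m) := by
  rw [eLpNorm_eq_lintegral_rpow_enorm_toReal two_ne_zero ENNReal.ofNat_ne_top,
    eLpNorm_eq_lintegral_rpow_enorm_toReal two_ne_zero ENNReal.ofNat_ne_top]
  congr 1
  rw [lintegral_symMap hO (by fun_prop : Measurable fun w => ‖k w‖ₑ ^ (2 : ℝ≥0∞).toReal)]
  refine lintegral_congr fun z => ?_
  by_cases hz : z.2 ∈ O
  · have h3 : z ∈ (Prod.snd ⁻¹' O : Set (G × E n)) := hz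
    rw [indicator_of_mem h3, symFun, indicator_of_mem hz, enorm_mul,
      ENNReal.mul_rpow_of_nonneg _ _ (by simp)]
    congr 1
    rw [ENNReal.ofReal_pow (Fdens_nonneg _)]
    simp only [ENNReal.toReal_ofNat, ENNReal.rpow_ofNat]
    congr 1
    rw [← ofReal_norm_eq_enorm, Complex.norm_real, Real.norm_of_nonneg (Fdens_nonneg _)]
  · have h3 : z ∉ (Prod.snd ⁻¹' O : Set (G × E n)) := hz
    rw [indicator_of_notMem h3, symFun, indicator_of_notMem hz]
    simp

lemma memLp_symFun (k : Lp ℂ 2 (m.prod m)) : MemLp (symFun O k) 2 (measN n m) :=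
  ⟨(measurable_symFun hO (Lp.stronglyMeasurable k).measurable).aestronglyMeasurable, by
    rw [eLpNorm_symFun hO (Lp.stronglyMeasurable k).measurable]; exact Lp.eLpNorm_lt_top k⟩

/-- The isometry from `L²(G × G)` to `L²(G × 𝔤)` given by symmetrization. -/
def symL : Lp ℂ 2 (m.prod m) →ₗᵢ[ℂ] Lp ℂ 2 (measN n m) where
  toFun k := (memLp_symFun hO k).toLp _
  map_add' k k' := by
    apply Lp.ext
    filter_upwards [(memLp_symFun hO (k + k')).coeFn_toLp, (memLp_symFun hO k).coeFn_toLp,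
      (memLp_symFun hO k').coeFn_toLp, Lp.coeFn_add ((memLp_symFun hO k).toLp _)
        ((memLp_symFun hO k').toLp _), ae_symMap hO (Lp.coeFn_add k k')] with z h1 h2 h3 h4 h5
    rw [h1, h4, Pi.add_apply, h2, h3]
    by_cases hz : z.2 ∈ O
    · simp only [symFun, indicator_of_mem hz]
      rw [h5 hz, Pi.add_apply, mul_add]
    · simp [symFun, indicator_of_notMem hz]
  map_smul' c k := by
    apply Lp.ext
    filter_upwards [(memLp_symFun hO (c • k)).coeFn_toLp, (memLp_symFun hO k).coeFn_toLp,
      Lp.coeFn_smul c ((memLp_symFun hO k).toLp _), ae_symMap hO (Lp.coeFn_smul c k)]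
      with z h1 h2 h4 h5
    rw [h1, RingHom.id_apply, h4, Pi.smul_apply, h2]
    by_cases hz : z.2 ∈ O
    · simp only [symFun, indicator_of_mem hz]
      rw [h5 hz, Pi.smul_apply, smul_eq_mul, smul_eq_mul]
      ring
    · simp [symFun, indicator_of_notMem hz]
  norm_map' k := by
    change ‖(memLp_symFun hO k).toLp _‖ = ‖k‖
    rw [Lp.norm_toLp, eLpNorm_symFun hO (Lp.stronglyMeasurable k).measurable, Lp.norm_def]

lemma coeFn_symL (k : Lp ℂ 2 (m.prod m)) : symL hO k =ᵐ[measN n m] symFun O k :=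
  (memLp_symFun hO k).coeFn_toLp

lemma symL_toLp {k : G × G → ℂ} (hk : MemLp k 2 (m.prod m)) :
    symL hO (hk.toLp k) =ᵐ[measN n m] symFun O k := by
  filter_upwards [coeFn_symL hO (hk.toLp k), ae_symMap hO hk.coeFn_toLp] with z h1 h2
  rw [h1]
  by_cases hz : z.2 ∈ O
  · simp only [symFun, indicator_of_mem hz]
    rw [h2 hz]
  · simp [symFun, indicator_of_notMem hz]

lemma ae_notMem_closure_diff : ∀ᵐ z ∂measN n m, z.2 ∉ closure O \ O := by
  have := sigmaFinite_measX hO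
  refine ae_snd (μ := m) (ν := measX n m) (p := fun X => X ∉ closure O \ O) ?_
  have h : measX n m (closure O \ O) = 0 := by
    rw [measX, Measure.smul_apply, volume_closure_diff hO, smul_zero]
  exact measure_eq_zero_iff_ae_notMem.1 h

lemma symL_mem (k : Lp ℂ 2 (m.prod m)) : symL hO k ∈ L2O m O := by
  change ∀ᵐ z ∂measN n m, _
  filter_upwards [coeFn_symL hO k] with z h1 hz
  rw [h1, symFun, indicator_of_notMem fun h => hz (subset_closure h)]

omit [IsTopologicalGroup G] [SecondCountableTopology G] [LocallyCompactSpace G]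
  [m.IsHaarMeasure] in
lemma measurable_logFun : Measurable (logFun (n := n) (G := G) O) := by
  refine measurable_of_restrict_of_restrict_compl hO.isOpen_image.measurableSet ?_ ?_
  · have h1 : Continuous ((lexp (n := n) (G := G) '' O).domRestrict (llog (G := G) O)) :=
      continuousOn_iff_continuous_domRestrict.1 hO.smooth_inv.continuousOn
    rw [show (lexp (n := n) (G := G) '' O).domRestrict (logFun O) =
      (lexp (n := n) (G := G) '' O).domRestrict (llog (G := G) O) from
      funext fun x => indicator_of_mem x.2 _]
    exact h1.measurable
  · rw [show (lexp (n := n) (G := G) '' O)ᶜ.domRestrict (logFun O) = fun _ => 0 from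
      funext fun x => indicator_of_notMem x.2 _]
    exact measurable_const

omit [IsTopologicalGroup G] [SecondCountableTopology G] [LocallyCompactSpace G]
  [m.IsHaarMeasure] [T2Space G] [LieGroup (𝓡 n) ∞ G] [BorelSpace G] in
lemma logFun_lexp {X : E n} (hX : X ∈ O) : logFun O (lexp X : G) = X := by
  rw [logFun, indicator_of_mem (mem_image_of_mem _ hX), llog_lexp hO hX]

omit [LocallyCompactSpace G] [m.IsHaarMeasure] in
lemma measurable_unsymFun {u : G × E n → ℂ} (hu : Measurable u) : Measurable (unsymFun O u) := by
  have hV : Measurable fun w : G × G => logFun (n := n) O (w.1⁻¹ * w.2) :=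
    (measurable_logFun hO).comp (measurable_fst.inv.mul measurable_snd)
  have h1 : Measurable fun w : G × G =>
      ((Fdens G (logFun (n := n) O (w.1⁻¹ * w.2)) : ℝ) : ℂ)⁻¹ :=
    (Complex.measurable_ofReal.comp ((continuous_Fdens hO).measurable.comp hV)).inv
  have h2 : Measurable fun w : G × G => (lexp ((1 / 2 : ℝ) • logFun (n := n) O (w.1⁻¹ * w.2)) : G) :=
    (measurable_lexp hO).comp (hV.fun_const_smul (1 / 2 : ℝ))
  have h3 : Measurable fun w : G × G => (w.1 * lexp ((1 / 2 : ℝ) • logFun (n := n) O (w.1⁻¹ * w.2)),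
      logFun (n := n) O (w.1⁻¹ * w.2)) := (measurable_fst.mul h2).prodMk hV
  have h4 : MeasurableSet {w : G × G | w.1⁻¹ * w.2 ∈ lexp (n := n) '' O} :=
    (measurable_fst.inv.mul measurable_snd) hO.isOpen_image.measurableSet
  exact (h1.mul (hu.comp h3)).indicator h4

omit [IsTopologicalGroup G] [SecondCountableTopology G] [LocallyCompactSpace G]
  [m.IsHaarMeasure] [BorelSpace G] in
lemma symFun_unsymFun (u : G × E n → ℂ) {z : G × E n} (hz : z.2 ∈ O) :
    symFun O (unsymFun O u) z = u z := by
  have h3 : (symMap G z).1⁻¹ * (symMap G z).2 = lexp z.2 := by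
    simp only [symMap]
    rw [← lexp_half_mul_half hO z.2]
    group
  have h6 : (symMap G z).1 * lexp ((1 / 2 : ℝ) • z.2) = z.1 := by simp [symMap]
  have h7 : symMap G z ∈ {w : G × G | w.1⁻¹ * w.2 ∈ lexp (n := n) '' O} := by
    rw [mem_ofPred_eq, h3]; exact ⟨_, hz, rfl⟩
  have h8 : ((Fdens G z.2 : ℝ) : ℂ) ≠ 0 := by
    exact_mod_cast (Fdens_pos hO hz).ne'
  rw [symFun, indicator_of_mem hz, Prod.mk.eta, unsymFun, indicator_of_mem h7]
  rw [h3, logFun_lexp hO hz, h6, mul_inv_cancel_left₀ h8]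

/-- The support condition only speaks of the closure of 𝒪; as the boundary is null, u vanishes a.e.
off 𝒪 and the explicit inverse of the symmetrization applies. -/
lemma exists_symL_eq {u : Lp ℂ 2 (measN n m)} (hu : u ∈ L2O m O) : ∃ k, symL hO k = u := by
  have hum := (Lp.stronglyMeasurable u).measurable
  have hku : symFun O (unsymFun O u) =ᵐ[measN n m] u := by
    filter_upwards [hu, ae_notMem_closure_diff hO] with z h1 h2
    by_cases hz : z.2 ∈ O
    · exact symFun_unsymFun hO u hz
    · rw [symFun, indicator_of_notMem hz, h1 fun h => h2 ⟨h, hz⟩]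
  have hkL : MemLp (unsymFun O u) 2 (m.prod m) := by
    refine ⟨(measurable_unsymFun hO hum).aestronglyMeasurable, ?_⟩
    rw [← eLpNorm_symFun hO (measurable_unsymFun hO hum), eLpNorm_congr_ae hku]
    exact Lp.eLpNorm_lt_top u
  exact ⟨hkL.toLp _, Lp.ext ((symL_toLp hO hkL).trans hku)⟩

end Symmetrization

end LieQuant

namespace LieQuant

/-! ### Isometry of the inverse momentum Fourier transform -/

section InnerDense

variable {H H' : Type*} [NormedAddCommGroup H] [InnerProductSpace ℂ H] [CompleteSpace H]
  [NormedAddCommGroup H'] [InnerProductSpace ℂ H'] [CompleteSpace H']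

lemma inner_map_map_of_dense {T : H →L[ℂ] H'} {S : Set H}
    (hS : Dense (Submodule.span ℂ S : Set H))
    (h : ∀ x ∈ S, ∀ y ∈ S, inner ℂ (T x) (T y) = inner ℂ x y) (x y : H) :
    inner ℂ (T x) (T y) = inner ℂ x y := by
  have h1 : (ContinuousLinearMap.adjoint T).comp T = .id ℂ H := by
    refine ContinuousLinearMap.ext_on hS fun y hy => ?_
    refine hS.eq_of_inner_right (𝕜 := ℂ) fun v hv => ?_
    rw [ContinuousLinearMap.comp_apply, ContinuousLinearMap.adjoint_inner_right]
    induction hv using Submodule.span_induction with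
    | mem x hx => exact h x hx y hy
    | zero => simp
    | add a b _ _ ha hb => rw [map_add, inner_add_left, inner_add_left, ha, hb]
    | smul c a _ ha => rw [map_smul, inner_smul_left, inner_smul_left, ha]
  have h2 := DFunLike.congr_fun h1 y
  rw [ContinuousLinearMap.comp_apply, ContinuousLinearMap.id_apply] at h2
  rw [← ContinuousLinearMap.adjoint_inner_right, h2]

end InnerDense

section DenseFunctions

variable {n : ℕ} {G : Type*} [TopologicalSpace G] [ChartedSpace (E n) G]
  [IsManifold (𝓡 n) ∞ G] [T2Space G] [SigmaCompactSpace G] [LocallyCompactSpace G]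
  [MeasurableSpace G] [BorelSpace G] {m : Measure G} [IsFiniteMeasureOnCompacts m]

variable (n m) in
/-- The classes of the smooth compactly supported functions in `L²`. -/
def smoothCompact : Set (Lp ℂ 2 m) :=
  {f | ∃ φ : G → ℂ, ContMDiff (𝓡 n) 𝓘(ℝ, ℂ) ∞ φ ∧ HasCompactSupport φ ∧ f =ᵐ[m] φ}

/-- A square integrable function orthogonal to all test functions vanishes almost everywhere. -/
lemma dense_smoothCompact :
    Dense (Submodule.span ℂ (smoothCompact n m) : Set (Lp ℂ 2 m)) := by
  rw [Submodule.dense_iff_topologicalClosure_eq_top, Submodule.topologicalClosure_eq_top_iff,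
    Submodule.eq_bot_iff]
  intro k hk
  rw [Submodule.mem_orthogonal] at hk
  refine Lp.eq_zero_iff_ae_eq_zero.2 ?_
  refine ae_eq_zero_of_integral_contMDiff_smul_eq_zero (𝓡 n)
    ((Lp.memLp k).locallyIntegrable one_le_two) fun g hg hgc => ?_
  have hgc' : HasCompactSupport fun x => (g x : ℂ) := hgc.comp_left (g := ((↑) : ℝ → ℂ)) rfl
  have hg' : ContMDiff (𝓡 n) 𝓘(ℝ, ℂ) ∞ fun x => (g x : ℂ) :=
    (Complex.ofRealCLM.contDiff.contMDiff).comp hg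
  have hL : MemLp (fun x => (g x : ℂ)) 2 m := hg'.continuous.memLp_of_hasCompactSupport hgc'
  have h1 := hk _ (Submodule.subset_span ⟨_, hg', hgc', hL.coeFn_toLp⟩)
  rw [L2.inner_def] at h1
  rw [← h1]
  refine integral_congr_ae ?_
  filter_upwards [hL.coeFn_toLp] with x hx
  rw [hx, RCLike.inner_apply, Complex.conj_ofReal, Complex.real_smul, mul_comm]

end DenseFunctions

section Fourier

variable {n : ℕ} {G : Type*} [Group G] [TopologicalSpace G] [ChartedSpace (E n) G]
  [MeasurableSpace G] {m : Measure G}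

lemma measL_absolutelyContinuous (ħ : ℝ) : measL n m ħ ≪ m.prod (measP n m) :=
  Measure.smul_absolutelyContinuous

lemma ae_measL_fst [SFinite m] [SFinite (measP n m)] {ħ : ℝ} {p : G → Prop} (h : ∀ᵐ q ∂m, p q) :
    ∀ᵐ x ∂measL n m ħ, p x.1 :=
  (measL_absolutelyContinuous ħ).ae_le (ae_fst h)

lemma sFinite_measP : SFinite (measP n m) := by
  rw [measP]; infer_instance

lemma sFinite_measX : SFinite (measX n m) := by
  rw [measX]; infer_instance

lemma invFourier_congr [SFinite m] {ħ : ℝ} {u v : G × E n → ℂ} (h : u =ᵐ[measN n m] v) :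
    invFourier m ħ u =ᵐ[measL n m ħ] invFourier m ħ v := by
  have := sFinite_measP (n := n) (m := m)
  have := sFinite_measX (n := n) (m := m)
  filter_upwards [ae_measL_fst (ħ := ħ) (Measure.ae_ae_of_ae_prod h)] with x hx
  refine integral_congr_ae ?_
  filter_upwards [hx] with X hX
  rw [hX]

/-- The Fourier transform on the Lie algebra in terms of that on Euclidean space. -/
lemma integral_mul_exp_eq_fourier (ħ : ℝ) (s : E n → ℂ) (ξ : E n) :
    ∫ X, s X * Complex.exp (-(Complex.I / (ħ : ℂ)) *
        ((InnerProductSpace.toDual ℝ (E n) ξ X : ℝ) : ℂ)) ∂(measX n m) =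
      (unitDensity n m).toReal • FourierTransform.fourier s ((2 * Real.pi * ħ)⁻¹ • ξ) := by
  rw [measX, integral_smul_measure, Real.fourier_eq']
  congr 1
  refine integral_congr_ae (Eventually.of_forall fun X => ?_)
  simp only [InnerProductSpace.toDual_apply_apply, smul_eq_mul]
  rw [mul_comm]
  congr 2
  rw [inner_smul_right, real_inner_comm]
  push_cast
  rcases eq_or_ne (ħ : ℂ) 0 with h | h
  · simp [h]
  · have : (Real.pi : ℂ) ≠ 0 := by exact_mod_cast Real.pi_ne_zero
    field_simp

lemma integral_measP {ħ : ℝ} (hħ : ħ ≠ 0) (f : E n → ℂ) :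
    ∫ p, f ((2 * Real.pi * ħ)⁻¹ • (InnerProductSpace.toDual ℝ (E n)).symm p) ∂measP n m =
      ((unitDensity n m)⁻¹.toReal * |2 * Real.pi * ħ| ^ n) • ∫ ξ, f ξ := by
  have hE : MeasurableEmbedding (InnerProductSpace.toDual ℝ (E n)) :=
    (InnerProductSpace.toDual ℝ (E n)).toHomeomorph.measurableEmbedding
  rw [measP, integral_smul_measure, hE.integral_map, mul_smul]
  congr 1
  have h1 : (fun ξ : E n => f ((2 * Real.pi * ħ)⁻¹ • (InnerProductSpace.toDual ℝ (E n)).symm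
      (InnerProductSpace.toDual ℝ (E n) ξ))) =
      fun ξ => f ((2 * Real.pi * ħ)⁻¹ • ξ) := by
    ext1 ξ
    congr 2
    exact (InnerProductSpace.toDual ℝ (E n)).symm_apply_apply ξ
  rw [h1, Measure.integral_comp_smul, finrank_euclideanSpace_fin, inv_pow, inv_inv, abs_pow]

variable [LieGroup (𝓡 n) ∞ G] [T2Space G] [IsTopologicalGroup G] [SecondCountableTopology G]
  [BorelSpace G] [m.IsHaarMeasure] [LocallyCompactSpace G] {O : Set (E n)}
  (hO : IsWeaklyExponential m O)
include hO

lemma isAddHaarMeasure_measX : (measX n m).IsAddHaarMeasure :=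
  Measure.IsAddHaarMeasure.smul volume (unitDensity_spec hO).1 (unitDensity_spec hO).2.1

/-- The inverse momentum Fourier transform is isometric. -/
lemma inner_invFourier {ħ : ℝ} (hħ : ħ ≠ 0) {T : Lp ℂ 2 (measN n m) →L[ℂ] Lp ℂ 2 (measL n m ħ)}
    (hT : ∀ u : Lp ℂ 2 (measN n m), Integrable u (measN n m) →
      T u =ᵐ[measL n m ħ] invFourier m ħ u) (u v : Lp ℂ 2 (measN n m)) :
    inner ℂ (T u) (T v) = inner ℂ u v := by
  have := isAddHaarMeasure_measX hO
  have := sigmaFinite_measX hO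
  have := sFinite_measP (n := n) (m := m)
  have hmfd : IsManifold (𝓡 n) ∞ G := inferInstance
  -- Products of a test function on G and a Schwartz function are total and integrable. On them the
  -- integral formula applies and the claim reduces to Plancherel for Schwartz functions.
  have hS2 : Dense (Submodule.span ℂ
      (range (SchwartzMap.toLpCLM ℝ (E := E n) ℂ 2 (measX n m))) : Set (Lp ℂ 2 (measX n m))) :=
    (SchwartzMap.denseRange_toLpCLM (p := 2) ENNReal.ofNat_ne_top).mono Submodule.subset_span
  have hS := dense_span_tensorL_of_dense (dense_smoothCompact (n := n) (m := m)) hS2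
  refine inner_map_map_of_dense (T := T) hS ?_ u v
  have key (a : Lp ℂ 2 m) (ha : a ∈ smoothCompact n m) (s : SchwartzMap (E n) ℂ) :
      T (tensorL a (SchwartzMap.toLpCLM ℝ (E := E n) ℂ 2 (measX n m) s)) =ᵐ[measL n m ħ]
        fun x => a x.1 * ((unitDensity n m).toReal • FourierTransform.fourier (s : E n → ℂ)
          ((2 * Real.pi * ħ)⁻¹ • (InnerProductSpace.toDual ℝ (E n)).symm x.2)) := by
    set w : Lp ℂ 2 (measN n m) := tensorL a (SchwartzMap.toLpCLM ℝ (E := E n) ℂ 2 (measX n m) s)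
    have hw : w =ᵐ[measN n m] fun z => a z.1 * s z.2 := by
      filter_upwards [coeFn_tensorFun a (SchwartzMap.toLpCLM ℝ (E := E n) ℂ 2 (measX n m) s),
        ae_snd (μ := m) (SchwartzMap.coeFn_toLp s 2 (measX n m))] with z h1 h2
      rw [← h2]
      exact h1
    have hint : Integrable w (measN n m) := by
      obtain ⟨φ, hφ, hφc, haφ⟩ := ha
      have h1 : Integrable a m :=
        (hφ.continuous.integrable_of_hasCompactSupport hφc).congr haφ.symm
      exact (h1.mul_prod s.integrable).congr hw.symm
    refine (hT w hint).trans ((invFourier_congr hw).trans (Eventually.of_forall fun x => ?_))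
    simp only [invFourier]
    simp only [mul_assoc (a x.1)]
    rw [integral_const_mul, ← integral_mul_exp_eq_fourier, LinearIsometryEquiv.apply_symm_apply]
  rintro _ ⟨a, ha, _, ⟨s, rfl⟩, rfl⟩ _ ⟨a', ha', _, ⟨s', rfl⟩, rfl⟩
  change inner ℂ (T (tensorL a (SchwartzMap.toLpCLM ℝ (E := E n) ℂ 2 (measX n m) s)))
    (T (tensorL a' (SchwartzMap.toLpCLM ℝ (E := E n) ℂ 2 (measX n m) s'))) =
    inner ℂ (tensorFun a (SchwartzMap.toLpCLM ℝ (E := E n) ℂ 2 (measX n m) s))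
      (tensorFun a' (SchwartzMap.toLpCLM ℝ (E := E n) ℂ 2 (measX n m) s'))
  rw [tensorFun_inner, L2.inner_def]
  set h : E n → ℂ := fun ξ => ((unitDensity n m).toReal ^ 2 : ℝ) •
    inner ℂ (FourierTransform.fourier (s : E n → ℂ) ξ) (FourierTransform.fourier (s' : E n → ℂ) ξ)
    with hh
  have h1 : ∫ x, inner ℂ
      (T (tensorL a (SchwartzMap.toLpCLM ℝ (E := E n) ℂ 2 (measX n m) s)) x)
      (T (tensorL a' (SchwartzMap.toLpCLM ℝ (E := E n) ℂ 2 (measX n m) s')) x) ∂measL n m ħ =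
      ∫ x : G × StrongDual ℝ (E n), inner ℂ (a x.1) (a' x.1) *
        h ((2 * Real.pi * ħ)⁻¹ • (InnerProductSpace.toDual ℝ (E n)).symm x.2) ∂measL n m ħ := by
    refine integral_congr_ae ?_
    filter_upwards [key a ha s, key a' ha' s'] with x hx hx'
    rw [hx, hx']
    simp only [hh, RCLike.inner_apply, map_mul, Complex.real_smul, Complex.conj_ofReal]
    push_cast
    ring
  rw [h1, measL, integral_smul_measure, integral_prod_mul (fun q : G => inner ℂ (a q) (a' q))
      (fun p => h ((2 * Real.pi * ħ)⁻¹ • (InnerProductSpace.toDual ℝ (E n)).symm p)),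
    integral_measP hħ, hh, integral_smul,
    ← SchwartzMap.fourier_coe, ← SchwartzMap.fourier_coe,
    SchwartzMap.integral_inner_fourier_fourier, L2.inner_def, L2.inner_def]
  have h2 : ∫ X, inner ℂ (SchwartzMap.toLpCLM ℝ (E := E n) ℂ 2 (measX n m) s X)
      (SchwartzMap.toLpCLM ℝ (E := E n) ℂ 2 (measX n m) s' X) ∂measX n m =
      (unitDensity n m).toReal • ∫ X, inner ℂ (s X) (s' X) := by
    rw [← integral_smul_measure, ← measX]
    refine integral_congr_ae ?_
    filter_upwards [SchwartzMap.coeFn_toLp s 2 (measX n m),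
      SchwartzMap.coeFn_toLp s' 2 (measX n m)] with X h3 h4
    rw [← h3, ← h4]
    rfl
  -- Let c be the density of dX. The two transforms contribute c², the measure dp contributes c⁻¹,
  -- and the powers of |2πħ| cancel; what remains is the single c of dX.
  rw [h2]
  have h3 : (unitDensity n m).toReal ≠ 0 :=
    ENNReal.toReal_ne_zero.2 ⟨(unitDensity_spec hO).1, (unitDensity_spec hO).2.1⟩
  have h4 : |2 * Real.pi * ħ| ^ n ≠ 0 :=
    pow_ne_zero _ (abs_ne_zero.2 (mul_ne_zero (mul_ne_zero two_ne_zero Real.pi_ne_zero) hħ))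
  rw [ENNReal.toReal_ofReal (by positivity), ENNReal.toReal_inv]
  simp only [Complex.real_smul]
  have h3' : ((unitDensity n m).toReal : ℂ) ≠ 0 := by exact_mod_cast h3
  have h4' : ((|2 * Real.pi * ħ| ^ n : ℝ) : ℂ) ≠ 0 := by exact_mod_cast h4
  simp only [Complex.ofReal_mul, Complex.ofReal_inv]
  generalize ((|2 * Real.pi * ħ| ^ n : ℝ) : ℂ) = c at *
  push_cast
  field_simp

end Fourier

end LieQuant

namespace LieQuant

/-! ### The star product of elementary tensors -/

section HalfDensity

variable {n : ℕ} {G : Type*} [Group G] [TopologicalSpace G] [ChartedSpace (E n) G]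
  [LieGroup (𝓡 n) ∞ G] [T2Space G] [IsTopologicalGroup G] [SecondCountableTopology G]
  [MeasurableSpace G] [BorelSpace G] {m : Measure G} {O : Set (E n)}

variable (n) in
/-- The square root of `|det Ad|`. -/
def sqrtDetAd (g : G) : ℝ := Real.sqrt |(AdL (n := n) g).det|

variable (n) in
/-- The half density `|det Ad|^{1/2} dm`. -/
def halfMeasure (m : Measure G) : Measure G :=
  m.withDensity fun g => ENNReal.ofReal (sqrtDetAd n g)

/-- The measure `F² dX` on `𝒪`. -/
def sqMeasure (m : Measure G) (O : Set (E n)) : Measure (E n) :=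
  ((measX n m).restrict O).withDensity fun X => ENNReal.ofReal (Fdens G X ^ 2)

/-- The kernel `φ(a) conj ψ(b)`. -/
def kerFun (φ ψ : G → ℂ) (w : G × G) : ℂ := φ w.1 * starRingEnd ℂ (ψ w.2)

variable (hO : IsWeaklyExponential m O)
include hO

omit [IsTopologicalGroup G] [SecondCountableTopology G] [BorelSpace G] in
lemma sqrtDetAd_mul (g h : G) : sqrtDetAd n (g * h) = sqrtDetAd n g * sqrtDetAd n h := by
  rw [sqrtDetAd, det_AdL_mul hO, abs_mul, Real.sqrt_mul (abs_nonneg _)]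
  rfl

omit [SecondCountableTopology G] [BorelSpace G] in
lemma continuous_sqrtDetAd : Continuous (sqrtDetAd n : G → ℝ) := by
  let δ : G →* ℝ :=
    { toFun := sqrtDetAd n
      map_one' := by simp [sqrtDetAd, det_AdL_one hO]
      map_mul' := sqrtDetAd_mul hO }
  refine continuous_of_continuousAt_one δ ?_
  have h1 : ContinuousAt (fun g : G => Real.sqrt
      |(AdL (n := n) (lexp (llog (n := n) O g) : G)).det|) 1 := by
    have h2 := (contMDiffAt_llog hO (one_mem_image hO)).continuousAt
    exact ContinuousAt.comp (g := fun X : E n => Real.sqrt |(AdL (n := n) (lexp X : G)).det|)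
      (continuous_det_AdL_lexp hO).abs.sqrt.continuousAt h2
  refine h1.congr ?_
  filter_upwards [hO.isOpen_image.mem_nhds (one_mem_image hO)] with g hg
  rw [lexp_llog hg]
  rfl

lemma measurable_ofReal_sqrtDetAd : Measurable fun g : G => ENNReal.ofReal (sqrtDetAd n g) :=
  ENNReal.measurable_ofReal.comp (continuous_sqrtDetAd hO).measurable

omit [IsTopologicalGroup G] [SecondCountableTopology G] [BorelSpace G] in
lemma measurable_ofReal_Fdens_sq : Measurable fun X : E n => ENNReal.ofReal (Fdens G X ^ 2) :=
  ENNReal.measurable_ofReal.comp ((continuous_Fdens hO).measurable.pow_const 2)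

lemma lintegral_halfMeasure {f : G → ℝ≥0∞} (hf : Measurable f) :
    ∫⁻ g, f g ∂halfMeasure n m = ∫⁻ g, ENNReal.ofReal (sqrtDetAd n g) * f g ∂m := by
  rw [halfMeasure, lintegral_withDensity_eq_lintegral_mul _ (measurable_ofReal_sqrtDetAd hO) hf]
  rfl

variable [m.IsHaarMeasure] [LocallyCompactSpace G]

/-- Since exp X is the square of exp(X/2), the root of |det Ad_{exp X}| is exactly the Ad-factor of
F², and the other factor is the Haar density. -/
lemma map_lexp_sqMeasure : (sqMeasure m O).map lexp = halfMeasure n m := by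
  refine Measure.ext_of_lintegral _ fun f hf => ?_
  have hg : Measurable fun g : G => ENNReal.ofReal (sqrtDetAd n g) * f g :=
    (measurable_ofReal_sqrtDetAd hO).mul hf
  rw [lintegral_map hf (measurable_lexp hO), sqMeasure,
    lintegral_withDensity_eq_lintegral_mul _ (measurable_ofReal_Fdens_sq hO)
      (g := fun X => f (lexp X)) (hf.comp (measurable_lexp hO)),
    lintegral_halfMeasure hO hf, lintegral_eq_lintegral_lexp hO hg]
  refine lintegral_congr fun X => ?_
  have h1 : sqrtDetAd n (lexp X : G) = |(AdL (n := n) (lexp ((1 / 2 : ℝ) • X) : G)).det| := by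
    rw [← lexp_half_mul_half hO X, sqrtDetAd, det_AdL_mul hO, abs_mul,
      Real.sqrt_mul_self (abs_nonneg _)]
  simp only [Pi.mul_apply]
  rw [h1, Fdens_sq, ENNReal.ofReal_mul (abs_nonneg _), mul_assoc]

lemma sFinite_sqMeasure : SFinite (sqMeasure m O) := by
  have := sigmaFinite_measX hO
  rw [sqMeasure]; infer_instance

lemma sFinite_halfMeasure : SFinite (halfMeasure n m) := by
  rw [halfMeasure]; infer_instance

/-- A twisted multiplication map takes `|det Ad|^{1/2} dm × |det Ad|^{1/2} dm` to
`dm × |det Ad|^{1/2} dm`. -/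
lemma map_mul_halfMeasure {s : G → G} (hs : Measurable s) :
    ((halfMeasure n m).prod (halfMeasure n m)).map (fun w => (s (w.1 * w.2) * w.1, w.1 * w.2)) =
      m.prod (halfMeasure n m) := by
  have := sFinite_halfMeasure hO
  have hδ := measurable_ofReal_sqrtDetAd hO
  have hΘ : Measurable fun w : G × G => (s (w.1 * w.2) * w.1, w.1 * w.2) := by fun_prop
  refine Measure.ext_of_lintegral _ fun f hf => ?_
  rw [lintegral_map hf hΘ, lintegral_prod (fun w : G × G => f (s (w.1 * w.2) * w.1, w.1 * w.2))
      (hf.comp hΘ).aemeasurable,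
    lintegral_prod_symm _ hf.aemeasurable]
  have h1 (c : G) : Measurable fun a : G => f (s c * a, c) := by fun_prop
  calc ∫⁻ a, ∫⁻ b, f (s (a * b) * a, a * b) ∂halfMeasure n m ∂halfMeasure n m
      = ∫⁻ a, ENNReal.ofReal (sqrtDetAd n a) *
          ∫⁻ b, ENNReal.ofReal (sqrtDetAd n b) * f (s (a * b) * a, a * b) ∂m ∂m := by
        rw [lintegral_halfMeasure hO (Measurable.lintegral_prod_right (by fun_prop))]
        refine lintegral_congr fun a => ?_
        rw [lintegral_halfMeasure hO (by fun_prop)]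
    -- Substitute c = ab by left invariance; multiplicativity merges the two half densities into
    -- that of c.
    _ = ∫⁻ a, ∫⁻ c, ENNReal.ofReal (sqrtDetAd n c) * f (s c * a, c) ∂m ∂m := by
        refine lintegral_congr fun a => ?_
        rw [← lintegral_const_mul' _ _ ENNReal.ofReal_ne_top,
          ← lintegral_mul_left_eq_self
            (fun c => ENNReal.ofReal (sqrtDetAd n c) * f (s c * a, c)) a]
        refine lintegral_congr fun b => ?_
        rw [sqrtDetAd_mul hO, ENNReal.ofReal_mul (p := sqrtDetAd n a) (Real.sqrt_nonneg _),
          mul_assoc]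
    _ = ∫⁻ c, ∫⁻ a, ENNReal.ofReal (sqrtDetAd n c) * f (s c * a, c) ∂m ∂m :=
        lintegral_lintegral_swap (by
          exact ((hδ.comp measurable_snd).mul (by fun_prop)).aemeasurable)
    _ = ∫⁻ c, ENNReal.ofReal (sqrtDetAd n c) * ∫⁻ a, f (a, c) ∂m ∂m := by
        refine lintegral_congr fun c => ?_
        rw [lintegral_const_mul _ (h1 c), lintegral_mul_left_eq_self (fun a => f (a, c))]
    _ = ∫⁻ c, ∫⁻ a, f (a, c) ∂m ∂halfMeasure n m :=
        (lintegral_halfMeasure hO (f := fun c => ∫⁻ a, f (a, c) ∂m) hf.lintegral_prod_left').symm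

lemma integral_sqMeasure (f : E n → ℂ) :
    ∫ X, f X ∂sqMeasure m O = ∫ X, O.indicator (fun X => ((Fdens G X ^ 2 : ℝ) : ℂ) * f X) X
      ∂measX n m := by
  rw [sqMeasure, integral_withDensity_eq_integral_toReal_smul (measurable_ofReal_Fdens_sq hO)
    (Eventually.of_forall fun _ => ENNReal.ofReal_lt_top),
    integral_indicator hO.isOpen.measurableSet]
  refine integral_congr_ae (Eventually.of_forall fun X => ?_)
  simp only [ENNReal.toReal_ofReal (sq_nonneg _), Complex.real_smul]

lemma integral_sqMeasure_prod (f : E n × E n → ℂ) :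
    ∫ z, f z ∂(sqMeasure m O).prod (sqMeasure m O) =
      ∫ z, (O ×ˢ O).indicator (fun z => ((Fdens G z.1 ^ 2 * Fdens G z.2 ^ 2 : ℝ) : ℂ) * f z) z
        ∂(measX n m).prod (measX n m) := by
  have := sigmaFinite_measX hO
  have hF := measurable_ofReal_Fdens_sq (G := G) hO
  rw [sqMeasure, prod_withDensity hF hF, Measure.prod_restrict,
    integral_withDensity_eq_integral_toReal_smul
      (f := fun z : E n × E n =>
        ENNReal.ofReal (Fdens G z.1 ^ 2) * ENNReal.ofReal (Fdens G z.2 ^ 2))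
      ((hF.comp measurable_fst).mul (hF.comp measurable_snd))
      (Eventually.of_forall fun _ => ENNReal.mul_lt_top ENNReal.ofReal_lt_top ENNReal.ofReal_lt_top),
    integral_indicator (hO.isOpen.measurableSet.prod hO.isOpen.measurableSet)]
  refine integral_congr_ae (Eventually.of_forall fun X => ?_)
  simp only [ENNReal.toReal_mul, ENNReal.toReal_ofReal (sq_nonneg _), Complex.real_smul]

/-- The star product of elementary tensors. -/
lemma starInt_kerFun (ħ : ℝ) {φ ψ φ' ψ' : G → ℂ} (hφ : Measurable φ) (hψ : Measurable ψ)
    (hφ' : Measurable φ') (hψ' : Measurable ψ') (x : G × StrongDual ℝ (E n)) :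
    starInt m O ħ (symFun O (kerFun φ ψ)) (symFun O (kerFun φ' ψ')) x =
      (∫ a, starRingEnd ℂ (ψ a) * φ' a ∂m) * invFourier m ħ (symFun O (kerFun φ ψ')) x := by
  have := sFinite_sqMeasure hO
  have := sFinite_halfMeasure hO
  obtain ⟨q, p⟩ := x
  set U := lexp (n := n) (G := G) '' O with hU
  -- For c in 𝒰, s(c) is the square root exp(½ log c). With c = exp X exp Y, the variable a = q
  -- s(c)⁻¹ exp X is the point at which ψ and φ' are both evaluated.
  set s : G → G := fun c => lexp ((1 / 2 : ℝ) • logFun O c) with hs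
  have hlog : Measurable (logFun (n := n) (G := G) O) := measurable_logFun hO
  have hsm : Measurable s := (measurable_lexp hO).comp (hlog.fun_const_smul (1 / 2 : ℝ))
  set χ : E n → ℂ := fun Z => Complex.exp (-(Complex.I / (ħ : ℂ)) * ((p Z : ℝ) : ℂ)) with hχ
  have hχm : Measurable χ := by
    have : Continuous χ := by
      simp only [hχ]
      fun_prop
    exact this.measurable
  -- The part of the integrand that depends on c alone; its integral against the half density is the
  -- inverse transform of φ ⊗ conj ψ'.
  set g : G → ℂ := U.indicator fun c => ((Fdens G (logFun O c) : ℝ) : ℂ)⁻¹ *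
    kerFun φ ψ' (q * (s c)⁻¹, q * s c) * χ (logFun O c) with hg
  have hgm : Measurable g := by
    refine Measurable.indicator ?_ hO.isOpen_image.measurableSet
    have h1 : Measurable fun c : G => ((Fdens G (logFun (n := n) O c) : ℝ) : ℂ)⁻¹ :=
      (Complex.measurable_ofReal.comp ((continuous_Fdens hO).measurable.comp hlog)).inv
    have h2 : Measurable fun c => kerFun φ ψ' (q * (s c)⁻¹, q * s c) :=
      (hφ.comp (measurable_const.mul hsm.inv)).mul
        (Complex.continuous_conj.measurable.comp (hψ'.comp (measurable_const.mul hsm)))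
    exact (h1.mul h2).mul (hχm.comp hlog)
  have hgX : ∫ c, g c ∂halfMeasure n m = invFourier m ħ (symFun O (kerFun φ ψ')) (q, p) := by
    rw [← map_lexp_sqMeasure hO, integral_map (measurable_lexp hO).aemeasurable
      hgm.aestronglyMeasurable, integral_sqMeasure hO]
    refine integral_congr_ae (Eventually.of_forall fun X => ?_)
    by_cases hX : X ∈ O
    · have h8 : ((Fdens G X : ℝ) : ℂ) ≠ 0 := by exact_mod_cast (Fdens_pos hO hX).ne'
      simp only [symFun, indicator_of_mem hX, hg]
      rw [indicator_of_mem (mem_image_of_mem _ hX)]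
      simp only [hs, logFun_lexp hO hX, symMap, hχ]
      push_cast
      field_simp
    · simp [symFun, indicator_of_notMem hX]
  set R : G × G → ℂ := fun w => (starRingEnd ℂ (ψ w.1) * φ' w.1) * g w.2 with hR
  have hRm : Measurable R :=
    ((Complex.continuous_conj.measurable.comp (hψ.comp measurable_fst)).mul
      (hφ'.comp measurable_fst)).mul (hgm.comp measurable_snd)
  have hΘ : Measurable fun w : G × G => (q * (s (w.1 * w.2))⁻¹ * w.1, w.1 * w.2) := by fun_prop
  -- The twist by q s(c)⁻¹ decouples a and c, so the double integral becomes a product. The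
  -- resulting weight F(X)²F(Y)²/F(X ⋄ Y) matches the two densities of the factors times L(X, Y).
  have h1 := map_mul_halfMeasure hO (n := n) (s := fun c => q * (s c)⁻¹) (by fun_prop)
  rw [← hgX, ← integral_prod_mul (fun a => starRingEnd ℂ (ψ a) * φ' a) g, ← h1,
    integral_map hΘ.aemeasurable hRm.aestronglyMeasurable, ← map_lexp_sqMeasure hO,
    Measure.map_prod_map _ _ (measurable_lexp hO) (measurable_lexp hO),
    integral_map (f := fun w : G × G => R (q * (s (w.1 * w.2))⁻¹ * w.1, w.1 * w.2))
      ((measurable_lexp hO).prodMap (measurable_lexp hO)).aemeasurable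
      (hRm.comp hΘ).aestronglyMeasurable, integral_sqMeasure_prod hO]
  refine integral_congr_ae (Eventually.of_forall fun ⟨X, Y⟩ => ?_)
  simp only
  by_cases hXY : (X, Y) ∈ O ×ˢ O
  swap
  · have h2 : (X, Y) ∉ bchDomain G O := fun h => hXY ⟨h.1, h.2.1⟩
    rw [indicator_of_notMem hXY, Lfac, if_neg h2]
    simp
  by_cases hc : (lexp X * lexp Y : G) ∈ U
  swap
  · have h2 : (X, Y) ∉ bchDomain G O := fun h => hc h.2.2
    rw [indicator_of_mem hXY, Lfac, if_neg h2]
    simp [hR, hg, indicator_of_notMem hc]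
  have h2 : (X, Y) ∈ bchDomain G O := ⟨hXY.1, hXY.2, hc⟩
  have hZ : logFun O (lexp X * lexp Y : G) = bch G O X Y := indicator_of_mem hc _
  have hZO : bch G O X Y ∈ O := llog_mem hc
  have hF : ((Fdens G (bch G O X Y) : ℝ) : ℂ) ≠ 0 := by exact_mod_cast (Fdens_pos hO hZO).ne'
  set Z := bch G O X Y
  set r : G := lexp ((1 / 2 : ℝ) • Z) with hr
  have hr' : (lexp (-(1 / 2 : ℝ) • Z) : G) = r⁻¹ := by rw [neg_smul, lexp_neg hO]
  have hY' : (lexp (-(1 / 2 : ℝ) • Y) : G) = (lexp ((1 / 2 : ℝ) • Y))⁻¹ := by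
    rw [neg_smul, lexp_neg hO]
  have hrr : r * r = lexp X * lexp Y := by rw [hr, lexp_half_mul_half hO]; exact lexp_llog hc
  -- With r = exp(½ X ⋄ Y), the first kernel is evaluated at (q r⁻¹, a) and the second at (a, q r),
  -- where a = q r⁻¹ exp X: the pattern of composition of kernels.
  have e1 : symMap G (q * r⁻¹ * lexp ((1 / 2 : ℝ) • X), X) = (q * r⁻¹, q * r⁻¹ * lexp X) := by
    simp only [symMap, mul_assoc (q * r⁻¹), mul_inv_cancel, mul_one, lexp_half_mul_half hO X]
  have e2 : symMap G (q * r * (lexp ((1 / 2 : ℝ) • Y))⁻¹, Y) = (q * r⁻¹ * lexp X, q * r) := by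
    have h3 : r * ((lexp ((1 / 2 : ℝ) • Y))⁻¹ * (lexp ((1 / 2 : ℝ) • Y))⁻¹) = r⁻¹ * lexp X := by
      rw [← mul_inv_rev, lexp_half_mul_half hO, eq_inv_mul_iff_mul_eq, ← mul_assoc, hrr,
        mul_inv_cancel_right]
    simp only [symMap, mul_assoc, h3, inv_mul_cancel, mul_one]
  have hL : Lfac G O X Y = Fdens G X * Fdens G Y / Fdens G Z := if_pos h2
  rw [indicator_of_mem hXY, hL, hr', hY']
  have hsr : s (lexp X * lexp Y) = r := by rw [hr, ← hZ]
  simp only [Prod.map_apply, symFun, indicator_of_mem hXY.1, indicator_of_mem hXY.2, e1, e2,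
    hR, hg, indicator_of_mem hc, hZ, hsr, kerFun, hχ]
  push_cast
  field_simp

end HalfDensity

end LieQuant

namespace LieQuant

/-! ### Smooth compactly supported kernels -/

section SmoothKernels

variable {n : ℕ} {G : Type*} [Group G] [TopologicalSpace G] [ChartedSpace (E n) G]
  [LieGroup (𝓡 n) ∞ G] [T2Space G] [IsTopologicalGroup G] [MeasurableSpace G]
  {m : Measure G} {O : Set (E n)}

omit [Group G] [LieGroup (𝓡 n) ∞ G] [T2Space G] [IsTopologicalGroup G] [MeasurableSpace G] in
lemma contMDiff_kerFun {φ ψ : G → ℂ} (hφ : ContMDiff (𝓡 n) 𝓘(ℝ, ℂ) ∞ φ)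
    (hψ : ContMDiff (𝓡 n) 𝓘(ℝ, ℂ) ∞ ψ) :
    ContMDiff ((𝓡 n).prod (𝓡 n)) 𝓘(ℝ, ℂ) ∞ (kerFun φ ψ) := by
  have h1 : ContDiff ℝ ∞ fun p : ℂ × ℂ => p.1 * starRingEnd ℂ p.2 :=
    contDiff_fst.mul (Complex.conjCLE.contDiff.comp contDiff_snd)
  exact h1.contMDiff.comp ((hφ.comp contMDiff_fst).prodMk_space (hψ.comp contMDiff_snd))

omit [Group G] [ChartedSpace (E n) G] [LieGroup (𝓡 n) ∞ G] [T2Space G] [IsTopologicalGroup G]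
  [MeasurableSpace G] in
lemma hasCompactSupport_kerFun [T2Space G] {φ ψ : G → ℂ} (hφ : HasCompactSupport φ)
    (hψ : HasCompactSupport ψ) : HasCompactSupport (kerFun φ ψ) := by
  refine HasCompactSupport.intro (hφ.isCompact.prod hψ.isCompact) fun w hw => ?_
  rw [mem_prod, not_and_or] at hw
  rcases hw with h | h
  · simp [kerFun, image_eq_zero_of_notMem_tsupport h]
  · simp [kerFun, image_eq_zero_of_notMem_tsupport h]

variable (hO : IsWeaklyExponential m O)
include hO

omit [IsTopologicalGroup G] in
lemma symMap_inv_mul (z : G × E n) : (symMap G z).1⁻¹ * (symMap G z).2 = lexp z.2 := by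
  simp only [symMap]
  rw [← lexp_half_mul_half hO z.2]
  group

omit [IsTopologicalGroup G] in
/-- Functions with smooth compactly supported kernel belong to `𝓕~(M)`. -/
lemma memFTilde_symFun {k : G × G → ℂ} (hk : ContMDiff ((𝓡 n).prod (𝓡 n)) 𝓘(ℝ, ℂ) ∞ k)
    (hkc : HasCompactSupport k) : MemFTilde O (symFun O k) := by
  refine ⟨fun q X hX => indicator_of_notMem hX _, k, hk, hkc, fun a b hab => ?_⟩
  have hV := llog_mem hab
  have h8 : ((Fdens G (llog O (a⁻¹ * b)) : ℝ) : ℂ) ≠ 0 := by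
    exact_mod_cast (Fdens_pos hO hV).ne'
  have h1 : symMap G (a * lexp ((1 / 2 : ℝ) • llog O (a⁻¹ * b)), llog O (a⁻¹ * b)) = (a, b) := by
    simp only [symMap, mul_assoc]
    rw [mul_inv_cancel, mul_one, lexp_half_mul_half hO, lexp_llog hab, mul_inv_cancel_left]
  rw [symFun, indicator_of_mem hV]
  simp only
  rw [h1]
  field_simp

-- Replacing X by -X exchanges the two points q exp(±X/2), and F is even.
omit [IsTopologicalGroup G] in
lemma conj_symFun_kerFun (φ ψ : G → ℂ) (q : G) (X : E n) :
    starRingEnd ℂ (symFun O (kerFun φ ψ) (q, X)) = symFun O (kerFun ψ φ) (q, -X) := by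
  by_cases hX : X ∈ O
  · have h1 : symMap G (q, -X) = ((symMap G (q, X)).2, (symMap G (q, X)).1) := by
      simp only [symMap, smul_neg, lexp_neg hO, inv_inv]
    simp only [symFun, indicator_of_mem hX, indicator_of_mem (neg_mem hO hX), h1, Fdens_neg hO,
      kerFun, map_mul, Complex.conj_conj, Complex.conj_ofReal]
    ring
  · have hX' : -X ∉ O := fun h => hX (by simpa using neg_mem hO h)
    simp only [symFun, indicator_of_notMem hX, indicator_of_notMem hX', map_zero]

variable [SecondCountableTopology G] [BorelSpace G] [m.IsHaarMeasure] [LocallyCompactSpace G]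

/-- On the support of k the element a⁻¹b = exp X stays in a compact set, so X ∈ 𝒪 stays in a compact
set by precompactness of log, and so does q = a exp(X/2). A continuous function is integrable there.
-/
lemma integrable_symFun {k : G × G → ℂ} (hk : Continuous k) (hkc : HasCompactSupport k) :
    Integrable (symFun O k) (measN n m) := by
  have := isAddHaarMeasure_measX hO
  have := sigmaFinite_measX hO
  set A : Set G := (fun w : G × G => w.1⁻¹ * w.2) '' tsupport k with hA
  have hAc : IsCompact A := hkc.isCompact.image (by fun_prop)
  set C : Set (E n) := closure (llog O '' (A ∩ lexp (n := n) '' O)) with hC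
  have hCc : IsCompact C := hO.precompact _ inter_subset_right
    (hAc.of_isClosed_subset isClosed_closure
      (closure_minimal inter_subset_left hAc.isClosed))
  set Q : Set G := (fun y : (G × G) × E n => y.1.1 * lexp ((1 / 2 : ℝ) • y.2)) ''
    (tsupport k ×ˢ C) with hQ
  have hexp : Continuous fun X : E n => (lexp ((1 / 2 : ℝ) • X) : G) :=
    (continuous_lexp hO).comp (by fun_prop)
  have hQc : IsCompact Q := (hkc.isCompact.prod hCc).image
    ((continuous_fst.comp continuous_fst).mul (hexp.comp continuous_snd))
  set f : G × E n → ℂ := fun z => (Fdens G z.2 : ℂ) * k (symMap G z) with hf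
  have hfc : Continuous f := (Complex.continuous_ofReal.comp ((continuous_Fdens hO).comp
    continuous_snd)).mul (hk.comp (continuous_symMap hO))
  have h1 : symFun O k = ((Q ×ˢ C) ∩ Prod.snd ⁻¹' O).indicator f := by
    ext z
    by_cases hz : z.2 ∈ O
    · rw [symFun, indicator_of_mem hz]
      by_cases hz2 : symMap G z ∈ tsupport k
      · have hzC : z.2 ∈ C := by
          refine subset_closure ⟨lexp z.2, ⟨⟨symMap G z, hz2, symMap_inv_mul hO z⟩, z.2, hz, rfl⟩, ?_⟩
          exact llog_lexp hO hz
        rw [indicator_of_mem]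
        refine ⟨⟨⟨(symMap G z, z.2), ⟨hz2, hzC⟩, ?_⟩, hzC⟩, hz⟩
        simp [symMap]
      · have h2 : k (symMap G z) = 0 := image_eq_zero_of_notMem_tsupport hz2
        have h3 : f z = 0 := by simp [hf, h2]
        rw [Prod.mk.eta, h2, mul_zero]
        exact (indicator_apply_eq_zero.2 fun _ => h3).symm
    · rw [symFun, indicator_of_notMem hz, indicator_of_notMem fun h => hz h.2]
  rw [h1]
  have h4 : MeasurableSet ((Q ×ˢ C) ∩ Prod.snd ⁻¹' O) :=
    (hQc.measurableSet.prod hCc.measurableSet).inter (measurable_snd hO.isOpen.measurableSet)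
  refine IntegrableOn.integrable_indicator ?_ h4
  have h5 : IntegrableOn f (Q ×ˢ C) (m.prod (measX n m)) :=
    hfc.continuousOn.integrableOn_compact (hQc.prod hCc)
  exact h5.mono_set inter_subset_left

/-- The substitution X ↦ -X undoes the conjugation of the phase, so conjugation of functions on M
transposes and conjugates the kernel. -/
lemma conj_invFourier_kerFun (ħ : ℝ) (φ ψ : G → ℂ) (x : G × StrongDual ℝ (E n)) :
    starRingEnd ℂ (invFourier m ħ (symFun O (kerFun φ ψ)) x) =
      invFourier m ħ (symFun O (kerFun ψ φ)) x := by
  have := isAddHaarMeasure_measX hO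
  rw [invFourier, invFourier, ← integral_conj, ← integral_neg_eq_self]
  refine integral_congr_ae (Eventually.of_forall fun X => ?_)
  simp only [map_mul, conj_symFun_kerFun hO, neg_neg, ← Complex.exp_conj, map_neg, map_div₀,
    Complex.conj_ofReal, Complex.conj_I]
  congr 2
  push_cast
  ring

end SmoothKernels

end LieQuant

namespace LieQuant

/-! ### Complex conjugation and density arguments -/

section Conjugation

variable {α : Type*} [MeasurableSpace α] {μ : Measure α}

/-- Complex conjugation on `L²`. -/
def conjLp : Lp ℂ 2 μ →L⋆[ℂ] Lp ℂ 2 μ :=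
  LinearMap.mkContinuous
    { toFun := star
      map_add' := fun f g => by
        apply Lp.ext
        filter_upwards [Lp.coeFn_star (f + g), Lp.coeFn_star f, Lp.coeFn_star g,
          Lp.coeFn_add f g, Lp.coeFn_add (star f) (star g)] with x h1 h2 h3 h4 h5
        rw [h1, h5, Pi.star_apply, h4, Pi.add_apply, Pi.add_apply, h2, h3, star_add,
          Pi.star_apply, Pi.star_apply]
      map_smul' := fun c f => by
        apply Lp.ext
        filter_upwards [Lp.coeFn_star (c • f), Lp.coeFn_star f,
          Lp.coeFn_smul c f, Lp.coeFn_smul (starRingEnd ℂ c) (star f)] with x h1 h2 h3 h4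
        rw [h1, h4, Pi.star_apply, h3, Pi.smul_apply, Pi.smul_apply, h2, star_smul,
          Pi.star_apply, starRingEnd_apply] } 1 fun f => by
    change ‖(star f : Lp ℂ 2 μ)‖ ≤ _
    rw [one_mul]
    refine Lp.norm_le_norm_of_ae_le ?_
    filter_upwards [Lp.coeFn_star f] with x hx
    rw [hx, Pi.star_apply, norm_star]

lemma coeFn_conjLp (f : Lp ℂ 2 μ) : conjLp f =ᵐ[μ] fun x => starRingEnd ℂ (f x) := Lp.coeFn_star f

lemma conjLp_conjLp (f : Lp ℂ 2 μ) : conjLp (conjLp f) = f := star_star f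

lemma inner_conjLp (f g : Lp ℂ 2 μ) : inner ℂ (conjLp f) (conjLp g) = inner ℂ g f := by
  rw [L2.inner_def, L2.inner_def]
  refine integral_congr_ae ?_
  filter_upwards [coeFn_conjLp f, coeFn_conjLp g] with x h1 h2
  simp only [h1, h2, RCLike.inner_apply, Complex.conj_conj, mul_comm]

lemma inner_eq_integral {f g : Lp ℂ 2 μ} {f₀ g₀ : α → ℂ} (hf : f =ᵐ[μ] f₀) (hg : g =ᵐ[μ] g₀) :
    inner ℂ f g = ∫ a, starRingEnd ℂ (f₀ a) * g₀ a ∂μ := by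
  rw [L2.inner_def]
  refine integral_congr_ae ?_
  filter_upwards [hf, hg] with a h3 h4
  rw [RCLike.inner_apply, h3, h4, mul_comm]

end Conjugation

section SpanInduction

lemma induction_of_dense_span {V : Type*} [NormedAddCommGroup V] [NormedSpace ℂ V] {S : Set V}
    (hS : Dense (Submodule.span ℂ S : Set V)) {p : V → Prop} (hcl : IsClosed {x | p x})
    (hmem : ∀ x ∈ S, p x) (h0 : p 0) (hadd : ∀ x y, p x → p y → p (x + y))
    (hsmul : ∀ (c : ℂ) x, p x → p (c • x)) (x : V) : p x := by
  refine hcl.closure_subset_iff.2 (fun v hv => ?_) (hS x)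
  induction hv using Submodule.span_induction with
  | mem x hx => exact hmem x hx
  | zero => exact h0
  | add x y _ _ hx hy => exact hadd x y hx hy
  | smul c x _ hx => exact hsmul c x hx

lemma mul_tensor_of_dense_span {K H : Type*} [NormedAddCommGroup K] [InnerProductSpace ℂ K]
    [NormedAddCommGroup H] [NormedSpace ℂ H] {S : Set K}
    (hS : Dense (Submodule.span ℂ S : Set K)) {B : H →L[ℂ] H →L[ℂ] H} {e : K →L[ℂ] K →L⋆[ℂ] H}
    (h : ∀ φ ∈ S, ∀ ψ ∈ S, ∀ φ' ∈ S, ∀ ψ' ∈ S,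
      B (e φ ψ) (e φ' ψ') = (inner ℂ ψ φ' : ℂ) • e φ ψ') (φ ψ φ' ψ' : K) :
    B (e φ ψ) (e φ' ψ') = (inner ℂ ψ φ' : ℂ) • e φ ψ' := by
  refine induction_of_dense_span hS
    (p := fun φ => B (e φ ψ) (e φ' ψ') = (inner ℂ ψ φ' : ℂ) • e φ ψ')
    (isClosed_eq (by fun_prop) (by fun_prop)) (fun φ hφ => ?_) (by simp)
    (fun x y hx hy => by simp only [map_add, add_apply, hx, hy, smul_add])
    (fun c x hx => by simp only [map_smul, smul_apply, hx, smul_comm c]) φ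
  refine induction_of_dense_span hS
    (p := fun ψ => B (e φ ψ) (e φ' ψ') = (inner ℂ ψ φ' : ℂ) • e φ ψ')
    (isClosed_eq (by fun_prop) (by fun_prop)) (fun ψ hψ => ?_) (by simp)
    (fun x y hx hy => by simp only [map_add, add_apply, hx, hy, inner_add_left, add_smul])
    (fun c x hx => by simp only [map_smul, map_smulₛₗ, smul_apply, hx, inner_smul_left,
      smul_smul]) ψ
  refine induction_of_dense_span hS
    (p := fun φ' => B (e φ ψ) (e φ' ψ') = (inner ℂ ψ φ' : ℂ) • e φ ψ')
    (isClosed_eq (by fun_prop) (by fun_prop)) (fun φ' hφ' => ?_) (by simp)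
    (fun x y hx hy => by simp only [map_add, add_apply, hx, hy, inner_add_right, add_smul])
    (fun c x hx => by simp only [map_smul, smul_apply, hx, inner_smul_right, smul_smul]) φ'
  exact induction_of_dense_span hS
    (p := fun ψ' => B (e φ ψ) (e φ' ψ') = (inner ℂ ψ φ' : ℂ) • e φ ψ')
    (isClosed_eq (by fun_prop) (by fun_prop)) (fun ψ' hψ' => h φ hφ ψ hψ φ' hφ' ψ' hψ') (by simp)
    (fun x y hx hy => by simp only [map_add, hx, hy, smul_add])
    (fun c x hx => by simp only [map_smul, map_smulₛₗ, hx, smul_comm (starRingEnd ℂ c)]) ψ'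

end SpanInduction

/-! ### 𝓛(M) as the Hilbert-Schmidt operators on L²(G) -/

section Kernel

variable {n : ℕ} {G : Type*} [Group G] [TopologicalSpace G] [ChartedSpace (E n) G]
  [LieGroup (𝓡 n) ∞ G] [T2Space G] [IsTopologicalGroup G] [SecondCountableTopology G]
  [MeasurableSpace G] [BorelSpace G] {m : Measure G} [m.IsHaarMeasure] [LocallyCompactSpace G]
  {O : Set (E n)} (hO : IsWeaklyExponential m O) {ħ : ℝ} (hħ : ħ ≠ 0)
  (hT : ∀ u : Lp ℂ 2 (measN n m), Integrable u (measN n m) →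
    invFourierL2 n m ħ u =ᵐ[measL n m ħ] invFourier m ħ u)
include hO hħ hT

/-- The unitary map that takes a kernel in `L²(G × G)` to the corresponding element of `𝓛(M)`. -/
def kernelEquiv : Lp ℂ 2 (m.prod m) ≃ₗᵢ[ℂ] hilbL m O ħ :=
  LinearIsometryEquiv.ofSurjective
    (LinearIsometry.mk (LinearMap.codRestrict (hilbL m O ħ)
      ((invFourierL2 n m ħ : Lp ℂ 2 (measN n m) →ₗ[ℂ] Lp ℂ 2 (measL n m ħ)) ∘ₗ
        (symL hO : Lp ℂ 2 (m.prod m) →ₗᵢ[ℂ] Lp ℂ 2 (measN n m)).toLinearMap)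
      fun k => ⟨_, symL_mem hO k, rfl⟩) fun k => by
        change ‖invFourierL2 n m ħ (symL hO k)‖ = ‖k‖
        rw [← LinearIsometry.norm_map (symL hO) k, norm_eq_sqrt_re_inner (𝕜 := ℂ),
          inner_invFourier hO hħ hT, ← norm_eq_sqrt_re_inner])
    (by
      rintro ⟨_, u, hu, rfl⟩
      obtain ⟨k, rfl⟩ := exists_symL_eq hO hu
      exact ⟨k, rfl⟩)

lemma coe_kernelEquiv (k : Lp ℂ 2 (m.prod m)) :
    (kernelEquiv hO hħ hT k : Lp ℂ 2 (measL n m ħ)) = invFourierL2 n m ħ (symL hO k) := rfl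

/-- As an isometric image of L²(G × G) the space is complete, hence closed in L²(M), which density
arguments inside it require. -/
lemma completeSpace_hilbL : CompleteSpace (hilbL m O ħ) :=
  (kernelEquiv hO hħ hT).symm.toIsometryEquiv.completeSpace

/-- The elements of `𝓛(M)` with kernel `φ(a) conj ψ(b)`. -/
def elemTensor : Lp ℂ 2 m →L[ℂ] Lp ℂ 2 m →L⋆[ℂ] hilbL m O ħ :=
  ((ContinuousLinearMap.compL ℂ (Lp ℂ 2 m) (Lp ℂ 2 (m.prod m)) (hilbL m O ħ)
    (kernelEquiv hO hħ hT).toContinuousLinearEquiv.toContinuousLinearMap).comp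
      tensorL).bilinearComp (.id ℂ _) conjLp

lemma elemTensor_apply (φ ψ : Lp ℂ 2 m) :
    elemTensor hO hħ hT φ ψ = kernelEquiv hO hħ hT (tensorL φ (conjLp ψ)) := rfl

lemma inner_elemTensor (φ ψ φ' ψ' : Lp ℂ 2 m) :
    inner ℂ (elemTensor hO hħ hT φ ψ) (elemTensor hO hħ hT φ' ψ') =
      inner ℂ φ φ' * inner ℂ ψ' ψ := by
  rw [elemTensor_apply, elemTensor_apply, LinearIsometryEquiv.inner_map_map, tensorL_apply,
    tensorL_apply, tensorFun_inner, inner_conjLp]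

lemma dense_span_elemTensor : Dense (Submodule.span ℂ
    (range fun z : Lp ℂ 2 m × Lp ℂ 2 m => elemTensor hO hħ hT z.1 z.2) : Set (hilbL m O ħ)) := by
  have h1 : range (fun z : Lp ℂ 2 m × Lp ℂ 2 m => elemTensor hO hħ hT z.1 z.2) =
      (kernelEquiv hO hħ hT).toLinearEquiv.toLinearMap ''
        range fun z : Lp ℂ 2 m × Lp ℂ 2 m => tensorL z.1 z.2 := by
    ext f
    constructor
    · rintro ⟨z, rfl⟩
      exact ⟨_, ⟨(z.1, conjLp z.2), rfl⟩, rfl⟩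
    · rintro ⟨_, ⟨z, rfl⟩, rfl⟩
      refine ⟨(z.1, conjLp z.2), ?_⟩
      change kernelEquiv hO hħ hT (tensorL z.1 (conjLp (conjLp z.2))) = _
      rw [conjLp_conjLp]
      rfl
  rw [h1, ← Submodule.map_span]
  exact (kernelEquiv hO hħ hT).surjective.denseRange.dense_image
    (kernelEquiv hO hħ hT).continuous dense_span_tensorL

lemma coeFn_elemTensor {φ ψ : Lp ℂ 2 m} {φ₀ ψ₀ : G → ℂ}
    (hφ : ContMDiff (𝓡 n) 𝓘(ℝ, ℂ) ∞ φ₀) (hφc : HasCompactSupport φ₀) (hφe : φ =ᵐ[m] φ₀)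
    (hψ : ContMDiff (𝓡 n) 𝓘(ℝ, ℂ) ∞ ψ₀) (hψc : HasCompactSupport ψ₀) (hψe : ψ =ᵐ[m] ψ₀) :
    (elemTensor hO hħ hT φ ψ : Lp ℂ 2 (measL n m ħ)) =ᵐ[measL n m ħ]
      invFourier m ħ (symFun O (kerFun φ₀ ψ₀)) := by
  have h1 : (tensorL φ (conjLp ψ) : Lp ℂ 2 (m.prod m)) =ᵐ[m.prod m] kerFun φ₀ ψ₀ := by
    filter_upwards [coeFn_tensorFun φ (conjLp ψ), ae_fst (ν := m) hφe, ae_snd (μ := m) hψe,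
      ae_snd (μ := m) (coeFn_conjLp ψ)] with w h1 h2 h3 h4
    rw [tensorL_apply, h1, h4, h2, h3]
    rfl
  have h2 : symL hO (tensorL φ (conjLp ψ)) =ᵐ[measN n m] symFun O (kerFun φ₀ ψ₀) := by
    filter_upwards [coeFn_symL hO (tensorL φ (conjLp ψ)), ae_symMap hO h1] with z h3 h4
    rw [h3]
    by_cases hz : z.2 ∈ O
    · simp only [symFun, indicator_of_mem hz]
      rw [h4 hz]
    · simp [symFun, indicator_of_notMem hz]
  have h3 : Integrable (symFun O (kerFun φ₀ ψ₀)) (measN n m) :=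
    integrable_symFun hO (contMDiff_kerFun hφ hψ).continuous (hasCompactSupport_kerFun hφc hψc)
  rw [elemTensor_apply, coe_kernelEquiv]
  exact (hT _ (h3.congr h2.symm)).trans (invFourier_congr h2)

lemma conj_elemTensor (φ ψ : Lp ℂ 2 m) :
    conjLp (elemTensor hO hħ hT φ ψ : Lp ℂ 2 (measL n m ħ)) = elemTensor hO hħ hT ψ φ := by
  have hS := dense_smoothCompact (n := n) (m := m)
  let j : hilbL m O ħ →L[ℂ] Lp ℂ 2 (measL n m ħ) := (hilbL m O ħ).subtypeL
  change conjLp (j (elemTensor hO hħ hT φ ψ)) = j (elemTensor hO hħ hT ψ φ)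
  refine induction_of_dense_span hS
    (p := fun φ => conjLp (j (elemTensor hO hħ hT φ ψ)) = j (elemTensor hO hħ hT ψ φ))
    (isClosed_eq (by fun_prop) (by fun_prop)) (fun φ hφ => ?_) (by simp)
    (fun x y hx hy => by simp only [map_add, add_apply, hx, hy])
    (fun c x hx => by simp only [map_smul, map_smulₛₗ, smul_apply, hx]) φ
  refine induction_of_dense_span hS
    (p := fun ψ => conjLp (j (elemTensor hO hħ hT φ ψ)) = j (elemTensor hO hħ hT ψ φ))
    (isClosed_eq (by fun_prop) (by fun_prop)) (fun ψ hψ => ?_) (by simp)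
    (fun x y hx hy => by simp only [map_add, add_apply, hx, hy])
    (fun c x hx => by simp only [map_smul, map_smulₛₗ, smul_apply, hx, Complex.conj_conj]) ψ
  obtain ⟨φ₀, hφ, hφc, hφe⟩ := hφ
  obtain ⟨ψ₀, hψ, hψc, hψe⟩ := hψ
  apply Lp.ext
  filter_upwards [coeFn_conjLp (j (elemTensor hO hħ hT φ ψ)),
    coeFn_elemTensor hO hħ hT hφ hφc hφe hψ hψc hψe,
    coeFn_elemTensor hO hħ hT hψ hψc hψe hφ hφc hφe] with x h1 h2 h3
  exact h1.trans ((congrArg _ h2).trans ((conj_invFourier_kerFun hO ħ φ₀ ψ₀ x).trans h3.symm))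

/-- Conjugation permutes the elementary tensors, which span a dense subspace of the closed space
𝓛(M). -/
lemma conjLp_mem_hilbL (f : hilbL m O ħ) :
    conjLp (f : Lp ℂ 2 (measL n m ħ)) ∈ hilbL m O ħ := by
  have := completeSpace_hilbL hO hħ hT
  have hcl : IsClosed (hilbL m O ħ : Set (Lp ℂ 2 (measL n m ħ))) :=
    (completeSpace_coe_iff_isComplete.1 this).isClosed
  refine induction_of_dense_span (dense_span_elemTensor hO hħ hT)
    (p := fun f => conjLp (f : Lp ℂ 2 (measL n m ħ)) ∈ hilbL m O ħ) ?_ ?_ ?_ ?_ ?_ f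
  · exact hcl.preimage (conjLp.continuous.comp continuous_subtype_val)
  · rintro _ ⟨z, rfl⟩
    rw [conj_elemTensor]
    exact Submodule.coe_mem _
  · simp
  · intro x y hx hy
    rw [Submodule.coe_add, map_add]
    exact add_mem hx hy
  · intro c x hx
    rw [Submodule.coe_smul, map_smulₛₗ]
    exact Submodule.smul_mem _ _ hx

lemma coe_conjL (f : hilbL m O ħ) :
    (conjL m O ħ f : Lp ℂ 2 (measL n m ħ)) = conjLp (f : Lp ℂ 2 (measL n m ħ)) := by
  have h : star (f : Lp ℂ 2 (measL n m ħ)) ∈ hilbL m O ħ := conjLp_mem_hilbL hO hħ hT f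
  rw [conjL, dif_pos h]
  rfl

lemma continuous_conjL : Continuous (conjL m O ħ) := by
  refine continuous_induced_rng.2 ?_
  have h : (Subtype.val ∘ conjL m O ħ) = fun f : hilbL m O ħ => conjLp (f : Lp ℂ 2 _) :=
    funext (coe_conjL hO hħ hT)
  rw [h]
  exact conjLp.continuous.comp continuous_subtype_val

lemma conjL_add (f g : hilbL m O ħ) : conjL m O ħ (f + g) = conjL m O ħ f + conjL m O ħ g :=
  Subtype.ext (by
    rw [coe_conjL hO hħ hT, Submodule.coe_add, Submodule.coe_add, map_add,
      coe_conjL hO hħ hT, coe_conjL hO hħ hT])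

lemma conjL_smul (c : ℂ) (f : hilbL m O ħ) :
    conjL m O ħ (c • f) = starRingEnd ℂ c • conjL m O ħ f :=
  Subtype.ext (by
    rw [coe_conjL hO hħ hT, Submodule.coe_smul, Submodule.coe_smul, map_smulₛₗ,
      coe_conjL hO hħ hT])

lemma conjL_elemTensor (φ ψ : Lp ℂ 2 m) :
    conjL m O ħ (elemTensor hO hħ hT φ ψ) = elemTensor hO hħ hT ψ φ :=
  Subtype.ext (by rw [coe_conjL hO hħ hT, conj_elemTensor])

-- These tensors lie in 𝓕(M), the only place where the star product is prescribed by an integral;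
-- there `starInt_kerFun` evaluates it.
set_option maxHeartbeats 1000000 in
lemma starL_elemTensor_of_smoothCompact (hB : ∀ (u v : G × E n → ℂ), MemFTilde O u → MemFTilde O v →
      ∀ f g : hilbL m O ħ,
        (f : Lp ℂ 2 (measL n m ħ)) =ᵐ[measL n m ħ] invFourier m ħ u →
        (g : Lp ℂ 2 (measL n m ħ)) =ᵐ[measL n m ħ] invFourier m ħ v →
        (starL m O ħ f g : Lp ℂ 2 (measL n m ħ)) =ᵐ[measL n m ħ] starInt m O ħ u v)
    {φ ψ φ' ψ' : Lp ℂ 2 m} (hφ : φ ∈ smoothCompact n m) (hψ : ψ ∈ smoothCompact n m)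
    (hφ' : φ' ∈ smoothCompact n m) (hψ' : ψ' ∈ smoothCompact n m) :
    starL m O ħ (elemTensor hO hħ hT φ ψ) (elemTensor hO hħ hT φ' ψ') =
      (inner ℂ ψ φ' : ℂ) • elemTensor hO hħ hT φ ψ' := by
  obtain ⟨φ₀, hφ, hφc, hφe⟩ := hφ
  obtain ⟨ψ₀, hψ, hψc, hψe⟩ := hψ
  obtain ⟨φ₀', hφ', hφc', hφe'⟩ := hφ'
  obtain ⟨ψ₀', hψ', hψc', hψe'⟩ := hψ'
  have hk := memFTilde_symFun hO (contMDiff_kerFun hφ hψ) (hasCompactSupport_kerFun hφc hψc)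
  have hk' := memFTilde_symFun hO (contMDiff_kerFun hφ' hψ') (hasCompactSupport_kerFun hφc' hψc')
  have h1 := hB _ _ hk hk' _ _ (coeFn_elemTensor hO hħ hT hφ hφc hφe hψ hψc hψe)
    (coeFn_elemTensor hO hħ hT hφ' hφc' hφe' hψ' hψc' hψe')
  have h2 : (inner ℂ ψ φ' : ℂ) = ∫ a, starRingEnd ℂ (ψ₀ a) * φ₀' a ∂m := by
    exact inner_eq_integral hψe hφe'
  have h5 := coeFn_elemTensor hO hħ hT hφ hφc hφe hψ' hψc' hψe'
  refine Subtype.ext (Lp.ext ?_)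
  rw [Submodule.coe_smul]
  filter_upwards [h1, Lp.coeFn_smul (inner ℂ ψ φ' : ℂ)
    (elemTensor hO hħ hT φ ψ' : Lp ℂ 2 (measL n m ħ)), h5]
    with x h3 h4 h5
  rw [h4, Pi.smul_apply, h5, h2, smul_eq_mul, ← starInt_kerFun hO ħ hφ.continuous.measurable
    hψ.continuous.measurable hφ'.continuous.measurable hψ'.continuous.measurable]
  exact h3

lemma starL_elemTensor (hB : ∀ (u v : G × E n → ℂ), MemFTilde O u → MemFTilde O v →
      ∀ f g : hilbL m O ħ,
        (f : Lp ℂ 2 (measL n m ħ)) =ᵐ[measL n m ħ] invFourier m ħ u →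
        (g : Lp ℂ 2 (measL n m ħ)) =ᵐ[measL n m ħ] invFourier m ħ v →
        (starL m O ħ f g : Lp ℂ 2 (measL n m ħ)) =ᵐ[measL n m ħ] starInt m O ħ u v)
    (φ ψ φ' ψ' : Lp ℂ 2 m) :
    starL m O ħ (elemTensor hO hħ hT φ ψ) (elemTensor hO hħ hT φ' ψ') =
      (inner ℂ ψ φ' : ℂ) • elemTensor hO hħ hT φ ψ' :=
  mul_tensor_of_dense_span (B := starL m O ħ) (e := elemTensor hO hħ hT)
    (dense_smoothCompact (n := n) (m := m)) (fun _ hφ _ hψ _ hφ' _ hψ' =>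
      starL_elemTensor_of_smoothCompact hO hħ hT hB hφ hψ hφ' hψ') φ ψ φ' ψ'

/-- `𝓛(M)` is a model of the Hilbert-Schmidt operators on `L²(G)`. -/
def hsModel (hB : ∀ (u v : G × E n → ℂ), MemFTilde O u → MemFTilde O v →
      ∀ f g : hilbL m O ħ,
        (f : Lp ℂ 2 (measL n m ħ)) =ᵐ[measL n m ħ] invFourier m ħ u →
        (g : Lp ℂ 2 (measL n m ħ)) =ᵐ[measL n m ħ] invFourier m ħ v →
        (starL m O ħ f g : Lp ℂ 2 (measL n m ħ)) =ᵐ[measL n m ħ] starInt m O ħ u v) :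
    HSModel (starL m O ħ) (conjL m O ħ) (Lp ℂ 2 m) :=
  haveI := completeSpace_hilbL hO hħ hT
  HSModel.ofTensor (elemTensor hO hħ hT) (inner_elemTensor hO hħ hT)
    (dense_span_elemTensor hO hħ hT) (starL_elemTensor hO hħ hT hB)
    (conjL_elemTensor hO hħ hT) (continuous_conjL hO hħ hT) (conjL_add hO hħ hT)
    (conjL_smul hO hħ hT)

end Kernel

end LieQuant

/-! ### The observables and their states -/

namespace LieQuant

lemma exists_bilinear_extension {P A : Type*} [SeminormedAddCommGroup P] [NormedSpace ℂ P]
    [NormedAddCommGroup A] [NormedSpace ℂ A] [CompleteSpace A] (β : P →ₗ[ℂ] P →ₗ[ℂ] A)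
    (hβ : ∀ x y, ‖β x y‖ ≤ ‖x‖ * ‖y‖) :
    ∃ L : UniformSpace.Completion P →L[ℂ] UniformSpace.Completion P →L[ℂ] A,
      ∀ x y : P, L x y = β x y := by
  let e : P →L[ℂ] UniformSpace.Completion P := UniformSpace.Completion.toComplL
  have he : DenseRange e := UniformSpace.Completion.denseRange_coe
  have he' : IsUniformInducing e := UniformSpace.Completion.isUniformInducing_coe P
  let b : P →L[ℂ] P →L[ℂ] A := β.mkContinuous₂ 1 fun x y => by rw [one_mul]; exact hβ x y
  let b₁ : UniformSpace.Completion P →L[ℂ] P →L[ℂ] A := b.extend e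
  refine ⟨(b₁.flip.extend e).flip, fun x y => ?_⟩
  change (b₁.flip.extend e) (e y) (e x) = _
  rw [ContinuousLinearMap.extend_eq _ he he', ContinuousLinearMap.flip_apply,
    ContinuousLinearMap.extend_eq _ he he']
  rfl

section Observables

variable {n : ℕ} {G : Type*} [Group G] [TopologicalSpace G] [ChartedSpace (E n) G]
  [LieGroup (𝓡 n) ∞ G] [MeasurableSpace G] {m : Measure G} {O : Set (E n)} {ħ : ℝ}

variable (m O ħ) in
/-- The embedding of `𝓛(M)` in `𝓐(M)`, as a linear map. -/
def toObsL : hilbL m O ħ →ₗ[ℂ] Obs m O ħ where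
  toFun := toObs m O ħ
  map_add' f g := UniformSpace.Completion.coe_add (α := PreObs m O ħ) f g
  map_smul' c f := UniformSpace.Completion.coe_smul (X := PreObs m O ħ) c f

lemma norm_toObs (f : hilbL m O ħ) : ‖toObs m O ħ f‖ = ‖starL m O ħ f‖ :=
  UniformSpace.Completion.norm_coe (E := PreObs m O ħ) f

lemma denseRange_toObs : DenseRange (toObs m O ħ) :=
  UniformSpace.Completion.denseRange_coe (α := PreObs m O ħ)

/-- If all left multiplications vanish, the norm is zero on the dense subspace, so the only
functional is 0. This disposes of the default values in the definitions. -/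
lemma states_eq_empty (h : ∀ f, starL m O ħ f = 0) : states m O ħ = ∅ := by
  refine eq_empty_of_forall_notMem fun Λ hΛ => ?_
  have h0 : Λ = 0 := by
    ext a
    refine denseRange_toObs.induction_on (p := fun a => Λ a = 0) a
      (isClosed_eq Λ.continuous continuous_const) fun f => ?_
    have h1 : toObs m O ħ f = 0 :=
      norm_eq_zero.1 ((norm_toObs f).trans ((congrArg norm (h f)).trans ContinuousLinearMap.opNorm_zero))
    rw [h1, map_zero]
  have h1 := hΛ.1
  rw [h0, norm_zero] at h1
  exact zero_ne_one h1

variable {K : Type*} [NormedAddCommGroup K] [InnerProductSpace ℂ K] [CompleteSpace K]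
  (M : HSModel (starL m O ħ) (conjL m O ħ) K)
include M

omit M in
variable (m O ħ) in
/-- The star product of `𝓛(M)` with values in `𝓐(M)`. -/
def starObs : hilbL m O ħ →ₗ[ℂ] hilbL m O ħ →ₗ[ℂ] Obs m O ħ :=
  (starL m O ħ).toLinearMap₁₂.compr₂ (toObsL m O ħ)

/-- Submultiplicativity of the norm gives a continuous bilinear extension, and by uniqueness it is
the product defined through dense extension. -/
lemma exists_mulObs_eq : ∃ L : Obs m O ħ →L[ℂ] Obs m O ħ →L[ℂ] Obs m O ħ,
    (∀ a b, mulObs m O ħ a b = L a b) ∧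
      ∀ f g, L (toObs m O ħ f) (toObs m O ħ g) = toObs m O ħ (starL m O ħ f g) := by
  obtain ⟨L, hL⟩ := exists_bilinear_extension (P := PreObs m O ħ) (starObs m O ħ) fun f g =>
    (norm_toObs (starL m O ħ f g)).trans_le (M.norm_mul_le f g)
  refine ⟨L, fun a b => ?_, hL⟩
  have h2 := (UniformSpace.Completion.isDenseInducing_coe (α := PreObs m O ħ).prodMap
    (UniformSpace.Completion.isDenseInducing_coe (α := PreObs m O ħ))).extend_unique
    (f := fun z : PreObs m O ħ × PreObs m O ħ => toObs m O ħ (starL m O ħ z.1 z.2))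
    (g := fun z : Obs m O ħ × Obs m O ħ => L z.1 z.2) (fun z => hL z.1 z.2) (by fun_prop)
  exact congrFun h2 (a, b)

/-- Conjugation preserves the norm, hence is uniformly continuous and extends to the completion. -/
lemma conjObs_spec : Continuous (conjObs m O ħ) ∧
    ∀ f, conjObs m O ħ (toObs m O ħ f) = toObs m O ħ (conjL m O ħ f) := by
  let c : PreObs m O ħ →+ Obs m O ħ :=
    { toFun := fun f => toObs m O ħ (conjL m O ħ f)
      map_zero' := by
        have h1 : conjL m O ħ 0 = 0 := by simpa using M.conj_smul 0 0
        exact (congrArg (toObsL m O ħ) h1).trans (map_zero _)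
      map_add' := fun f g =>
        (congrArg (toObsL m O ħ) (M.conj_add f g)).trans (map_add (toObsL m O ħ) _ _) }
  have hc : UniformContinuous c :=
    (AddMonoidHomClass.isometry_of_norm c fun f => by
      exact (norm_toObs _).trans (M.norm_conj f)).uniformContinuous
  have h1 : conjObs m O ħ = UniformSpace.Completion.extension c :=
    UniformSpace.Completion.isDenseInducing_coe.extend_unique
      (fun f => UniformSpace.Completion.extension_coe hc f)
      UniformSpace.Completion.continuous_extension
  rw [h1]
  exact ⟨UniformSpace.Completion.continuous_extension,
    fun f => UniformSpace.Completion.extension_coe hc f⟩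

/-- Positivity on the dense subspace passes to the completion, product and involution being
continuous. -/
lemma states_eq_stateSet : states m O ħ = M.stateSet (toObsL m O ħ) := by
  obtain ⟨L, hL, hL'⟩ := exists_mulObs_eq M
  obtain ⟨hc, hc'⟩ := conjObs_spec M
  ext Λ
  refine and_congr_right fun _ => ⟨fun h f => ?_, fun h a => ?_⟩
  · have h1 := h (toObs m O ħ f)
    rw [hc', hL, hL'] at h1
    exact h1
  · refine denseRange_toObs.induction_on
      (p := fun a => 0 ≤ Λ (mulObs m O ħ (conjObs m O ħ a) a)) a ?_ fun f => ?_
    · simp only [hL]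
      exact isClosed_le continuous_const (by fun_prop)
    · rw [hc', hL, hL']
      exact h f

lemma mem_extremePoints_states_iff {ρ : hilbL m O ħ} {Λ : Obs m O ħ →L[ℂ] ℂ}
    (hC : ∀ f : hilbL m O ħ,
      (conjL m O ħ f : Lp ℂ 2 (measL n m ħ)) = conjLp (f : Lp ℂ 2 (measL n m ħ)))
    (hΛ : Λ ∈ states m O ħ) (hρ : IsFunctionalOf m O ħ ρ Λ) :
    Λ ∈ extremePoints ℝ (states m O ħ) ↔ starL m O ħ ρ ρ = ρ := by
  rw [states_eq_stateSet M] at hΛ ⊢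
  refine M.mem_extremePoints_iff denseRange_toObs norm_toObs (fun f => (hρ f).trans ?_) hΛ
  -- The integral of f ρ is the inner product of conj f with ρ, the form tr(fρ) used in the abstract
  -- theorem.
  rw [Submodule.coe_inner, hC, L2.inner_def]
  refine integral_congr_ae ?_
  filter_upwards [coeFn_conjLp (f : Lp ℂ 2 (measL n m ħ))] with x hx
  simp only [hx, RCLike.inner_apply, Complex.conj_conj, mul_comm]

end Observables

end LieQuant

end

theorem theorem6 {n : ℕ} {G : Type*} [Group G] [TopologicalSpace G]
    [ChartedSpace (LieQuant.E n) G] [LieGroup (𝓡 n) ∞ G] [T2Space G] [SecondCountableTopology G]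
    [MeasurableSpace G] [BorelSpace G] (m : Measure G) [m.IsHaarMeasure]
    (O : Set (LieQuant.E n)) (hO : LieQuant.IsWeaklyExponential m O) (ħ : ℝ) (hħ : ħ ≠ 0)
    (ρ : LieQuant.hilbL m O ħ) (Λ : LieQuant.Obs m O ħ →L[ℂ] ℂ)
    (hΛ : Λ ∈ LieQuant.states m O ħ) (hρ : LieQuant.IsFunctionalOf m O ħ ρ Λ) :
    Λ ∈ Set.extremePoints ℝ (LieQuant.states m O ħ) ↔ LieQuant.starL m O ħ ρ ρ = ρ := by
  have : IsTopologicalGroup G := topologicalGroup_of_lieGroup (𝓡 n) ∞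
  have : LocallyCompactSpace G := ChartedSpace.locallyCompactSpace (LieQuant.E n) G
  -- Existence of the two continuous extensions need not be settled: if the transform does not
  -- exist, 𝓛(M) is zero, and if the star product does not exist, it is the zero map. In either case
  -- there are no states.
  by_cases hT : ∃ T : Lp ℂ 2 (LieQuant.measN n m) →L[ℂ] Lp ℂ 2 (LieQuant.measL n m ħ),
      ∀ u : Lp ℂ 2 (LieQuant.measN n m), Integrable u (LieQuant.measN n m) →
        T u =ᵐ[LieQuant.measL n m ħ] LieQuant.invFourier m ħ u
  · have hT' : ∀ u : Lp ℂ 2 (LieQuant.measN n m), Integrable u (LieQuant.measN n m) →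
        LieQuant.invFourierL2 n m ħ u =ᵐ[LieQuant.measL n m ħ] LieQuant.invFourier m ħ u := by
      rw [LieQuant.invFourierL2, dif_pos hT]
      exact hT.choose_spec
    by_cases hB : ∃ B : LieQuant.hilbL m O ħ →L[ℂ] LieQuant.hilbL m O ħ →L[ℂ] LieQuant.hilbL m O ħ,
        ∀ (u v : G × LieQuant.E n → ℂ), LieQuant.MemFTilde O u → LieQuant.MemFTilde O v →
          ∀ f g : LieQuant.hilbL m O ħ,
          (f : Lp ℂ 2 (LieQuant.measL n m ħ)) =ᵐ[LieQuant.measL n m ħ] LieQuant.invFourier m ħ u →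
          (g : Lp ℂ 2 (LieQuant.measL n m ħ)) =ᵐ[LieQuant.measL n m ħ] LieQuant.invFourier m ħ v →
          (B f g : Lp ℂ 2 (LieQuant.measL n m ħ)) =ᵐ[LieQuant.measL n m ħ]
            LieQuant.starInt m O ħ u v
    · have hB' : LieQuant.starL m O ħ = hB.choose := dif_pos hB
      exact LieQuant.mem_extremePoints_states_iff
        (LieQuant.hsModel hO hħ hT' (by rw [hB']; exact hB.choose_spec))
        (LieQuant.coe_conjL hO hħ hT') hΛ hρ
    · have hB' : LieQuant.starL m O ħ = 0 := dif_neg hB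
      rw [LieQuant.states_eq_empty fun f => by rw [hB', zero_apply]] at hΛ
      exact hΛ.elim
  · have hT' : LieQuant.invFourierL2 n m ħ = 0 := dif_neg hT
    have hsub (f : LieQuant.hilbL m O ħ) : f = 0 := by
      obtain ⟨u, _, hu⟩ := f.2
      refine Subtype.ext (hu.symm.trans ?_)
      change LieQuant.invFourierL2 n m ħ u = 0
      rw [hT', zero_apply]
    rw [LieQuant.states_eq_empty fun f => by
      rw [hsub f, map_zero]] at hΛ
    exact hΛ.elim
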